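/- **Theorem (28 circular loci among $X_1,\dots,X_{100}$).** Let $a>b>0$ and consider the elliptic billiard $(x/a)^2+(y/b)^2=1$, with foci $(\pm c,0)$, $c^2=a^2-b^2$. A *3-periodic* is a triangle $P_1P_2P_3$ inscribed in the ellipse which is a closed billiard trajectory (at every vertex the two sides make equal angles with the normal of the ellipse). Let $F$ be one of the foci and $\rho>0$. The *focus-inversive* triangle of a 3-periodic has as vertices the inversions $F+\rho^2\,(P_i-F)/|P_i-F|^2$ of the $P_i$ in the circle of center $F$ and radius $\rho$. For $k\ge 1$ let $X_k$ denote the $k$-th triangle center in Kimberling's Encyclopedia of Triangle Centers, and let $X_k^\dagger$ denote the center $X_k$ of the focus-inversive triangle. The *locus* of $X_k^\dagger$ is the set of all points $X_k^\dagger$ (when defined and finite) obtained as the triangle ranges over all 3-periodics of the billiard. Put $$K=\{1,2,3,4,5,8,9,10,11,12,20,21,35,36,40,46,55,56,57,63,65,72,78,79,80,84,90,100\},$$ a set of 28 indices. (i) For $1\le k\le 100$: the locus of $X_k^\dagger$ is a circle of positive radius for all billiards and all $\rho$, $F$, with at most finitely many exceptional values of the aspect ratio $a/b$, if and only if $k\in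 K$. (ii) More precisely, let $\delta=\sqrt{a^4-a^2b^2+b^4}$. For every $k\in K$, all $a>b>0$, every $\rho>0$ and either focus $F$, the locus of $X_k^\dagger$ is a full circle of positive radius whose center lies on the line of the major axis of the billiard; here, for $k=46$, the one aspect ratio given by $2a^2=(5-\sqrt5)\,b^2$ is excluded and, for $k=90$, the one given by $\delta\,(2a^2-b^2-\delta)=\sqrt2\,a^2(a^2-b^2)$ is excluded. -/

import Mathlib

open EuclideanGeometry

/-- The Euclidean plane. -/
abbrev Plane := EuclideanSpace ℝ (Fin 2)

noncomputable section

/-! ## Billiard 3-periodics -/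

/-- The boundary of the elliptic billiard with semi-axes `a` (along the first axis) and `b`. -/
def billiard (a b : ℝ) : Set Plane :=
  {P | (P 0 / a) ^ 2 + (P 1 / b) ^ 2 = 1}

/-- The two foci `(±c, 0)`, `c ^ 2 = a ^ 2 - b ^ 2`, of the billiard (for `a ≥ b`). -/
def foci (a b : ℝ) : Set Plane :=
  {F | F 0 ^ 2 = a ^ 2 - b ^ 2 ∧ F 1 = 0}

/-- A normal vector to the billiard at its point `P`. -/
def billiardNormal (a b : ℝ) (P : Plane) : Plane :=
  !₂[P 0 / a ^ 2, P 1 / b ^ 2]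

/-- The reflection law at `P` for a trajectory coming from `Q` and leaving towards `R`:
the segments `PQ` and `PR` make equal angles with the normal to the billiard at `P`. (It is only
used for distinct points `P`, `Q`, `R` of the billiard, so that the two segments lie on
opposite sides of the normal.) -/
def ReflectsAt (a b : ℝ) (Q P R : Plane) : Prop :=
  InnerProductGeometry.angle (Q -ᵥ P) (billiardNormal a b P) =
    InnerProductGeometry.angle (R -ᵥ P) (billiardNormal a b P)

/-- `P Q R` is a 3-periodic billiard trajectory: three distinct points of the billiard such that
the closed polygon `P Q R` obeys the reflection law at each vertex. -/
structure IsThreePeriodic (a b : ℝ) (P Q R : Plane) : Prop where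
  mem_P : P ∈ billiard a b
  mem_Q : Q ∈ billiard a b
  mem_R : R ∈ billiard a b
  ne_PQ : P ≠ Q
  ne_QR : Q ≠ R
  ne_RP : R ≠ P
  reflects_P : ReflectsAt a b R P Q
  reflects_Q : ReflectsAt a b P Q R
  reflects_R : ReflectsAt a b Q R P

/-! ## Triangle centers -/

/-- `trilinear k a b c A B C` is the first trilinear coordinate of the Kimberling center `X_k`,
`1 ≤ k ≤ 100`, of a triangle with sides `a`, `b`, `c` and opposite angles `A`, `B`, `C`; the other
two arise by cyclic permutation. Trilinears are homogeneous, and factors that may vanish are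
cleared from denominators by multiplying all three coordinates with the same factor: for instance
`sec A : sec B : sec C` is written as `cos B cos C : cos C cos A : cos A cos B`. The value for
other `k` is irrelevant. -/
def trilinear (k : ℕ) (a b c A B C : ℝ) : ℝ :=
  open Real in
  match k with
  | 1 => 1
  | 2 => b * c
  | 3 => cos A
  | 4 => cos B * cos C
  | 5 => cos (B - C)
  | 6 => a
  | 7 => b * c / (b + c - a)
  | 8 => b * c * (b + c - a)
  | 9 => b + c - a
  | 10 => b * c * (b + c)
  | 11 => 1 - cos (B - C)
  | 12 => 1 + cos (B - C)
  | 13 => sin (B + π / 3) * sin (C + π / 3)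
  | 14 => sin (B - π / 3) * sin (C - π / 3)
  | 15 => sin (A + π / 3)
  | 16 => sin (A - π / 3)
  | 17 => sin (B + π / 6) * sin (C + π / 6)
  | 18 => sin (B - π / 6) * sin (C - π / 6)
  | 19 => sin A * cos B * cos C
  | 20 => cos A - cos B * cos C
  | 21 => 1 / (cos B + cos C)
  | 22 => a * (b ^ 4 + c ^ 4 - a ^ 4)
  | 23 => a * (b ^ 4 + c ^ 4 - a ^ 4 - b ^ 2 * c ^ 2)
  | 24 => cos B * cos C * cos (2 * A)
  | 25 => sin A ^ 2 * cos B * cos C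
  | 26 => a * (b ^ 2 * cos (2 * B) + c ^ 2 * cos (2 * C) - a ^ 2 * cos (2 * A))
  | 27 => cos B * cos C / (b + c)
  | 28 => sin A * cos B * cos C / (b + c)
  | 29 => cos B * cos C / (cos B + cos C)
  | 30 => cos A - 2 * cos B * cos C
  | 31 => a ^ 2
  | 32 => a ^ 3
  | 33 => (1 + cos A) * cos B * cos C
  | 34 => (1 - cos A) * cos B * cos C
  | 35 => 1 + 2 * cos A
  | 36 => 1 - 2 * cos A
  | 37 => b + c
  | 38 => b ^ 2 + c ^ 2
  | 39 => a * (b ^ 2 + c ^ 2)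
  | 40 => cos B + cos C - cos A - 1
  | 41 => a ^ 2 * (b + c - a)
  | 42 => a * (b + c)
  | 43 => a * b + a * c - b * c
  | 44 => b + c - 2 * a
  | 45 => 2 * b + 2 * c - a
  | 46 => cos B + cos C - cos A
  | 47 => cos (2 * A)
  | 48 => sin (2 * A)
  | 49 => cos (3 * A)
  | 50 => sin (3 * A)
  | 51 => a ^ 2 * cos (B - C)
  | 52 => cos (2 * A) * cos (B - C)
  | 53 => sin A * cos B * cos C * cos (B - C)
  | 54 => cos (C - A) * cos (A - B)
  | 55 => a * (b + c - a)
  | 56 => a / (b + c - a)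
  | 57 => 1 / (b + c - a)
  | 58 => a / (b + c)
  | 59 => (1 - cos (C - A)) * (1 - cos (A - B))
  | 60 => 1 / (1 + cos (B - C))
  | 61 => sin (A + π / 6)
  | 62 => sin (A - π / 6)
  | 63 => cos A / sin A
  | 64 => (cos B - cos C * cos A) * (cos C - cos A * cos B)
  | 65 => cos B + cos C
  | 66 => b * (c ^ 4 + a ^ 4 - b ^ 4) * (c * (a ^ 4 + b ^ 4 - c ^ 4))
  | 67 => b * (c ^ 4 + a ^ 4 - b ^ 4 - c ^ 2 * a ^ 2) *
      (c * (a ^ 4 + b ^ 4 - c ^ 4 - a ^ 2 * b ^ 2))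
  | 68 => cos A * cos (2 * B) * cos (2 * C)
  | 69 => cos A / sin A ^ 2
  | 70 => b * (c ^ 2 * cos (2 * C) + a ^ 2 * cos (2 * A) - b ^ 2 * cos (2 * B)) *
      (c * (a ^ 2 * cos (2 * A) + b ^ 2 * cos (2 * B) - c ^ 2 * cos (2 * C)))
  | 71 => (b + c) * cos A
  | 72 => (b + c) * (cos A / sin A)
  | 73 => cos A * (cos B + cos C)
  | 74 => (cos B - 2 * cos C * cos A) * (cos C - 2 * cos A * cos B)
  | 75 => 1 / a ^ 2
  | 76 => 1 / a ^ 3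
  | 77 => cos A / (1 + cos A)
  | 78 => cos A / (1 - cos A)
  | 79 => (1 + 2 * cos B) * (1 + 2 * cos C)
  | 80 => (1 - 2 * cos B) * (1 - 2 * cos C)
  | 81 => 1 / (b + c)
  | 82 => 1 / (b ^ 2 + c ^ 2)
  | 83 => b * c / (b ^ 2 + c ^ 2)
  | 84 => (cos C + cos A - cos B - 1) * (cos A + cos B - cos C - 1)
  | 85 => b ^ 2 * c ^ 2 / (b + c - a)
  | 86 => b * c / (b + c)
  | 87 => (b * c + b * a - c * a) * (c * a + c * b - a * b)
  | 88 => (c + a - 2 * b) * (a + b - 2 * c)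
  | 89 => 1 / (2 * b + 2 * c - a)
  | 90 => (cos C + cos A - cos B) * (cos A + cos B - cos C)
  | 91 => cos (2 * B) * cos (2 * C)
  | 92 => sin (2 * B) * sin (2 * C)
  | 93 => cos (3 * B) * cos (3 * C)
  | 94 => sin (3 * B) * sin (3 * C)
  | 95 => cos (C - A) * cos (A - B) / a ^ 2
  | 96 => cos (2 * B) * cos (2 * C) * (cos (C - A) * cos (A - B))
  | 97 => cos A / sin A * (cos (C - A) * cos (A - B))
  | 98 => b * (c ^ 4 + a ^ 4 - b ^ 2 * c ^ 2 - b ^ 2 * a ^ 2) *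
      (c * (a ^ 4 + b ^ 4 - c ^ 2 * a ^ 2 - c ^ 2 * b ^ 2))
  | 99 => b * (c ^ 2 - a ^ 2) * (c * (a ^ 2 - b ^ 2))
  | 100 => (c - a) * (a - b)
  | _ => 0

/-- The weight of the vertex `P` in the barycentric coordinates of `X_k` of the triangle `P Q R`:
the opposite side times the trilinear coordinate. -/
def weight (k : ℕ) (P Q R : Plane) : ℝ :=
  dist Q R * trilinear k (dist Q R) (dist R P) (dist P Q) (∠ R P Q) (∠ P Q R) (∠ Q R P)

/-- `X` is the center `X_k` of the triangle `P Q R`. There is no such `X` if `X_k` is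
undefined or a point at infinity. -/
def IsKimberlingCenter (k : ℕ) (P Q R X : Plane) : Prop :=
  weight k P Q R + weight k Q R P + weight k R P Q ≠ 0 ∧
    (weight k P Q R + weight k Q R P + weight k R P Q) • X =
      weight k P Q R • P + weight k Q R P • Q + weight k R P Q • R

/-! ## Loci over the focus-inversive family -/

/-- The locus of `X_k` over the focus-inversive family: the triangles whose vertices are the
inversions of the vertices of the billiard 3-periodics in the circle of center `F`, radius `ρ`. -/
def inversiveLocus (k : ℕ) (a b ρ : ℝ) (F : Plane) : Set Plane :=
  {X | ∃ P Q R : Plane, IsThreePeriodic a b P Q R ∧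
    IsKimberlingCenter k (inversion F ρ P) (inversion F ρ Q) (inversion F ρ R) X}

/-- `X_k` sweeps a circle (of positive radius) over the focus-inversive family of every elliptic
billiard, except possibly for finitely many values of the aspect ratio `a / b`. -/
def SweepsCircle (k : ℕ) : Prop :=
  ∃ E : Set ℝ, E.Finite ∧
    ∀ (a b ρ : ℝ) (F : Plane), 0 < b → b < a → a / b ∉ E → 0 < ρ → F ∈ foci a b →
      ∃ (O : Plane) (r : ℝ), 0 < r ∧ inversiveLocus k a b ρ F = Metric.sphere O r

/-- The 28 indices of the circular loci. -/
def circularIndices : Set ℕ :=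
  {1, 2, 3, 4, 5, 8, 9, 10, 11, 12, 20, 21, 35, 36, 40, 46, 55, 56, 57, 63, 65, 72, 78, 79, 80, 84,
    90, 100}

end

/-! Let `t₁, t₂, t₃` be the unit directions in which the vertices of an orbit are seen from the
focus. The inverse of a point of the ellipse is, up to a translation and a scale, the limaçon point
`z(t) = (1 + ε Re t) t = t + ε (t² + 1) / 2`. For two directions with angle `θ` one has `|z(t) -
z(s)|² = 2 (1 - cos θ) G` with `G = chordFactor ε t s`, and the reflection law at `t` says that `(1
- cos θ) / G` is the same for both neighbours (`reflectsAt_iff`). Equality of the three quotients is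
equivalent to `t₁ + t₂ + t₃ = h`, where `h` is the root in `(-1, 1)` of `ε h² + 2 h (1 + ε²) + 3 ε =
0` (`isThreePeriodic_iff`).

On such triples the sides of the inversive triangle are proportional to `3 - h² + 2 h Re tᵢ`, so the
perimeter is constant, and so is `κ = r / R = (1 - h²) / 2` (`sum_cos_sub_one`). With `λ = t₁ t₂
t₃`, the elementary symmetric functions of the `tᵢ` are `h`, `h λ`, `λ`; hence `X₁`, `X₂`, `X₃` have
the form `u + v λ` with real constants `u`, `v`. For the 28 indices `X_k` is a combination of `X₁`,
`X₂`, `X₃` with coefficients polynomial in `κ` (`isKimberlingCenter_iff`), so it has the same form.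
As `λ` takes every value on the unit circle (`exists_unit_triple`), the locus is a full circle
centered on the axis unless the coefficient sum or `v` vanishes. The first happens only for `X₉₀`,
the second only for `X₄₆`, each for one aspect ratio.

Conversely, the locus is symmetric in the axis, so if it is a circle then `|Z|²` is an affine
function of `Re Z` on it. For `h = -2/7` three explicit orbits have inversive triangles similar to
integer-sided ones, and the failure of this affine relation amounts to the nonvanishing of an
element of `ℤ[√57, √345]`, certified by its integer norm (`norm_circleDefect_ne_zero`). The failure
persists for `h` near `-2/7` by continuity, hence for infinitely many aspect ratios
(`not_sweepsCircle_of_det_ne_zero`). Two indices need their own argument: `X₇` does not move and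
`X₃₀` is at infinity. -/

/-! ### Trigonometry of a nondegenerate triangle -/

/-- Side lengths and opposite angles of a nondegenerate triangle. -/
structure IsTriangle (a b c A B C : ℝ) : Prop where
  a_pos : 0 < a
  b_pos : 0 < b
  c_pos : 0 < c
  a_lt : a < b + c
  b_lt : b < c + a
  c_lt : c < a + b
  cos_A : Real.cos A = (b ^ 2 + c ^ 2 - a ^ 2) / (2 * b * c)
  cos_B : Real.cos B = (c ^ 2 + a ^ 2 - b ^ 2) / (2 * c * a)
  cos_C : Real.cos C = (a ^ 2 + b ^ 2 - c ^ 2) / (2 * a * b)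
  sin_A_pos : 0 < Real.sin A
  sin_B_pos : 0 < Real.sin B
  sin_C_pos : 0 < Real.sin C
  sines_AB : a * Real.sin B = b * Real.sin A
  sines_BC : b * Real.sin C = c * Real.sin B
  sines_CA : c * Real.sin A = a * Real.sin C
  sum_eq : A + B + C = Real.pi

namespace IsTriangle

theorem rotate {a b c A B C : ℝ} (h : IsTriangle a b c A B C) : IsTriangle b c a B C A :=
  ⟨h.b_pos, h.c_pos, h.a_pos, h.b_lt, h.c_lt, h.a_lt, h.cos_B, h.cos_C, h.cos_A, h.sin_B_pos,
    h.sin_C_pos, h.sin_A_pos, h.sines_BC, h.sines_CA, h.sines_AB, by linarith [h.sum_eq]⟩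

theorem cos_B_sub_C {a b c A B C : ℝ} (h : IsTriangle a b c A B C) :
    Real.cos (B - C) = Real.cos A + 2 * (Real.cos B * Real.cos C) := by
  have : A = Real.pi - (B + C) := by linarith [h.sum_eq]
  rw [this, Real.cos_pi_sub, Real.cos_sub, Real.cos_add]; ring

end IsTriangle

theorem cos_angle_eq {P Q R : Plane} (h1 : Q ≠ P) (h2 : R ≠ P) :
    Real.cos (∠ R P Q) =
      (dist R P ^ 2 + dist P Q ^ 2 - dist Q R ^ 2) / (2 * dist R P * dist P Q) := by
  have := EuclideanGeometry.law_cos R P Q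
  have h3 : dist R P ≠ 0 := by simpa using h2
  have h4 : dist P Q ≠ 0 := by simpa using h1.symm
  rw [dist_comm Q P, dist_comm R Q] at this
  field_simp
  linarith

theorem sin_angle_pos_of_lt {a b c A : ℝ} (ha : 0 < a) (hb : 0 < b) (hc : 0 < c)
    (h1 : a < b + c) (h2 : b < c + a) (h3 : c < a + b) (hA0 : 0 ≤ A) (hA : A ≤ Real.pi)
    (hcos : Real.cos A = (b ^ 2 + c ^ 2 - a ^ 2) / (2 * b * c)) : 0 < Real.sin A := by
  have h0 := Real.sin_nonneg_of_nonneg_of_le_pi hA0 hA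
  rcases h0.lt_or_eq with h | h
  · exact h
  exfalso
  have h5 := Real.sin_sq_add_cos_sq A
  rw [← h, hcos] at h5
  field_simp at h5
  -- Heron: the product is `4 b² c² - (b² + c² - a²)²`, which vanishes when `cos A ^ 2 = 1`.
  have : 0 < (b + c - a) * (c + a - b) * (a + b - c) * (a + b + c) := by
    have := sub_pos.2 h1; have := sub_pos.2 h2; have := sub_pos.2 h3; positivity
  nlinarith

theorem isTriangle_of_dist {P Q R : Plane} (ha : 0 < dist Q R) (hb : 0 < dist R P)
    (hc : 0 < dist P Q) (h1 : dist Q R < dist R P + dist P Q)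
    (h2 : dist R P < dist P Q + dist Q R) (h3 : dist P Q < dist Q R + dist R P) :
    IsTriangle (dist Q R) (dist R P) (dist P Q) (∠ R P Q) (∠ P Q R) (∠ Q R P) := by
  have nQR : Q ≠ R := dist_pos.1 ha
  have nRP : R ≠ P := dist_pos.1 hb
  have nPQ : P ≠ Q := dist_pos.1 hc
  have cA := cos_angle_eq nPQ.symm nRP
  have cB := cos_angle_eq nQR.symm nPQ
  have cC := cos_angle_eq nRP.symm nQR
  have sAB := EuclideanGeometry.law_sin P Q R
  have sBC := EuclideanGeometry.law_sin Q R P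
  have sCA := EuclideanGeometry.law_sin R P Q
  refine ⟨ha, hb, hc, h1, h2, h3, cA, cB, cC, ?_, ?_, ?_, ?_, ?_, ?_, ?_⟩
  · exact sin_angle_pos_of_lt ha hb hc h1 h2 h3 (angle_nonneg _ _ _) (angle_le_pi _ _ _) cA
  · exact sin_angle_pos_of_lt hb hc ha h2 h3 h1 (angle_nonneg _ _ _) (angle_le_pi _ _ _) cB
  · exact sin_angle_pos_of_lt hc ha hb h3 h1 h2 (angle_nonneg _ _ _) (angle_le_pi _ _ _) cC
  · linarith
  · linarith
  · linarith
  · have := angle_add_angle_add_angle_eq_pi R nPQ.symm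
    rw [angle_comm R P Q, angle_comm Q R P, angle_comm P Q R]
    rw [angle_comm P Q R, angle_comm Q R P, angle_comm R P Q] at this
    linarith


/-! ### The circular centers as combinations of incenter, centroid and circumcenter -/

/-- Coefficients `(α, β, γ)`, polynomials in `κ = r / R`, such that for the circular indices
`(α + β + γ) X_k = α X_1 + β X_2 + γ X_3`. -/
noncomputable def centerCoeff (k : ℕ) (κ : ℝ) : ℝ × ℝ × ℝ :=
  match k with
  | 1 => (1, 0, 0)
  | 2 => (0, 1, 0)
  | 3 => (0, 0, 1)
  | 4 => (0, 3, -2)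
  | 5 => (0, 3 / 2, -1 / 2)
  | 8 => (-2, 3, 0)
  | 9 => (-2 - κ, 6, 2 * κ)
  | 10 => (-1 / 2, 3 / 2, 0)
  | 11 => (-1 / 2, 3 / 2 * κ, -κ / 2)
  | 12 => (1 / 2, 3 / 2 * κ, -κ / 2)
  | 20 => (0, -3, 4)
  | 21 => (0, 3 / 2, κ)
  | 35 => (1 / 2, 0, κ)
  | 36 => (-1 / 2, 0, κ)
  | 40 => (-1, 0, 2)
  | 46 => (-1 - κ, 0, 2 * κ)
  | 55 => (1, 0, κ)
  | 56 => (-1, 0, κ)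
  | 57 => (-2 - κ, 0, 2 * κ)
  | 63 => (-2 - κ, 3, 2 * κ)
  | 65 => (1 + κ, 0, -κ)
  | 72 => (-2 - κ, 3, κ)
  | 78 => (2 + κ, -3, 0)
  | 79 => (3 / 2 + κ, 3 * κ, -3 * κ)
  | 80 => (-1 / 2 - κ, 3 * κ, -κ)
  | 84 => (-2 - κ, 6, 2 * κ - 4)
  | 90 => (-1 - 2 * κ - κ ^ 2, 6 * κ, 2 * κ ^ 2 - 2 * κ)
  | 100 => (1, -3 / 2, κ)
  | _ => (0, 0, 0)

/-- The common factor relating the weights of `X_k` to the combination given by `centerCoeff`,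
in terms of the perimeter `p`, the product `m` of the sides, the product `n` of the pairwise sums
of sides, `κ = r / R` and `d = 2 R`. -/
noncomputable def weightFactor (k : ℕ) (p m n κ d : ℝ) : ℝ :=
  match k with
  | 1 => p
  | 2 => 3 * m
  | 3 => p * κ
  | 4 => p * κ / 2
  | 5 => 2 * p * κ
  | 8 => m * p
  | 9 => 2 * m / p
  | 10 => 2 * m * p
  | 11 => -2 * p
  | 12 => 2 * p
  | 20 => p * κ / 2
  | 21 => 2 * p * m / (κ * n)
  | 35 => 2 * p
  | 36 => -2 * p
  | 40 => -p * κ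
  | 46 => -p
  | 55 => 2 * m
  | 56 => -p / κ
  | 57 => -1 / κ
  | 63 => d
  | 65 => p
  | 72 => p * d
  | 78 => -p / κ
  | 79 => 2 * p
  | 80 => 2 * p
  | 84 => p * κ
  | 90 => p
  | 100 => 2 * m
  | _ => 0

theorem ravi {a b c A B C : ℝ} (h : IsTriangle a b c A B C) :
    ∃ x y z : ℝ, 0 < x ∧ 0 < y ∧ 0 < z ∧ a = y + z ∧ b = z + x ∧ c = x + y :=
  ⟨(b + c - a) / 2, (c + a - b) / 2, (a + b - c) / 2, by linarith [h.a_lt], by linarith [h.b_lt],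
    by linarith [h.c_lt], by ring, by ring, by ring⟩

-- The barycentric weights of `X₁`, `X₂`, `X₃`, normalized to total 1, are `a / p`, `1 / 3` and `a
-- cos A / (p κ)`. In the Ravi variables every case becomes an identity of rational functions. The
-- prefactor involves only cyclically invariant quantities and `a / sin A = 2 R`, so it is common to
-- the three vertices.
set_option maxHeartbeats 4000000 in
theorem mul_trilinear_eq {k : ℕ} (hk : k ∈ circularIndices) {a b c A B C κ : ℝ}
    (h : IsTriangle a b c A B C) (hκ : κ = Real.cos A + Real.cos B + Real.cos C - 1) :
    a * trilinear k a b c A B C =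
      weightFactor k (a + b + c) (a * b * c) ((a + b) * (b + c) * (c + a)) κ (a / Real.sin A) *
        ((centerCoeff k κ).1 * a / (a + b + c) + (centerCoeff k κ).2.1 / 3 +
          (centerCoeff k κ).2.2 * (a * Real.cos A) / ((a + b + c) * κ)) := by
  obtain ⟨x, y, z, hx, hy, hz, rfl, rfl, rfl⟩ := ravi h
  have hA : Real.cos A = (x * (x + y + z) - y * z) / ((z + x) * (x + y)) := by
    rw [h.cos_A]; field_simp; ring
  have hB : Real.cos B = (y * (x + y + z) - z * x) / ((x + y) * (y + z)) := by
    rw [h.cos_B]; field_simp; ring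
  have hC : Real.cos C = (z * (x + y + z) - x * y) / ((y + z) * (z + x)) := by
    rw [h.cos_C]; field_simp; ring
  have hκ' : κ = 4 * x * y * z / ((x + y) * (y + z) * (z + x)) := by
    rw [hκ, hA, hB, hC]; field_simp; ring
  have hBC := h.cos_B_sub_C
  have hs := h.sin_A_pos.ne'
  have e1 : z + x + (x + y) - (y + z) = 2 * x := by ring
  have e2 : (x * (x + y + z) - y * z) / ((z + x) * (x + y)) =
     1 - 2 * (y * z) / ((z + x) * (x + y)) := by field_simp; ring
  have e3 : (y * (x + y + z) - z * x) / ((x + y) * (y + z)) +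
      (z * (x + y + z) - x * y) / ((y + z) * (z + x)) = 2 * y * z * (2 * x + y + z) /
        ((x + y) * (y + z) * (z + x)) := by field_simp; ring
  clear hκ
  simp only [circularIndices, Set.mem_insert_iff, Set.mem_singleton_iff] at hk
  rcases hk with rfl | rfl | rfl | rfl | rfl | rfl | rfl | rfl | rfl | rfl | rfl | rfl | rfl | rfl |
    rfl | rfl | rfl | rfl | rfl | rfl | rfl | rfl | rfl | rfl | rfl | rfl | rfl | rfl
  -- The indices `78` and `21` have the denominators `1 - cos A` and `cos B + cos C`; `e2` and `e3`
  -- present these as products of visibly positive factors.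
  case' inr.inr.inr.inr.inr.inr.inr.inr.inr.inr.inr.inr.inr.inr.inr.inr.inr.inr.inr.inr.inr.inr.inl =>
    simp only [trilinear, weightFactor, centerCoeff, hA, e2, sub_sub_cancel]
  case' inr.inr.inr.inr.inr.inr.inr.inr.inr.inr.inr.inl =>
    simp only [trilinear, weightFactor, centerCoeff, hA, hB, hC, e3]
  all_goals
    try simp only [trilinear, weightFactor, centerCoeff, hBC, hA, hB, hC, hκ', e1]
    field_simp
    try ring

theorem weightFactor_ne_zero {k : ℕ} (hk : k ∈ circularIndices) {p m n κ d : ℝ} (hp : 0 < p)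
    (hm : 0 < m) (hn : 0 < n) (hκ : 0 < κ) (hd : 0 < d) : weightFactor k p m n κ d ≠ 0 := by
  simp only [circularIndices, Set.mem_insert_iff, Set.mem_singleton_iff] at hk
  rcases hk with rfl | rfl | rfl | rfl | rfl | rfl | rfl | rfl | rfl | rfl | rfl | rfl | rfl | rfl |
    rfl | rfl | rfl | rfl | rfl | rfl | rfl | rfl | rfl | rfl | rfl | rfl | rfl | rfl
  all_goals
    simp only [weightFactor]
    first
      | positivity
      | (rw [neg_mul]; exact neg_ne_zero.2 (by positivity))
      | (rw [neg_div]; exact neg_ne_zero.2 (by positivity))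
      | exact neg_ne_zero.2 (by positivity)

namespace IsTriangle

theorem sum_cos_sub_one_pos {a b c A B C : ℝ} (h : IsTriangle a b c A B C) :
    0 < Real.cos A + Real.cos B + Real.cos C - 1 := by
  have : Real.cos A + Real.cos B + Real.cos C - 1 =
      (b + c - a) * (c + a - b) * (a + b - c) / (2 * a * b * c) := by
    have := h.a_pos; have := h.b_pos; have := h.c_pos
    rw [h.cos_A, h.cos_B, h.cos_C]; field_simp; ring
  have := h.a_pos; have := h.b_pos; have := h.c_pos
  have := sub_pos.2 h.a_lt; have := sub_pos.2 h.b_lt; have := sub_pos.2 h.c_lt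
  rw [‹Real.cos A + _ + _ - 1 = _›]; positivity

theorem sum_mul_cos {a b c A B C : ℝ} (h : IsTriangle a b c A B C) :
    a * Real.cos A + b * Real.cos B + c * Real.cos C =
      (a + b + c) * (Real.cos A + Real.cos B + Real.cos C - 1) := by
  have := h.a_pos; have := h.b_pos; have := h.c_pos
  rw [h.cos_A, h.cos_B, h.cos_C]; field_simp; ring

end IsTriangle

/-- By `mul_trilinear_eq` the three weights of `X_k` are a common nonzero multiple `M` of the `(α,
β, γ)`-combination of the normalized weights of `X₁`, `X₂`, `X₃`, and `M` cancels. The points `I`,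
`G`, `O` enter only through their barycentric equations. -/
theorem isKimberlingCenter_iff {k : ℕ} (hk : k ∈ circularIndices) {P Q R X I G O : Plane} {κ : ℝ}
    (h : IsTriangle (dist Q R) (dist R P) (dist P Q) (∠ R P Q) (∠ P Q R) (∠ Q R P))
    (hκ : κ = Real.cos (∠ R P Q) + Real.cos (∠ P Q R) + Real.cos (∠ Q R P) - 1)
    (hI : (dist Q R + dist R P + dist P Q) • I = dist Q R • P + dist R P • Q + dist P Q • R)
    (hG : (3 : ℝ) • G = P + Q + R)
    (hO : ((dist Q R + dist R P + dist P Q) * κ) • O = (dist Q R * Real.cos (∠ R P Q)) • P +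
      (dist R P * Real.cos (∠ P Q R)) • Q + (dist P Q * Real.cos (∠ Q R P)) • R) :
    IsKimberlingCenter k P Q R X ↔
      (centerCoeff k κ).1 + (centerCoeff k κ).2.1 + (centerCoeff k κ).2.2 ≠ 0 ∧
      ((centerCoeff k κ).1 + (centerCoeff k κ).2.1 + (centerCoeff k κ).2.2) • X =
        (centerCoeff k κ).1 • I + (centerCoeff k κ).2.1 • G + (centerCoeff k κ).2.2 • O := by
  have w1 : weight k P Q R = _ := mul_trilinear_eq hk h hκ
  have w2 : weight k Q R P = _ := mul_trilinear_eq (κ := κ) hk h.rotate (by rw [hκ]; ring)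
  have w3 : weight k R P Q = _ := mul_trilinear_eq (κ := κ) hk h.rotate.rotate (by rw [hκ]; ring)
  have hs := h.sum_mul_cos
  rw [← hκ] at hs
  have κpos : 0 < κ := hκ ▸ h.sum_cos_sub_one_pos
  have ha := h.a_pos; have hb := h.b_pos; have hc := h.c_pos
  have sA := h.sin_A_pos; have sB := h.sin_B_pos; have sC := h.sin_C_pos
  have d2 : dist R P / Real.sin (∠ P Q R) = dist Q R / Real.sin (∠ R P Q) := by
    rw [div_eq_div_iff sB.ne' sA.ne']; linarith [h.sines_AB]
  have d3 : dist P Q / Real.sin (∠ Q R P) = dist Q R / Real.sin (∠ R P Q) := by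
    rw [div_eq_div_iff sC.ne' sA.ne']; linarith [h.sines_CA]
  generalize ∠ R P Q = A at *
  generalize ∠ P Q R = B at *
  generalize ∠ Q R P = C at *
  generalize dist Q R = a at *
  generalize dist R P = b at *
  generalize dist P Q = c at *
  have dpos : 0 < a / Real.sin A := by positivity
  rw [d2, show b + c + a = a + b + c by ring, show b * c * a = a * b * c by ring,
    show (b + c) * (c + a) * (a + b) = (a + b) * (b + c) * (c + a) by ring] at w2
  rw [d3, show c + a + b = a + b + c by ring, show c * a * b = a * b * c by ring,
    show (c + a) * (a + b) * (b + c) = (a + b) * (b + c) * (c + a) by ring] at w3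
  have hM : weightFactor k (a + b + c) (a * b * c) ((a + b) * (b + c) * (c + a)) κ
      (a / Real.sin A) ≠ 0 :=
    weightFactor_ne_zero hk (by positivity) (by positivity) (by positivity) κpos dpos
  generalize weightFactor k (a + b + c) (a * b * c) ((a + b) * (b + c) * (c + a)) κ
      (a / Real.sin A) = M at *
  generalize (centerCoeff k κ).1 = α at *
  generalize (centerCoeff k κ).2.1 = β at *
  generalize (centerCoeff k κ).2.2 = γ at *
  have sp : 0 < a + b + c := by positivity
  have hsum : weight k P Q R + weight k Q R P + weight k R P Q = M * (α + β + γ) := by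
    rw [w1, w2, w3]
    field_simp
    linear_combination (3 * γ) * hs
  have hvec : weight k P Q R • P + weight k Q R P • Q + weight k R P Q • R =
      M • (α • I + β • G + γ • O) := by
    ext i
    have e1 := congrArg (fun v : Plane => v i) hI
    have e2 := congrArg (fun v : Plane => v i) hG
    have e3 := congrArg (fun v : Plane => v i) hO
    simp only [PiLp.add_apply, PiLp.smul_apply, smul_eq_mul] at e1 e2 e3 ⊢
    rw [w1, w2, w3]
    have f1 : I i = (a * P i + b * Q i + c * R i) / (a + b + c) := by
      rw [← e1]; field_simp
    have f2 : G i = (P i + Q i + R i) / 3 := by rw [← e2]; field_simp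
    have f3 : O i = (a * Real.cos A * P i + b * Real.cos B * Q i + c * Real.cos C * R i) /
        ((a + b + c) * κ) := by rw [← e3]; field_simp
    rw [f1, f2, f3]
    field_simp
    ring
  unfold IsKimberlingCenter
  rw [hsum, hvec, mul_smul]
  constructor
  · rintro ⟨h1, h2⟩
    exact ⟨right_ne_zero_of_mul h1, smul_right_injective _ hM h2⟩
  · rintro ⟨h1, h2⟩
    exact ⟨mul_ne_zero hM h1, by rw [h2]⟩


/-! ### Focal parametrization of the ellipse and the reflection law -/

/-- The isometry of `ℂ` with the plane. -/
noncomputable def toPlane : ℂ ≃ₗᵢ[ℝ] Plane := Complex.orthonormalBasisOneI.repr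

@[simp] theorem toPlane_zero (z : ℂ) : toPlane z 0 = z.re := by
  simp [toPlane, Complex.orthonormalBasisOneI_repr_apply]

@[simp] theorem toPlane_one (z : ℂ) : toPlane z 1 = z.im := by
  simp [toPlane, Complex.orthonormalBasisOneI_repr_apply]

/-- The cosine of the angle between two unit complex numbers. -/
noncomputable def cosBetween (t s : ℂ) : ℝ := t.re * s.re + t.im * s.im

/-- The quantity with `|z(t) - z(s)|² = 2 (1 - cos) G` for `z(t) = (1 + ε Re t) t`. -/
noncomputable def chordFactor (ε : ℝ) (t s : ℂ) : ℝ :=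
  1 + ε * (t.re + s.re) + ε ^ 2 * (1 + cosBetween t s) / 2

/-- The point of the ellipse with semi-axis `a` and eccentricity `ε` seen from the focus `(ε a, 0)`
in direction `t`. -/
noncomputable def ellipsePoint (a ε : ℝ) (t : ℂ) : Plane :=
  toPlane ((ε * a : ℝ) + (a * (1 - ε ^ 2) / (1 + ε * t.re) : ℝ) * t)

/-- The limaçon, that is the inverse of the ellipse about its focus, up to scale. -/
noncomputable def limacon (ε : ℝ) (t : ℂ) : ℂ := (1 + ε * t.re : ℝ) * t

theorem sq_re_add_sq_im {t : ℂ} (ht : ‖t‖ = 1) : t.re ^ 2 + t.im ^ 2 = 1 := by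
  have := Complex.sq_norm t
  rw [ht, Complex.normSq_apply] at this
  linarith

theorem abs_re_le_one {t : ℂ} (ht : ‖t‖ = 1) : |t.re| ≤ 1 := ht ▸ Complex.abs_re_le_norm t

theorem one_add_mul_re_pos {ε : ℝ} (hε : ε ^ 2 < 1) {t : ℂ} (ht : ‖t‖ = 1) : 0 < 1 + ε * t.re := by
  have := sq_re_add_sq_im ht
  have h1 : (ε * t.re) ^ 2 < 1 := by
    rw [mul_pow]; nlinarith [sq_nonneg t.re, sq_nonneg t.im, sq_nonneg ε]
  linarith [(abs_lt.1 ((sq_lt_one_iff_abs_lt_one _).1 h1)).1]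

theorem cosBetween_lt_one {t s : ℂ} (ht : ‖t‖ = 1) (hs : ‖s‖ = 1) (hne : t ≠ s) :
    cosBetween t s < 1 := by
  have h1 := sq_re_add_sq_im ht
  have h2 := sq_re_add_sq_im hs
  by_contra! h
  unfold cosBetween at h
  have : (t.re - s.re) ^ 2 + (t.im - s.im) ^ 2 ≤ 0 := by nlinarith
  apply hne
  apply Complex.ext <;> nlinarith [sq_nonneg (t.re - s.re), sq_nonneg (t.im - s.im)]

theorem neg_one_le_cosBetween {t s : ℂ} (ht : ‖t‖ = 1) (hs : ‖s‖ = 1) :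
    -1 ≤ cosBetween t s := by
  have h1 := sq_re_add_sq_im ht
  have h2 := sq_re_add_sq_im hs
  unfold cosBetween
  nlinarith [sq_nonneg (t.re + s.re), sq_nonneg (t.im + s.im)]

theorem cosBetween_comm (t s : ℂ) : cosBetween t s = cosBetween s t := by
  unfold cosBetween; ring

theorem chordFactor_comm (ε : ℝ) (t s : ℂ) : chordFactor ε t s = chordFactor ε s t := by
  unfold chordFactor; rw [cosBetween_comm]; ring

/-- The Gram identity behind the distance formula on the limaçon. -/
theorem limacon_gram {ε : ℝ} {t s : ℂ} (ht : ‖t‖ = 1) (hs : ‖s‖ = 1) :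
    (1 + ε * t.re) ^ 2 + (1 + ε * s.re) ^ 2 -
      2 * cosBetween t s * (1 + ε * t.re) * (1 + ε * s.re) =
    2 * (1 - cosBetween t s) * chordFactor ε t s := by
  have h1 := sq_re_add_sq_im ht
  have h2 := sq_re_add_sq_im hs
  unfold chordFactor
  -- The Gram determinant of `1`, `t`, `s` vanishes, these being three vectors in a plane.
  have h3 : cosBetween t s ^ 2 = 2 * t.re * s.re * cosBetween t s + 1 - t.re ^ 2 - s.re ^ 2 := by
    unfold cosBetween
    linear_combination s.im ^ 2 * h1 - h2 * (t.re ^ 2 - 1)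
  linear_combination (ε ^ 2) * h3

theorem chordFactor_pos {ε : ℝ} (hε : ε ^ 2 < 1) {t s : ℂ} (ht : ‖t‖ = 1) (hs : ‖s‖ = 1)
    (hne : t ≠ s) : 0 < chordFactor ε t s := by
  have h := limacon_gram (ε := ε) ht hs
  have h1 := cosBetween_lt_one ht hs hne
  have h2 := neg_one_le_cosBetween ht hs
  have m1 := one_add_mul_re_pos hε ht
  have m1' : 1 + t.re * ε ≠ 0 := by rw [mul_comm]; exact m1.ne'
  have m2 := one_add_mul_re_pos hε hs
  have m2' : 1 + s.re * ε ≠ 0 := by rw [mul_comm]; exact m2.ne'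
  have : 0 < 2 * (1 - cosBetween t s) * chordFactor ε t s := by
    rw [← h]
    nlinarith [sq_nonneg ((1 + ε * t.re) - (1 + ε * s.re)), mul_pos m1 m2]
  exact pos_of_mul_pos_right this (by linarith)

theorem dist_toPlane_sq (z w : ℂ) :
    dist (toPlane z) (toPlane w) ^ 2 = (z.re - w.re) ^ 2 + (z.im - w.im) ^ 2 := by
  rw [toPlane.dist_map, Complex.dist_eq, Complex.sq_norm, Complex.normSq_apply]
  simp; ring

theorem dist_limacon {ε : ℝ} {t s : ℂ} (ht : ‖t‖ = 1) (hs : ‖s‖ = 1) : dist (limacon ε t) (limacon ε s) =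
      √(2 * (1 - cosBetween t s) * chordFactor ε t s) := by
  have h1 := sq_re_add_sq_im ht
  have h2 := sq_re_add_sq_im hs
  rw [← limacon_gram ht hs, ← Real.sqrt_sq (dist_nonneg (x := limacon ε t)), Complex.dist_eq,
    Complex.sq_norm, Complex.normSq_apply]
  congr 1
  simp only [limacon, cosBetween, Complex.sub_re, Complex.sub_im, Complex.re_ofReal_mul,
    Complex.im_ofReal_mul]
  linear_combination (1 + ε * t.re) ^ 2 * h1 + (1 + ε * s.re) ^ 2 * h2

section Ellipse

variable {a b ε : ℝ}

theorem ellipsePoint_zero (hε : ε ^ 2 < 1) {t : ℂ} (ht : ‖t‖ = 1) :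
    ellipsePoint a ε t 0 = a * (t.re + ε) / (1 + ε * t.re) := by
  have m1 := one_add_mul_re_pos hε ht
  have m1' : 1 + t.re * ε ≠ 0 := by rw [mul_comm]; exact m1.ne'
  simp only [ellipsePoint, toPlane_zero, Complex.add_re, Complex.re_ofReal_mul, Complex.ofReal_re]
  field_simp; ring

theorem ellipsePoint_one (t : ℂ) :
    ellipsePoint a ε t 1 = a * (1 - ε ^ 2) * t.im / (1 + ε * t.re) := by
  simp only [ellipsePoint, toPlane_one, Complex.add_im, Complex.im_ofReal_mul, Complex.ofReal_im]
  ring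

theorem ellipsePoint_mem (ha : 0 < a) (hε : ε ^ 2 < 1) (hab : b ^ 2 = a ^ 2 * (1 - ε ^ 2))
    {t : ℂ} (ht : ‖t‖ = 1) : ellipsePoint a ε t ∈ billiard a b := by
  have m1 := one_add_mul_re_pos hε ht
  have m1' : 1 + t.re * ε ≠ 0 := by rw [mul_comm]; exact m1.ne'
  have h1 := sq_re_add_sq_im ht
  have h2 : 1 - ε ^ 2 ≠ 0 := by linarith
  simp only [billiard, Set.mem_ofPred_eq, ellipsePoint_zero hε ht, ellipsePoint_one, div_pow, hab]
  field_simp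
  linear_combination (1 - ε ^ 2) * h1

/-- The focal distance of `P` is `a - ε P₀`, so the direction is `(P - F) / (a - ε P₀)`. -/
theorem exists_ellipsePoint (ha : 0 < a) (hb : 0 < b) (hε : ε ^ 2 < 1) (hab : b ^ 2 = a ^ 2 * (1 - ε ^ 2))
    {P : Plane} (hP : P ∈ billiard a b) : ∃ t : ℂ, ‖t‖ = 1 ∧ P = ellipsePoint a ε t := by
  have h2 : 0 < 1 - ε ^ 2 := by linarith
  simp only [billiard, Set.mem_ofPred_eq, div_pow, hab] at hP
  have hP' : P 0 ^ 2 * (1 - ε ^ 2) + P 1 ^ 2 = a ^ 2 * (1 - ε ^ 2) := by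
    field_simp at hP; linarith
  have hr : 0 < a - ε * P 0 := by
    have h3 : (ε * P 0) ^ 2 < a ^ 2 := by
      rw [mul_pow]
      have : P 0 ^ 2 ≤ a ^ 2 := by nlinarith [sq_nonneg (P 1)]
      nlinarith [sq_nonneg ε, sq_nonneg (P 0), mul_pos ha ha]
    linarith [(abs_lt.1 (abs_lt_of_sq_lt_sq h3 ha.le)).2]
  have hr' : a - P 0 * ε ≠ 0 := by rw [mul_comm]; exact hr.ne'
  have hn : ((P 0 - ε * a) / (a - ε * P 0)) ^ 2 + (P 1 / (a - ε * P 0)) ^ 2 = 1 := by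
    field_simp; linarith
  have hre : 0 < a * (1 - ε ^ 2) := by positivity
  have ht : ‖(⟨(P 0 - ε * a) / (a - ε * P 0), P 1 / (a - ε * P 0)⟩ : ℂ)‖ = 1 := by
    rw [← sq_eq_sq₀ (norm_nonneg _) zero_le_one, Complex.sq_norm, Complex.normSq_apply]
    simp only; linarith
  refine ⟨_, ht, ?_⟩
  have m1 := one_add_mul_re_pos hε ht
  have key : 1 + ε * ((P 0 - ε * a) / (a - ε * P 0)) = a * (1 - ε ^ 2) / (a - ε * P 0) := by
    field_simp; ring
  ext i
  fin_cases i
  · change P 0 = ellipsePoint a ε _ 0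
    rw [ellipsePoint_zero hε ht, key]; field_simp; ring
  · change P 1 = ellipsePoint a ε _ 1
    rw [ellipsePoint_one, key]; field_simp

theorem inner_normal (ha : 0 < a) (hε : ε ^ 2 < 1) (hab : b ^ 2 = a ^ 2 * (1 - ε ^ 2))
    {t s : ℂ} (ht : ‖t‖ = 1) (hs : ‖s‖ = 1) :
    inner ℝ (ellipsePoint a ε s -ᵥ ellipsePoint a ε t) (billiardNormal a b (ellipsePoint a ε t)) =
      - ((1 - ε ^ 2) * (1 - cosBetween t s) / ((1 + ε * t.re) * (1 + ε * s.re))) := by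
  have m1 := one_add_mul_re_pos hε ht
  have m1' : 1 + t.re * ε ≠ 0 := by rw [mul_comm]; exact m1.ne'
  have m2 := one_add_mul_re_pos hε hs
  have m2' : 1 + s.re * ε ≠ 0 := by rw [mul_comm]; exact m2.ne'
  have h1 := sq_re_add_sq_im ht
  have h2 : 1 - ε ^ 2 ≠ 0 := by linarith
  rw [PiLp.inner_apply, Fin.sum_univ_two]
  simp only [billiardNormal, vsub_eq_sub, PiLp.sub_apply, ellipsePoint_zero hε ht,
    ellipsePoint_zero hε hs, ellipsePoint_one, hab, cosBetween]
  simp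
  field_simp
  linear_combination (-(1 + ε * s.re) * (1 - ε ^ 2)) * h1

theorem dist_ellipsePoint (ha : 0 < a) (hε : ε ^ 2 < 1) {t s : ℂ} (ht : ‖t‖ = 1) (hs : ‖s‖ = 1)
    (hne : t ≠ s) : dist (ellipsePoint a ε t) (ellipsePoint a ε s) =
      a * (1 - ε ^ 2) / ((1 + ε * t.re) * (1 + ε * s.re)) *
        √(2 * (1 - cosBetween t s) * chordFactor ε t s) := by
  have m1 := one_add_mul_re_pos hε ht
  have m1' : 1 + t.re * ε ≠ 0 := by rw [mul_comm]; exact m1.ne'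
  have m2 := one_add_mul_re_pos hε hs
  have m2' : 1 + s.re * ε ≠ 0 := by rw [mul_comm]; exact m2.ne'
  have h1 := sq_re_add_sq_im ht
  have h2 := sq_re_add_sq_im hs
  have h3 : 0 < 1 - ε ^ 2 := by linarith
  have h4 := chordFactor_pos hε ht hs hne
  have h5 := cosBetween_lt_one ht hs hne
  rw [← sq_eq_sq₀ dist_nonneg (by positivity), mul_pow, Real.sq_sqrt (by
    have := sub_pos.2 h5; positivity), ← limacon_gram ht hs]
  have h6 : ∀ r r' : ℝ, (r * t.re - r' * s.re) ^ 2 + (r * t.im - r' * s.im) ^ 2 =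
      r ^ 2 + r' ^ 2 - 2 * r * r' * cosBetween t s := by
    intro r r'
    unfold cosBetween
    linear_combination r ^ 2 * h1 + r' ^ 2 * h2
  simp only [ellipsePoint, dist_toPlane_sq, Complex.add_re, Complex.re_ofReal_mul,
    Complex.ofReal_re, Complex.add_im, Complex.im_ofReal_mul, Complex.ofReal_im,
    add_sub_add_left_eq_sub, h6]
  field_simp
  ring

/-- The scalar product of the chord with the normal is a multiple of `1 - cos`, and the length of
the chord a multiple of `√((1 - cos) G)`. The factor depending on the far endpoint `s` cancels, so
the cosine of the angle is `-√((1 - cos) / G)` times a constant depending on `t` only. -/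
theorem reflectsAt_iff (ha : 0 < a) (hb : 0 < b) (hε : ε ^ 2 < 1) (hab : b ^ 2 = a ^ 2 * (1 - ε ^ 2))
    {t s u : ℂ} (ht : ‖t‖ = 1) (hs : ‖s‖ = 1) (hu : ‖u‖ = 1) (hts : t ≠ s) (htu : t ≠ u) :
    ReflectsAt a b (ellipsePoint a ε s) (ellipsePoint a ε t) (ellipsePoint a ε u) ↔
      (1 - cosBetween t s) / chordFactor ε t s = (1 - cosBetween t u) / chordFactor ε t u := by
  have m1 := one_add_mul_re_pos hε ht
  have m1' : 1 + t.re * ε ≠ 0 := by rw [mul_comm]; exact m1.ne'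
  have h3 : 0 < 1 - ε ^ 2 := by linarith
  have hn : billiardNormal a b (ellipsePoint a ε t) ≠ 0 := by
    intro h0
    have := ellipsePoint_mem ha hε hab ht
    have e0 := congrArg (fun v : Plane => v 0) h0
    have e1 := congrArg (fun v : Plane => v 1) h0
    simp [billiardNormal, ha.ne', hb.ne'] at e0 e1
    simp [billiard, e0, e1] at this
  have key : ∀ s : ℂ, ‖s‖ = 1 → t ≠ s →
      inner ℝ (ellipsePoint a ε s -ᵥ ellipsePoint a ε t)
          (billiardNormal a b (ellipsePoint a ε t)) /
        (‖ellipsePoint a ε s -ᵥ ellipsePoint a ε t‖ *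
          ‖billiardNormal a b (ellipsePoint a ε t)‖) =
      - √((1 - cosBetween t s) / chordFactor ε t s) /
        (a * √2 * ‖billiardNormal a b (ellipsePoint a ε t)‖) := by
    intro s hs hts
    have m2 := one_add_mul_re_pos hε hs
    have m2' : 1 + s.re * ε ≠ 0 := by rw [mul_comm]; exact m2.ne'
    have h4 := chordFactor_pos hε ht hs hts
    have h5 := sub_pos.2 (cosBetween_lt_one ht hs hts)
    rw [inner_normal ha hε hab ht hs, vsub_eq_sub, ← dist_eq_norm, dist_comm,
      dist_ellipsePoint ha hε ht hs hts, Real.sqrt_mul (by positivity), Real.sqrt_mul (by positivity),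
      Real.sqrt_div h5.le]
    have := Real.sqrt_pos.2 h4
    have h6 := Real.sqrt_pos.2 h5
    have h7 : (1 - cosBetween t s) = √(1 - cosBetween t s) * √(1 - cosBetween t s) :=
      (Real.mul_self_sqrt h5.le).symm
    have h8 := norm_pos_iff.2 hn
    field_simp
    rw [Real.sq_sqrt h5.le]
  unfold ReflectsAt InnerProductGeometry.angle
  rw [Real.arccos_injOn.eq_iff (abs_le.1 (abs_real_inner_div_norm_mul_norm_le_one _ _))
    (abs_le.1 (abs_real_inner_div_norm_mul_norm_le_one _ _)), key s hs hts, key u hu htu]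
  have h8 := norm_pos_iff.2 hn
  rw [div_left_inj' (by positivity), neg_inj, Real.sqrt_inj]
  · exact div_nonneg (sub_nonneg.2 (cosBetween_lt_one ht hs hts).le) (chordFactor_pos hε ht hs hts).le
  · exact div_nonneg (sub_nonneg.2 (cosBetween_lt_one ht hu htu).le) (chordFactor_pos hε ht hu htu).le

theorem inversion_ellipsePoint (ha : 0 < a) (hε : ε ^ 2 < 1) (ρ : ℝ) {t : ℂ} (ht : ‖t‖ = 1) :
    inversion (toPlane (ε * a : ℝ)) ρ (ellipsePoint a ε t) =
      toPlane ((ε * a : ℝ) + (ρ ^ 2 / (a * (1 - ε ^ 2)) : ℝ) * limacon ε t) := by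
  have m1 := one_add_mul_re_pos hε ht
  have m1' : 1 + t.re * ε ≠ 0 := by rw [mul_comm]; exact m1.ne'
  have h3 : 0 < 1 - ε ^ 2 := by linarith
  have hd : dist (ellipsePoint a ε t) (toPlane (ε * a : ℝ)) = a * (1 - ε ^ 2) / (1 + ε * t.re) := by
    rw [ellipsePoint, toPlane.dist_map, Complex.dist_eq, add_sub_cancel_left, norm_mul, ht, mul_one,
      Complex.norm_real, Real.norm_of_nonneg (by positivity)]
  rw [inversion, hd, ellipsePoint, vsub_eq_sub, ← map_sub, ← map_smul, vadd_eq_add, ← map_add,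
    add_sub_cancel_left, limacon, add_comm, Complex.real_smul, ← mul_assoc, ← mul_assoc,
    ← Complex.ofReal_mul, ← Complex.ofReal_mul]
  congr 4
  field_simp

end Ellipse


/-! ### Three-periodics as unit triples of constant sum -/

/-- `h` is the constant sum of the directions in which the vertices of a 3-periodic are seen
from the focus of a billiard of eccentricity `ε`. -/
structure FocalParams (ε h : ℝ) : Prop where
  ecc_ne : ε ≠ 0
  ecc_sq : ε ^ 2 < 1
  ne : h ≠ 0
  sq_lt : h ^ 2 < 1
  rel : ε * h ^ 2 + 2 * h * (1 + ε ^ 2) + 3 * ε = 0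

namespace FocalParams

variable {ε h : ℝ}

/-- The defining relation reads `2 h (1 + ε²) = -ε (h² + 3)`. -/
theorem mul_neg (p : FocalParams ε h) : ε * h < 0 := by
  have h1 := p.rel
  have h2 := pow_pos (abs_pos.2 p.ne) 2
  rw [sq_abs] at h2
  by_contra! hc
  have h3 : 0 < ε ^ 2 := by have := p.ecc_ne; positivity
  nlinarith [mul_nonneg hc (sq_nonneg ε), mul_nonneg hc (sq_nonneg h)]

theorem neg_one_lt_mul (p : FocalParams ε h) : -1 < ε * h := by
  have h1 : (ε * h) ^ 2 < 1 := by
    rw [mul_pow]; nlinarith [p.ecc_sq, p.sq_lt, sq_nonneg ε, sq_nonneg h]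
  exact (abs_lt.1 ((sq_lt_one_iff_abs_lt_one _).1 h1)).1

/-- The constant ratio between `chordFactor` and `1 - cosBetween`. -/
noncomputable def ratio (ε h : ℝ) : ℝ := -ε * (2 + ε * h) / (2 * h)

theorem ratio_pos (p : FocalParams ε h) : 0 < ratio ε h := by
  have h1 := p.mul_neg
  have h2 := p.neg_one_lt_mul
  have h3 := p.ne
  have : ratio ε h = (-(ε * h)) * (2 + ε * h) / (2 * h ^ 2) := by unfold ratio; field_simp
  rw [this]
  have : 0 < -(ε * h) := by linarith
  have : 0 < 2 + ε * h := by linarith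
  positivity

theorem sq_relation (p : FocalParams ε h) :
    (ε * h) ^ 2 + 2 * (ε * h) * (1 + ε ^ 2) + 3 * ε ^ 2 = 0 := by
  linear_combination ε * p.rel

end FocalParams

section Sum

variable {ε h : ℝ} {t₁ t₂ t₃ : ℂ}

theorem cosBetween_of_sum (h₁ : ‖t₁‖ = 1) (h₂ : ‖t₂‖ = 1) (h₃ : ‖t₃‖ = 1)
    (hs : t₁ + t₂ + t₃ = h) : 1 - cosBetween t₁ t₂ = (3 - h ^ 2 + 2 * h * t₃.re) / 2 := by
  have e1 := sq_re_add_sq_im h₁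
  have e2 := sq_re_add_sq_im h₂
  have e3 := sq_re_add_sq_im h₃
  have r := congrArg Complex.re hs
  have i := congrArg Complex.im hs
  simp at r i
  have r' : t₁.re + t₂.re = h - t₃.re := by linarith
  have i' : t₁.im + t₂.im = - t₃.im := by linarith
  unfold cosBetween
  linear_combination (e1 + e2 - e3) / 2 - (t₁.re + t₂.re + h - t₃.re) / 2 * r' -
    (t₁.im + t₂.im - t₃.im) / 2 * i'

/-- Once the sum is fixed, both quantities are affine functions of `Re t₃`; the quadratic relation
for `h` is the condition for them to be proportional. -/
theorem chordFactor_of_sum (p : FocalParams ε h) (h₁ : ‖t₁‖ = 1) (h₂ : ‖t₂‖ = 1) (h₃ : ‖t₃‖ = 1)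
    (hs : t₁ + t₂ + t₃ = h) :
    chordFactor ε t₁ t₂ = FocalParams.ratio ε h * (1 - cosBetween t₁ t₂) := by
  have h1 := cosBetween_of_sum h₁ h₂ h₃ hs
  have hn := p.ne
  have r := congrArg Complex.re hs
  simp at r
  have r' : t₁.re + t₂.re = h - t₃.re := by linarith
  have h2 : cosBetween t₁ t₂ = 1 - (3 - h ^ 2 + 2 * h * t₃.re) / 2 := by linarith
  rw [h1, chordFactor, r', h2, FocalParams.ratio]
  field_simp
  linear_combination 2 * p.rel

theorem side_pos (p : FocalParams ε h) (h₃ : ‖t₃‖ = 1) : 0 < 3 - h ^ 2 + 2 * h * t₃.re := by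
  have h1 := sq_re_add_sq_im h₃
  have h2 := p.sq_lt
  nlinarith [sq_nonneg (h + t₃.re), sq_nonneg t₃.im]

theorem ne_of_sum (p : FocalParams ε h) (h₁ : ‖t₁‖ = 1) (h₂ : ‖t₂‖ = 1) (h₃ : ‖t₃‖ = 1)
    (hs : t₁ + t₂ + t₃ = h) : t₁ ≠ t₂ := by
  rintro rfl
  have h1 := cosBetween_of_sum h₁ h₂ h₃ hs
  have h2 := side_pos p h₃
  have h3 := sq_re_add_sq_im h₁
  unfold cosBetween at h1
  nlinarith

/-- By the proportionality of `chordFactor` and `1 - cosBetween` the radicand of `dist_limacon` is a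
constant times a square, so that the sides are affine in the real parts. -/
theorem dist_limacon_of_sum (p : FocalParams ε h) (h₁ : ‖t₁‖ = 1) (h₂ : ‖t₂‖ = 1) (h₃ : ‖t₃‖ = 1)
    (hs : t₁ + t₂ + t₃ = h) : dist (limacon ε t₁) (limacon ε t₂) =
      √(2 * FocalParams.ratio ε h) / 2 * (3 - h ^ 2 + 2 * h * t₃.re) := by
  have h1 := cosBetween_of_sum h₁ h₂ h₃ hs
  have h2 := side_pos p h₃
  have h3 := p.ratio_pos
  rw [dist_limacon h₁ h₂, chordFactor_of_sum p h₁ h₂ h₃ hs, h1,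
    show 2 * ((3 - h ^ 2 + 2 * h * t₃.re) / 2) *
      (FocalParams.ratio ε h * ((3 - h ^ 2 + 2 * h * t₃.re) / 2)) =
      2 * FocalParams.ratio ε h * ((3 - h ^ 2 + 2 * h * t₃.re) / 2) ^ 2 by ring,
    Real.sqrt_mul (by positivity), Real.sqrt_sq (by positivity)]
  ring

/-- A line meets the unit circle in at most two points. -/
theorem cross_ne_zero (h₁ : ‖t₁‖ = 1) (h₂ : ‖t₂‖ = 1) (h₃ : ‖t₃‖ = 1) (h12 : t₁ ≠ t₂)
    (h23 : t₂ ≠ t₃) (h31 : t₃ ≠ t₁) :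
    (t₁.re - t₂.re) * (t₂.im - t₃.im) - (t₁.im - t₂.im) * (t₂.re - t₃.re) ≠ 0 := by
  have e1 := sq_re_add_sq_im h₁
  have e2 := sq_re_add_sq_im h₂
  have e3 := sq_re_add_sq_im h₃
  have c12 := cosBetween_lt_one h₁ h₂ h12
  have c23 := cosBetween_lt_one h₂ h₃ h23
  have c31 := cosBetween_lt_one h₃ h₁ h31
  intro h0
  unfold cosBetween at c12 c23 c31
  have hD : (t₂.re - t₃.re) * (t₁.re + t₂.re) + (t₂.im - t₃.im) * (t₁.im + t₂.im) = 0 := by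
    by_contra hD
    have hx : t₁.re - t₂.re = 0 := by
      apply (mul_eq_zero.1 _).resolve_right hD
      linear_combination (t₁.im + t₂.im) * h0 + (t₂.re - t₃.re) * (e1 - e2)
    have hy : t₁.im - t₂.im = 0 := by
      apply (mul_eq_zero.1 _).resolve_right hD
      linear_combination (-(t₁.re + t₂.re)) * h0 + (t₂.im - t₃.im) * (e1 - e2)
    exact h12 (Complex.ext (sub_eq_zero.1 hx) (sub_eq_zero.1 hy))
  have hE : (t₂.re - t₃.re) * (t₁.re - t₃.re) + (t₂.im - t₃.im) * (t₁.im - t₃.im) = 0 := by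
    linear_combination hD - e2 + e3
  have hF : (t₁.re - t₃.re) * (t₂.im - t₃.im) - (t₁.im - t₃.im) * (t₂.re - t₃.re) = 0 := by
    linear_combination h0
  have hG : ((t₂.re - t₃.re) ^ 2 + (t₂.im - t₃.im) ^ 2) *
      ((t₁.re - t₃.re) ^ 2 + (t₁.im - t₃.im) ^ 2) = 0 := by
    linear_combination ((t₂.re - t₃.re) * (t₁.re - t₃.re) + (t₂.im - t₃.im) * (t₁.im - t₃.im)) * hE +
      ((t₁.re - t₃.re) * (t₂.im - t₃.im) - (t₁.im - t₃.im) * (t₂.re - t₃.re)) * hF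
  rcases mul_eq_zero.1 hG with h | h <;> nlinarith

/-- Let `μ` be the common quotient and `A = 1 + μ ε² / 2`. Differences of the three equations `1 -
cos = μ G` say that the vector `A (t₁ + t₂ + t₃) + μ ε` is orthogonal to two sides of the triangle
of the `tᵢ`; these are independent, so it vanishes and the sum is real. Eliminating `μ` leaves the
quadratic equation of `h`. -/
theorem sum_eq_of_ratio_eq (p : FocalParams ε h) (h₁ : ‖t₁‖ = 1) (h₂ : ‖t₂‖ = 1) (h₃ : ‖t₃‖ = 1)
    (h12 : t₁ ≠ t₂) (h23 : t₂ ≠ t₃) (h31 : t₃ ≠ t₁)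
    (q1 : (1 - cosBetween t₁ t₂) / chordFactor ε t₁ t₂ =
      (1 - cosBetween t₂ t₃) / chordFactor ε t₂ t₃)
    (q2 : (1 - cosBetween t₂ t₃) / chordFactor ε t₂ t₃ =
      (1 - cosBetween t₃ t₁) / chordFactor ε t₃ t₁) :
    t₁ + t₂ + t₃ = h := by
  have e1 := sq_re_add_sq_im h₁
  have e2 := sq_re_add_sq_im h₂
  have e3 := sq_re_add_sq_im h₃
  have g12 := chordFactor_pos p.ecc_sq h₁ h₂ h12
  have g23 := chordFactor_pos p.ecc_sq h₂ h₃ h23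
  have g31 := chordFactor_pos p.ecc_sq h₃ h₁ h31
  have c12 := sub_pos.2 (cosBetween_lt_one h₁ h₂ h12)
  have hx := cross_ne_zero h₁ h₂ h₃ h12 h23 h31
  obtain ⟨μ, hμ⟩ : ∃ μ, μ = (1 - cosBetween t₁ t₂) / chordFactor ε t₁ t₂ := ⟨_, rfl⟩
  have μpos : 0 < μ := by rw [hμ]; positivity
  have r12 : 1 - cosBetween t₁ t₂ = μ * chordFactor ε t₁ t₂ := by rw [hμ]; field_simp
  have r23 : 1 - cosBetween t₂ t₃ = μ * chordFactor ε t₂ t₃ := by rw [hμ, q1]; field_simp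
  have r31 : 1 - cosBetween t₃ t₁ = μ * chordFactor ε t₃ t₁ := by rw [hμ, q1, q2]; field_simp
  have Apos : 0 < 1 + μ * ε ^ 2 / 2 := by positivity
  have a1 := abs_le.1 (abs_re_le_one h₁)
  have a2 := abs_le.1 (abs_re_le_one h₂)
  have a3 := abs_le.1 (abs_re_le_one h₃)
  unfold chordFactor cosBetween at r12 r23 r31
  have lin1 : ((1 + μ * ε ^ 2 / 2) * (t₁.re + t₂.re + t₃.re) + μ * ε) * (t₂.re - t₃.re) +
      ((1 + μ * ε ^ 2 / 2) * (t₁.im + t₂.im + t₃.im)) * (t₂.im - t₃.im) = 0 := by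
    linear_combination r31 - r12 + (1 + μ * ε ^ 2 / 2) * (e2 - e3)
  have lin2 : ((1 + μ * ε ^ 2 / 2) * (t₁.re + t₂.re + t₃.re) + μ * ε) * (t₁.re - t₂.re) +
      ((1 + μ * ε ^ 2 / 2) * (t₁.im + t₂.im + t₃.im)) * (t₁.im - t₂.im) = 0 := by
    linear_combination r23 - r31 + (1 + μ * ε ^ 2 / 2) * (e1 - e2)
  have hX : (1 + μ * ε ^ 2 / 2) * (t₁.re + t₂.re + t₃.re) + μ * ε = 0 := by
    apply (mul_eq_zero.1 _).resolve_right hx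
    linear_combination (t₂.im - t₃.im) * lin2 - (t₁.im - t₂.im) * lin1
  have hY : t₁.im + t₂.im + t₃.im = 0 := by
    apply (mul_eq_zero.1 ((mul_eq_zero.1 _).resolve_right hx)).resolve_left Apos.ne'
    linear_combination (t₁.re - t₂.re) * lin1 - (t₂.re - t₃.re) * lin2
  obtain ⟨s, hs⟩ : ∃ s, s = t₁.re + t₂.re + t₃.re := ⟨_, rfl⟩
  rw [← hs] at hX
  have hq : ε * s ^ 2 + 2 * s * (1 + ε ^ 2) + 3 * ε = 0 := by
    have h5 : t₁.re * t₂.re + t₁.im * t₂.im = (s ^ 2 - 1 - 2 * s * t₃.re) / 2 := by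
      have r' : t₁.re + t₂.re = s - t₃.re := by linarith
      have i' : t₁.im + t₂.im = - t₃.im := by linarith
      linear_combination -(e1 + e2 - e3) / 2 + (t₁.re + t₂.re + s - t₃.re) / 2 * r' +
        (t₁.im + t₂.im - t₃.im) / 2 * i'
    have r' : t₁.re + t₂.re = s - t₃.re := by linarith
    rw [h5, r'] at r12
    have h6 : (1 + μ * ε ^ 2 / 2) * (s ^ 2 - 1) = 2 - μ * (2 + ε ^ 2) - 2 * μ * ε * s := by
      linear_combination (-2) * r12 + 2 * t₃.re * hX
    have h7 : μ * (ε * (2 + ε * s)) = -2 * s := by linear_combination 2 * hX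
    linear_combination (-(ε * (2 + ε * s) / 2)) * h6 +
      (ε ^ 2 * (s ^ 2 - 1) / 4 + (2 + ε ^ 2) / 2 + ε * s) * h7
  have hsh : s = h := by
    -- The two roots of the quadratic have product `3`; as `|h| < 1`, the other root exceeds `3` in
    -- absolute value and is not a sum of three unit numbers.
    have h6 : (s - h) * (ε * (s + h) + 2 * (1 + ε ^ 2)) = 0 := by
      linear_combination hq - p.rel
    rcases mul_eq_zero.1 h6 with h7 | h7
    · linarith
    exfalso
    have h8 : ε * (s * h) = 3 * ε := by linear_combination h * h7 - p.rel
    have h9 : s * h = 3 := mul_left_cancel₀ p.ecc_ne (by linarith)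
    have h10 : |s| ≤ 3 := abs_le.2 ⟨by linarith, by linarith⟩
    have h11 : s ^ 2 ≤ 3 ^ 2 := sq_le_sq' (abs_le.1 h10).1 (abs_le.1 h10).2
    have h12 : s ^ 2 * h ^ 2 = 9 := by rw [← mul_pow, h9]; norm_num
    linarith [mul_le_mul_of_nonneg_right h11 (sq_nonneg h), p.sq_lt]
  apply Complex.ext
  · simp; linarith
  · simp; linarith

theorem isThreePeriodic_iff {a b : ℝ} (ha : 0 < a) (hb : 0 < b) (hab : b ^ 2 = a ^ 2 * (1 - ε ^ 2))
    (p : FocalParams ε h) (h₁ : ‖t₁‖ = 1) (h₂ : ‖t₂‖ = 1) (h₃ : ‖t₃‖ = 1) :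
    IsThreePeriodic a b (ellipsePoint a ε t₁) (ellipsePoint a ε t₂) (ellipsePoint a ε t₃) ↔
      t₁ + t₂ + t₃ = h := by
  constructor
  · intro H
    have n12 : t₁ ≠ t₂ := fun e => H.ne_PQ (by rw [e])
    have n23 : t₂ ≠ t₃ := fun e => H.ne_QR (by rw [e])
    have n31 : t₃ ≠ t₁ := fun e => H.ne_RP (by rw [e])
    have q2 := (reflectsAt_iff ha hb p.ecc_sq hab h₂ h₁ h₃ n12.symm n23).1 H.reflects_Q
    have q3 := (reflectsAt_iff ha hb p.ecc_sq hab h₃ h₂ h₁ n23.symm n31).1 H.reflects_R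
    rw [cosBetween_comm t₂ t₁, chordFactor_comm _ t₂ t₁] at q2
    rw [cosBetween_comm t₃ t₂, chordFactor_comm _ t₃ t₂] at q3
    exact sum_eq_of_ratio_eq p h₁ h₂ h₃ n12 n23 n31 q2 q3
  · intro hs
    have key : ∀ u v w : ℂ, ‖u‖ = 1 → ‖v‖ = 1 → ‖w‖ = 1 → u + v + w = h →
        ReflectsAt a b (ellipsePoint a ε w) (ellipsePoint a ε u) (ellipsePoint a ε v) := by
      intro u v w hu hv hw hs
      have s2 : u + w + v = h := by rw [← hs]; ring
      have n1 := ne_of_sum p hu hv hw hs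
      have n2 := ne_of_sum p hu hw hv s2
      have c1 := sub_pos.2 (cosBetween_lt_one hu hv n1)
      have c2 := sub_pos.2 (cosBetween_lt_one hu hw n2)
      have := p.ratio_pos
      rw [reflectsAt_iff ha hb p.ecc_sq hab hu hw hv n2 n1, chordFactor_of_sum p hu hv hw hs,
        chordFactor_of_sum p hu hw hv s2]
      field_simp
    have s2 : t₂ + t₃ + t₁ = h := by rw [← hs]; ring
    have s3 : t₃ + t₁ + t₂ = h := by rw [← hs]; ring
    have inj : ∀ u v w : ℂ, ‖u‖ = 1 → ‖v‖ = 1 → ‖w‖ = 1 → u + v + w = h →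
        ellipsePoint a ε u ≠ ellipsePoint a ε v := by
      intro u v w hu hv hw hs
      have n1 := ne_of_sum p hu hv hw hs
      have := chordFactor_pos p.ecc_sq hu hv n1
      have := sub_pos.2 (cosBetween_lt_one hu hv n1)
      have := one_add_mul_re_pos p.ecc_sq hu
      have := one_add_mul_re_pos p.ecc_sq hv
      have := sub_pos.2 p.ecc_sq
      rw [← dist_pos, dist_ellipsePoint ha p.ecc_sq hu hv n1]
      positivity
    exact ⟨ellipsePoint_mem ha p.ecc_sq hab h₁, ellipsePoint_mem ha p.ecc_sq hab h₂,
      ellipsePoint_mem ha p.ecc_sq hab h₃, inj _ _ _ h₁ h₂ h₃ hs, inj _ _ _ h₂ h₃ h₁ s2,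
      inj _ _ _ h₃ h₁ h₂ s3, key _ _ _ h₁ h₂ h₃ hs, key _ _ _ h₂ h₃ h₁ s2, key _ _ _ h₃ h₁ h₂ s3⟩

end Sum


/-! ### Unit triples with prescribed sum and product -/

/-- The Blaschke product `x² (x - h) / (1 - h x)` has modulus less than 1 inside the unit disc and
greater than 1 outside, so it takes the unimodular value `l` only on the circle. -/
theorem norm_eq_one_of_cubic {h : ℝ} (hh : h ^ 2 < 1) {l x : ℂ} (hl : ‖l‖ = 1)
    (hx : x ^ 2 * (x - h) = l * (1 - h * x)) : ‖x‖ = 1 := by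
  have e1 : ‖x‖ ^ 2 * ‖x - h‖ = ‖1 - h * x‖ := by
    have := congrArg norm hx
    rwa [norm_mul, norm_mul, norm_pow, hl, one_mul] at this
  have e2 : ‖1 - h * x‖ ^ 2 - ‖x - h‖ ^ 2 = (1 - h ^ 2) * (1 - ‖x‖ ^ 2) := by
    simp only [Complex.sq_norm, Complex.normSq_apply]
    simp
    ring
  have n0 := norm_nonneg x
  have n1 := norm_nonneg (x - h)
  have n2 := norm_nonneg (1 - h * x)
  have hh' := sub_pos.2 hh
  rcases lt_trichotomy ‖x‖ 1 with hlt | heq | hgt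
  · exfalso
    have h3 : ‖x‖ ^ 2 < 1 := by nlinarith
    have h4 : ‖x - h‖ ^ 2 < ‖1 - h * x‖ ^ 2 := by nlinarith [mul_pos hh' (sub_pos.2 h3)]
    have h5 := lt_of_pow_lt_pow_left₀ 2 n2 h4
    nlinarith
  · exact heq
  · exfalso
    have h3 : 1 < ‖x‖ ^ 2 := by nlinarith
    have h4 : ‖1 - h * x‖ ^ 2 < ‖x - h‖ ^ 2 := by nlinarith [mul_pos hh' (sub_pos.2 h3)]
    have h5 := lt_of_pow_lt_pow_left₀ 2 n1 h4
    nlinarith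

/-- Every unit complex number is the product of three unit numbers of given real sum `h`,
`|h| < 1`. -/
theorem exists_unit_triple {h : ℝ} (hh : h ^ 2 < 1) {l : ℂ} (hl : ‖l‖ = 1) :
    ∃ t₁ t₂ t₃ : ℂ, ‖t₁‖ = 1 ∧ ‖t₂‖ = 1 ∧ ‖t₃‖ = 1 ∧ t₁ + t₂ + t₃ = h ∧ t₁ * t₂ * t₃ = l := by
  have hl0 : l ≠ 0 := by rintro rfl; simp at hl
  -- For unit numbers of real sum `h` and product `l`, conjugation gives `h l` for the sum of the
  -- pairwise products; this determines the cubic whose roots they are.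
  obtain ⟨t₁, h1⟩ : ∃ x : ℂ, x ^ 3 - h * x ^ 2 + l * h * x - l = 0 := by
    have hd : (Polynomial.X ^ 3 - Polynomial.C (h : ℂ) * Polynomial.X ^ 2 +
      Polynomial.C (l * h) * Polynomial.X - Polynomial.C l : Polynomial ℂ).degree = 3 := by
      compute_degree!
    obtain ⟨x, hx⟩ := IsAlgClosed.exists_root _ (by rw [hd]; decide)
    exact ⟨x, by simpa [Polynomial.IsRoot] using hx⟩
  have ht0 : t₁ ≠ 0 := by
    rintro rfl
    exact hl0 (by linear_combination -h1)
  obtain ⟨t₂, h2⟩ : ∃ x : ℂ, x ^ 2 - (h - t₁) * x + l / t₁ = 0 := by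
    have hd : (Polynomial.X ^ 2 - Polynomial.C ((h : ℂ) - t₁) * Polynomial.X +
      Polynomial.C (l / t₁) : Polynomial ℂ).degree = 2 := by
      compute_degree!
    obtain ⟨x, hx⟩ := IsAlgClosed.exists_root _ (by rw [hd]; decide)
    exact ⟨x, by simpa [Polynomial.IsRoot] using hx⟩
  have h2' : t₁ * (t₂ * (h - t₁ - t₂)) = l := by
    field_simp at h2
    linear_combination -h2
  have cubic : ∀ x : ℂ, x ^ 3 - h * x ^ 2 + l * h * x - l =
      (x - t₁) * (x - t₂) * (x - (h - t₁ - t₂)) := by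
    intro x
    apply mul_left_cancel₀ ht0
    linear_combination (-(x - t₁)) * h2' + x * h1
  have root : ∀ x : ℂ, (x - t₁) * (x - t₂) * (x - (h - t₁ - t₂)) = 0 → ‖x‖ = 1 := by
    intro x hx
    rw [← cubic] at hx
    exact norm_eq_one_of_cubic hh hl (by linear_combination hx)
  exact ⟨t₁, t₂, h - t₁ - t₂, root _ (by ring), root _ (by ring), root _ (by ring), by ring,
    by rw [← h2']; ring⟩

theorem dist_sq_plane (P Q : Plane) : dist P Q ^ 2 = (P 0 - Q 0) ^ 2 + (P 1 - Q 1) ^ 2 := by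
  rw [EuclideanSpace.dist_eq, Real.sq_sqrt (Finset.sum_nonneg fun _ _ => sq_nonneg _),
    Fin.sum_univ_two, Real.dist_eq, Real.dist_eq, sq_abs, sq_abs]

theorem circumcenter_barycentric {P Q R O : Plane}
    (h : IsTriangle (dist Q R) (dist R P) (dist P Q) (∠ R P Q) (∠ P Q R) (∠ Q R P))
    (h1 : dist P O = dist Q O) (h2 : dist Q O = dist R O) :
    (dist Q R * Real.cos (∠ R P Q) + dist R P * Real.cos (∠ P Q R) +
        dist P Q * Real.cos (∠ Q R P)) • O =
      (dist Q R * Real.cos (∠ R P Q)) • P + (dist R P * Real.cos (∠ P Q R)) • Q +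
        (dist P Q * Real.cos (∠ Q R P)) • R := by
  have ea := dist_sq_plane Q R
  have eb := dist_sq_plane R P
  have ec := dist_sq_plane P Q
  have s1 : dist P O ^ 2 = dist Q O ^ 2 := by rw [h1]
  have s2 : dist Q O ^ 2 = dist R O ^ 2 := by rw [h2]
  rw [dist_sq_plane, dist_sq_plane] at s1 s2
  obtain ⟨ha, hb, hc, la, lb, lc, cA, cB, cC, -⟩ := h
  -- Heron's product is four times the square of this determinant and is positive by the strict
  -- triangle inequalities.
  have hcr : (P 0 - Q 0) * (Q 1 - R 1) - (P 1 - Q 1) * (Q 0 - R 0) ≠ 0 := by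
    intro h0
    have := sub_pos.2 la
    have := sub_pos.2 lb
    have := sub_pos.2 lc
    have hpos : 0 < (dist R P + dist P Q - dist Q R) * (dist P Q + dist Q R - dist R P) *
      (dist Q R + dist R P - dist P Q) * (dist Q R + dist R P + dist P Q) := by positivity
    have : (dist R P + dist P Q - dist Q R) * (dist P Q + dist Q R - dist R P) *
      (dist Q R + dist R P - dist P Q) * (dist Q R + dist R P + dist P Q) =
      4 * ((P 0 - Q 0) * (Q 1 - R 1) - (P 1 - Q 1) * (Q 0 - R 0)) ^ 2 := by
      have : (dist R P + dist P Q - dist Q R) * (dist P Q + dist Q R - dist R P) *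
        (dist Q R + dist R P - dist P Q) * (dist Q R + dist R P + dist P Q) =
        4 * dist Q R ^ 2 * dist P Q ^ 2 - (dist R P ^ 2 - dist Q R ^ 2 - dist P Q ^ 2) ^ 2 := by ring
      rw [this, ea, eb, ec]; ring
    rw [this, h0] at hpos
    norm_num at hpos
  rw [cA, cB, cC]
  generalize dist Q R = a at *
  generalize dist R P = b at *
  generalize dist P Q = c at *
  have hx : ∀ x y z w : ℝ,
      ((a * ((b ^ 2 + c ^ 2 - a ^ 2) / (2 * b * c)) + b * ((c ^ 2 + a ^ 2 - b ^ 2) / (2 * c * a)) +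
        c * ((a ^ 2 + b ^ 2 - c ^ 2) / (2 * a * b))) * w =
      (a * ((b ^ 2 + c ^ 2 - a ^ 2) / (2 * b * c))) * x +
        (b * ((c ^ 2 + a ^ 2 - b ^ 2) / (2 * c * a))) * y +
        (c * ((a ^ 2 + b ^ 2 - c ^ 2) / (2 * a * b))) * z) ↔
      a ^ 2 * (b ^ 2 + c ^ 2 - a ^ 2) * (x - w) + b ^ 2 * (c ^ 2 + a ^ 2 - b ^ 2) * (y - w) +
        c ^ 2 * (a ^ 2 + b ^ 2 - c ^ 2) * (z - w) = 0 := by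
    intro x y z w
    field_simp
    constructor <;> intro h <;> linarith
  -- The sum of the vectors from `O` to the vertices, weighted by `a² (b² + c² - a²)` and its
  -- analogues, is orthogonal to `P - Q` and, in `d2`, to `Q - R`; these being independent, it is
  -- zero.
  have d1 : (a ^ 2 * (b ^ 2 + c ^ 2 - a ^ 2) * (P 0 - O 0) +
      b ^ 2 * (c ^ 2 + a ^ 2 - b ^ 2) * (Q 0 - O 0) +
      c ^ 2 * (a ^ 2 + b ^ 2 - c ^ 2) * (R 0 - O 0)) * (P 0 - Q 0) +
      (a ^ 2 * (b ^ 2 + c ^ 2 - a ^ 2) * (P 1 - O 1) +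
      b ^ 2 * (c ^ 2 + a ^ 2 - b ^ 2) * (Q 1 - O 1) +
      c ^ 2 * (a ^ 2 + b ^ 2 - c ^ 2) * (R 1 - O 1)) * (P 1 - Q 1) = 0 := by
    linear_combination
      (a ^ 2 * (b ^ 2 + c ^ 2 - a ^ 2) + b ^ 2 * (c ^ 2 + a ^ 2 - b ^ 2) +
        c ^ 2 * (a ^ 2 + b ^ 2 - c ^ 2)) / 2 * s1 -
      (a ^ 2 * (b ^ 2 + c ^ 2 - a ^ 2) - b ^ 2 * (c ^ 2 + a ^ 2 - b ^ 2)) / 2 * ec -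
      c ^ 2 * (a ^ 2 + b ^ 2 - c ^ 2) / 2 * (ea - eb)
  have d2 : (a ^ 2 * (b ^ 2 + c ^ 2 - a ^ 2) * (P 0 - O 0) +
      b ^ 2 * (c ^ 2 + a ^ 2 - b ^ 2) * (Q 0 - O 0) +
      c ^ 2 * (a ^ 2 + b ^ 2 - c ^ 2) * (R 0 - O 0)) * (Q 0 - R 0) +
      (a ^ 2 * (b ^ 2 + c ^ 2 - a ^ 2) * (P 1 - O 1) +
      b ^ 2 * (c ^ 2 + a ^ 2 - b ^ 2) * (Q 1 - O 1) +
      c ^ 2 * (a ^ 2 + b ^ 2 - c ^ 2) * (R 1 - O 1)) * (Q 1 - R 1) = 0 := by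
    linear_combination
      (a ^ 2 * (b ^ 2 + c ^ 2 - a ^ 2) + b ^ 2 * (c ^ 2 + a ^ 2 - b ^ 2) +
        c ^ 2 * (a ^ 2 + b ^ 2 - c ^ 2)) / 2 * s2 -
      (b ^ 2 * (c ^ 2 + a ^ 2 - b ^ 2) - c ^ 2 * (a ^ 2 + b ^ 2 - c ^ 2)) / 2 * ea -
      a ^ 2 * (b ^ 2 + c ^ 2 - a ^ 2) / 2 * (eb - ec)
  have v0 := (mul_eq_zero.1 (show (a ^ 2 * (b ^ 2 + c ^ 2 - a ^ 2) * (P 0 - O 0) +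
      b ^ 2 * (c ^ 2 + a ^ 2 - b ^ 2) * (Q 0 - O 0) +
      c ^ 2 * (a ^ 2 + b ^ 2 - c ^ 2) * (R 0 - O 0)) *
      ((P 0 - Q 0) * (Q 1 - R 1) - (P 1 - Q 1) * (Q 0 - R 0)) = 0 by
    linear_combination (Q 1 - R 1) * d1 - (P 1 - Q 1) * d2)).resolve_right hcr
  have v1 := (mul_eq_zero.1 (show (a ^ 2 * (b ^ 2 + c ^ 2 - a ^ 2) * (P 1 - O 1) +
      b ^ 2 * (c ^ 2 + a ^ 2 - b ^ 2) * (Q 1 - O 1) +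
      c ^ 2 * (a ^ 2 + b ^ 2 - c ^ 2) * (R 1 - O 1)) *
      ((P 0 - Q 0) * (Q 1 - R 1) - (P 1 - Q 1) * (Q 0 - R 0)) = 0 by
    linear_combination (P 0 - Q 0) * d2 - (Q 0 - R 0) * d1)).resolve_right hcr
  ext i
  simp only [PiLp.add_apply, PiLp.smul_apply, smul_eq_mul]
  fin_cases i
  · exact (hx _ _ _ _).2 v0
  · exact (hx _ _ _ _).2 v1

/-! ### Sides of the focus-inversive triangle and the constancy of `r / R` -/

section Sum

variable {ε h : ℝ} {t₁ t₂ t₃ : ℂ}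

/-- Vertices of the focus-inversive triangle: the focus is `f`, and `s` is a scale. -/
noncomputable def inversePoint (f s ε : ℝ) (t : ℂ) : Plane := toPlane (f + s * limacon ε t)

theorem dist_inversePoint (p : FocalParams ε h) {f s : ℝ} (hs : 0 < s) (h₁ : ‖t₁‖ = 1)
    (h₂ : ‖t₂‖ = 1) (h₃ : ‖t₃‖ = 1) (hsum : t₁ + t₂ + t₃ = h) :
    dist (inversePoint f s ε t₁) (inversePoint f s ε t₂) =
      s * (√(2 * FocalParams.ratio ε h) / 2) * (3 - h ^ 2 + 2 * h * t₃.re) := by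
  rw [inversePoint, inversePoint, toPlane.dist_map, dist_add_left, Complex.dist_eq, ← mul_sub,
    norm_mul, ← Complex.dist_eq, dist_limacon_of_sum p h₁ h₂ h₃ hsum, Complex.norm_real,
    Real.norm_of_nonneg hs.le]
  ring

theorem isTriangle_inversePoint (p : FocalParams ε h) {f s : ℝ} (hs : 0 < s) (h₁ : ‖t₁‖ = 1)
    (h₂ : ‖t₂‖ = 1) (h₃ : ‖t₃‖ = 1) (hsum : t₁ + t₂ + t₃ = h) :
    IsTriangle (dist (inversePoint f s ε t₂) (inversePoint f s ε t₃))
      (dist (inversePoint f s ε t₃) (inversePoint f s ε t₁))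
      (dist (inversePoint f s ε t₁) (inversePoint f s ε t₂))
      (∠ (inversePoint f s ε t₃) (inversePoint f s ε t₁) (inversePoint f s ε t₂))
      (∠ (inversePoint f s ε t₁) (inversePoint f s ε t₂) (inversePoint f s ε t₃))
      (∠ (inversePoint f s ε t₂) (inversePoint f s ε t₃) (inversePoint f s ε t₁)) := by
  have d3 := dist_inversePoint (f := f) p hs h₁ h₂ h₃ hsum
  have d1 := dist_inversePoint (f := f) p hs h₂ h₃ h₁ (by rw [← hsum]; ring)
  have d2 := dist_inversePoint (f := f) p hs h₃ h₁ h₂ (by rw [← hsum]; ring)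
  have r := congrArg Complex.re hsum
  simp at r
  have hσ : 0 < s * (√(2 * FocalParams.ratio ε h) / 2) := by have := p.ratio_pos; positivity
  have p1 := side_pos p h₁
  have p2 := side_pos p h₂
  have p3 := side_pos p h₃
  -- Up to scale this is the sum of two sides minus the third, the real parts having sum `h`.
  have semi : ∀ t : ℂ, ‖t‖ = 1 → 0 < 3 + h ^ 2 - 4 * h * t.re := by
    intro t ht
    have h1 := sq_re_add_sq_im ht
    have h2 := p.sq_lt
    nlinarith [sq_nonneg (h - t.re), sq_nonneg t.im, sq_nonneg (2 * h - t.re),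
      sq_nonneg (h + t.re)]
  have q1 := semi _ h₁
  have q2 := semi _ h₂
  have q3 := semi _ h₃
  have r' : 2 * h * t₁.re + 2 * h * t₂.re + 2 * h * t₃.re = 2 * h ^ 2 := by
    linear_combination 2 * h * r
  apply isTriangle_of_dist <;> rw [d1, d2, d3] at *
  · positivity
  · positivity
  · positivity
  all_goals
    rw [← mul_add]
    refine mul_lt_mul_of_pos_left ?_ hσ
    linarith

/-- Both sides are `r / R`, which equals `(b + c - a)(c + a - b)(a + b - c) / (2 a b c)`. Numerator
and denominator are symmetric in the real parts of the `tᵢ`, and the relation between these makes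
the quotient constant. -/
theorem sum_cos_sub_one (p : FocalParams ε h) {f s : ℝ} (hs : 0 < s) (h₁ : ‖t₁‖ = 1)
    (h₂ : ‖t₂‖ = 1) (h₃ : ‖t₃‖ = 1) (hsum : t₁ + t₂ + t₃ = h) :
    (1 - h ^ 2) / 2 =
      Real.cos (∠ (inversePoint f s ε t₃) (inversePoint f s ε t₁) (inversePoint f s ε t₂)) +
      Real.cos (∠ (inversePoint f s ε t₁) (inversePoint f s ε t₂) (inversePoint f s ε t₃)) +
      Real.cos (∠ (inversePoint f s ε t₂) (inversePoint f s ε t₃) (inversePoint f s ε t₁)) - 1 := by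
  have T := isTriangle_inversePoint (f := f) p hs h₁ h₂ h₃ hsum
  rw [T.cos_A, T.cos_B, T.cos_C]
  have d3 := dist_inversePoint (f := f) p hs h₁ h₂ h₃ hsum
  have d1 := dist_inversePoint (f := f) p hs h₂ h₃ h₁ (by rw [← hsum]; ring)
  have d2 := dist_inversePoint (f := f) p hs h₃ h₁ h₂ (by rw [← hsum]; ring)
  rw [d1, d2, d3]
  have hσ : 0 < s * (√(2 * FocalParams.ratio ε h) / 2) := by have := p.ratio_pos; positivity
  generalize s * (√(2 * FocalParams.ratio ε h) / 2) = σ at *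
  have p1 := side_pos p h₁
  have p2 := side_pos p h₂
  have p3 := side_pos p h₃
  have e1 := sq_re_add_sq_im h₁
  have e2 := sq_re_add_sq_im h₂
  have e3 := sq_re_add_sq_im h₃
  have r := congrArg Complex.re hsum
  have i := congrArg Complex.im hsum
  simp at r i
  clear T d1 d2 d3 hsum h₁ h₂ h₃
  generalize t₁.re = x at *
  generalize t₂.re = y at *
  generalize t₃.re = z at *
  have hz : z = h - x - y := by linarith
  -- The imaginary parts have sum zero; eliminating them by means of `Im² = 1 - Re²` leaves this
  -- relation between the real parts.
  have rel : 2 * h * (x * y * z) - (1 + h ^ 2) * (x * y + y * z + z * x) -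
      (1 - h ^ 2) * (3 + h ^ 2) / 4 = 0 := by
    have i' : t₁.im + t₂.im = - t₃.im := by linarith
    have j : 2 * (t₁.im * t₂.im) = x ^ 2 + y ^ 2 - z ^ 2 - 1 := by
      linear_combination (t₁.im + t₂.im - t₃.im) * i' - e1 - e2 + e3
    have j2 : (x ^ 2 + y ^ 2 - z ^ 2 - 1) ^ 2 = 4 * (1 - x ^ 2) * (1 - y ^ 2) := by
      rw [← j]
      linear_combination 4 * t₁.im ^ 2 * e2 + 4 * (1 - y ^ 2) * e1
    subst hz
    linear_combination j2 / 4
  have key : (3 + h ^ 2 - 4 * h * x) * (3 + h ^ 2 - 4 * h * y) * (3 + h ^ 2 - 4 * h * z) =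
      (1 - h ^ 2) * ((3 - h ^ 2 + 2 * h * x) * (3 - h ^ 2 + 2 * h * y) *
        (3 - h ^ 2 + 2 * h * z)) := by
    subst hz
    linear_combination (-32 * h ^ 2 - 4 * h ^ 2 * (1 - h ^ 2)) * rel
  have key2 : (1 - h ^ 2) / 2 = (3 + h ^ 2 - 4 * h * x) * (3 + h ^ 2 - 4 * h * y) *
      (3 + h ^ 2 - 4 * h * z) / (2 * ((3 - h ^ 2 + 2 * h * x) * (3 - h ^ 2 + 2 * h * y) *
        (3 - h ^ 2 + 2 * h * z))) := by
    rw [eq_div_iff (by positivity)]; linear_combination -key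
  rw [key2]
  have k1 : 3 + h ^ 2 - 4 * h * x = (3 - h ^ 2 + 2 * h * y) + (3 - h ^ 2 + 2 * h * z) -
    (3 - h ^ 2 + 2 * h * x) := by rw [hz]; ring
  have k2 : 3 + h ^ 2 - 4 * h * y = (3 - h ^ 2 + 2 * h * z) + (3 - h ^ 2 + 2 * h * x) -
    (3 - h ^ 2 + 2 * h * y) := by rw [hz]; ring
  have k3 : 3 + h ^ 2 - 4 * h * z = (3 - h ^ 2 + 2 * h * x) + (3 - h ^ 2 + 2 * h * y) -
    (3 - h ^ 2 + 2 * h * z) := by rw [hz]; ring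
  rw [k1, k2, k3]
  generalize 3 - h ^ 2 + 2 * h * x = a at *
  generalize 3 - h ^ 2 + 2 * h * y = b at *
  generalize 3 - h ^ 2 + 2 * h * z = c at *
  field_simp
  ring

end Sum


/-! ### Existence of the parameters for a given billiard -/

theorem exists_focalParams {a b : ℝ} {F : Plane} (hb : 0 < b) (hab : b < a) (hF : F ∈ foci a b) :
    ∃ ε h : ℝ, FocalParams ε h ∧ b ^ 2 = a ^ 2 * (1 - ε ^ 2) ∧ F = toPlane ((ε * a : ℝ) : ℂ) ∧
      a ^ 2 * (-(ε * h)) = 2 * a ^ 2 - b ^ 2 - √(a ^ 4 - a ^ 2 * b ^ 2 + b ^ 4) := by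
  have ha : 0 < a := hb.trans hab
  obtain ⟨hF0, hF1⟩ := hF
  obtain ⟨δ, hδ⟩ : ∃ δ, δ = √(a ^ 4 - a ^ 2 * b ^ 2 + b ^ 4) := ⟨_, rfl⟩
  have hb2 : b ^ 2 < a ^ 2 := by gcongr
  have hb0 : 0 < b ^ 2 := by positivity
  have δ0 : 0 ≤ δ := hδ ▸ Real.sqrt_nonneg _
  have δ2 : δ ^ 2 = a ^ 4 - a ^ 2 * b ^ 2 + b ^ 4 := by
    rw [hδ]; exact Real.sq_sqrt (by nlinarith)
  rw [← hδ]
  have hE : b ^ 2 = a ^ 2 * (1 - (F 0 / a) ^ 2) := by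
    rw [div_pow, hF0]; field_simp; ring
  have hF00 : F 0 ≠ 0 := by
    intro h0
    rw [h0] at hF0
    linarith
  have hq1 : 0 < 2 * a ^ 2 - b ^ 2 - δ := by
    have : δ ^ 2 < (2 * a ^ 2 - b ^ 2) ^ 2 := by rw [δ2]; nlinarith
    linarith [lt_of_pow_lt_pow_left₀ 2 (by linarith) this]
  have hE1 : (F 0 / a) ^ 2 < 1 := by
    rw [div_pow, div_lt_one (by positivity), hF0]; linarith
  have hE0 : 0 < (F 0 / a) ^ 2 := by positivity
  have hε0 : F 0 / a ≠ 0 := by positivity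
  have hEE : (F 0 / a) ^ 2 = (a ^ 2 - b ^ 2) / a ^ 2 := by rw [div_pow, hF0]
  -- This is the inequality `h² < 1`.
  have hq3 : (2 * a ^ 2 - b ^ 2 - δ) ^ 2 < a ^ 2 * (a ^ 2 - b ^ 2) := by
    by_contra! hc
    have h5 : 2 * δ * (2 * a ^ 2 - b ^ 2) ≤ 4 * a ^ 4 - 4 * a ^ 2 * b ^ 2 + 2 * b ^ 4 := by
      nlinarith
    have h6 : (2 * δ * (2 * a ^ 2 - b ^ 2)) ^ 2 ≤
        (4 * a ^ 4 - 4 * a ^ 2 * b ^ 2 + 2 * b ^ 4) ^ 2 := by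
      apply pow_le_pow_left₀ _ h5
      have : 0 < 2 * a ^ 2 - b ^ 2 := by linarith
      positivity
    have h7 : (4 * a ^ 4 - 4 * a ^ 2 * b ^ 2 + 2 * b ^ 4) ^ 2 -
        (2 * δ * (2 * a ^ 2 - b ^ 2)) ^ 2 = -(4 * a ^ 2 * (b ^ 4 * (a ^ 2 - b ^ 2))) := by
      rw [mul_pow, mul_pow, δ2]; ring
    have : 0 < 4 * a ^ 2 * (b ^ 4 * (a ^ 2 - b ^ 2)) := by
      have := sub_pos.2 hb2; positivity
    linarith
  -- The relation for `h` is quadratic in `ε h` with roots `-(2 a² - b² ∓ δ) / a²`; the one of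
  -- smaller modulus is chosen. The sign of `ε` distinguishes the two foci.
  refine ⟨F 0 / a, -((2 * a ^ 2 - b ^ 2 - δ) / a ^ 2) / (F 0 / a), ⟨hε0, hE1, ?_, ?_, ?_⟩, hE, ?_, ?_⟩
  · exact div_ne_zero (neg_ne_zero.2 (by positivity)) hε0
  · rw [div_pow, hEE, neg_sq, div_pow, div_lt_one (by have := sub_pos.2 hb2; positivity),
      div_lt_div_iff₀ (by positivity) (by positivity)]
    nlinarith [mul_lt_mul_of_pos_left hq3 (show 0 < a ^ 2 by positivity)]
  · have e1 : F 0 / a * (-((2 * a ^ 2 - b ^ 2 - δ) / a ^ 2) / (F 0 / a)) =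
      -((2 * a ^ 2 - b ^ 2 - δ) / a ^ 2) := by field_simp
    generalize -((2 * a ^ 2 - b ^ 2 - δ) / a ^ 2) / (F 0 / a) = h at *
    apply mul_left_cancel₀ hε0
    have : (F 0 / a * h) ^ 2 + 2 * (F 0 / a * h) * (1 + (F 0 / a) ^ 2) + 3 * (F 0 / a) ^ 2 = 0 := by
      rw [e1, hEE]
      field_simp
      linear_combination δ2
    linear_combination this
  · ext i
    fin_cases i
    · simp; field_simp
    · simpa using hF1
  · field_simp

/-! ### The loci of incenter, centroid and circumcenter -/

section Sum

variable {ε h : ℝ} {t₁ t₂ t₃ : ℂ}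

/-- The constant `u` in the locus `u + v λ`, `‖λ‖ = 1`, of `X_1` in the normalized position. -/
noncomputable def incenterConst (ε h : ℝ) : ℝ := (6 * h + ε * (9 + 3 * h ^ 2) / 2) / (9 - h ^ 2)

/-- The coefficient `v` in the locus `u + v λ` of `X_1`. -/
noncomputable def incenterCoeff (ε h : ℝ) : ℝ := -(h * (ε * (3 + h ^ 2) + 4 * h) / 2) / (9 - h ^ 2)

/-- The constant `u` in the locus `u + v λ` of `X_2`. -/
noncomputable def centroidConst (ε h : ℝ) : ℝ := (h + ε * (3 + h ^ 2) / 2) / 3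

/-- The coefficient `v` in the locus `u + v λ` of `X_2`. -/
noncomputable def centroidCoeff (ε h : ℝ) : ℝ := -(ε * h) / 3

/-- The coefficient `v` in the locus `u + v λ` of `X_3`. -/
noncomputable def circumcenterCoeff (ε h : ℝ) : ℝ := -(ε ^ 2) / ((2 + ε * h) ^ 2 - ε ^ 2)

/-- The constant `u` in the locus `u + v λ` of `X_3`. -/
noncomputable def circumcenterConst (ε h : ℝ) : ℝ :=
  ε / 2 + ε * (2 + ε * h) / ((2 + ε * h) ^ 2 - ε ^ 2)

theorem mul_conj_of_norm {t : ℂ} (ht : ‖t‖ = 1) : t * (starRingEnd ℂ) t = 1 := by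
  rw [Complex.mul_conj, Complex.normSq_eq_norm_sq, ht]; simp

theorem ofReal_re_eq (t : ℂ) : (t.re : ℂ) = (t + (starRingEnd ℂ) t) / 2 := Complex.re_eq_add_conj t

theorem limacon_eq {t : ℂ} (ht : ‖t‖ = 1) : limacon ε t = t + ε / 2 * (t ^ 2 + 1) := by
  rw [limacon]
  push_cast
  rw [ofReal_re_eq]
  linear_combination ε / 2 * mul_conj_of_norm ht

theorem conj_sum (hsum : t₁ + t₂ + t₃ = h) :
    (starRingEnd ℂ) t₁ + (starRingEnd ℂ) t₂ + (starRingEnd ℂ) t₃ = h := by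
  have := congrArg (starRingEnd ℂ) hsum
  simpa using this

/-- Multiply the conjugate of the sum by `t₁ t₂ t₃`, the conjugate of a unit number being its
inverse. -/
theorem sum_mul_pairs (h₁ : ‖t₁‖ = 1) (h₂ : ‖t₂‖ = 1) (h₃ : ‖t₃‖ = 1) (hsum : t₁ + t₂ + t₃ = h) :
    t₁ * t₂ + t₂ * t₃ + t₃ * t₁ = h * (t₁ * t₂ * t₃) := by
  have c := conj_sum hsum
  have m1 := mul_conj_of_norm h₁
  have m2 := mul_conj_of_norm h₂
  have m3 := mul_conj_of_norm h₃
  linear_combination t₁ * t₂ * t₃ * c - t₂ * t₃ * m1 - t₃ * t₁ * m2 - t₁ * t₂ * m3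

theorem sum_limacon (h₁ : ‖t₁‖ = 1) (h₂ : ‖t₂‖ = 1) (h₃ : ‖t₃‖ = 1) (hsum : t₁ + t₂ + t₃ = h) :
    limacon ε t₁ + limacon ε t₂ + limacon ε t₃ =
      3 * (centroidConst ε h + centroidCoeff ε h * (t₁ * t₂ * t₃)) := by
  have e2 := sum_mul_pairs h₁ h₂ h₃ hsum
  rw [limacon_eq h₁, limacon_eq h₂, limacon_eq h₃, centroidConst, centroidCoeff]
  push_cast
  linear_combination (1 + ε / 2 * (t₁ + t₂ + t₃ + h)) * hsum - ε * e2

theorem sum_side_mul_limacon (p : FocalParams ε h) (h₁ : ‖t₁‖ = 1) (h₂ : ‖t₂‖ = 1) (h₃ : ‖t₃‖ = 1)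
    (hsum : t₁ + t₂ + t₃ = h) :
    ((3 - h ^ 2 + 2 * h * t₁.re : ℝ) : ℂ) * limacon ε t₁ +
      ((3 - h ^ 2 + 2 * h * t₂.re : ℝ) : ℂ) * limacon ε t₂ +
      ((3 - h ^ 2 + 2 * h * t₃.re : ℝ) : ℂ) * limacon ε t₃ =
      (9 - h ^ 2 : ℝ) * (incenterConst ε h + incenterCoeff ε h * (t₁ * t₂ * t₃)) := by
  have c := conj_sum hsum
  have e2 := sum_mul_pairs h₁ h₂ h₃ hsum
  have h9 : (9 - h ^ 2 : ℝ) ≠ 0 := by nlinarith [p.sq_lt]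
  have k1 : (9 - h ^ 2 : ℝ) * incenterConst ε h = 6 * h + ε * (9 + 3 * h ^ 2) / 2 := by
    rw [incenterConst]; field_simp
  have k2 : (9 - h ^ 2 : ℝ) * incenterCoeff ε h = -(h * (ε * (3 + h ^ 2) + 4 * h) / 2) := by
    rw [incenterCoeff]; field_simp
  have k1' := congrArg (Complex.ofReal) k1
  have k2' := congrArg (Complex.ofReal) k2
  rw [mul_add, ← mul_assoc, ← Complex.ofReal_mul, ← Complex.ofReal_mul, k1, k2]
  have term : ∀ t : ℂ, ‖t‖ = 1 → ((3 - h ^ 2 + 2 * h * t.re : ℝ) : ℂ) * limacon ε t =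
      (3 - h ^ 2) * (t + ε / 2 * (t ^ 2 + 1)) + h * (t ^ 2 + 1) +
        h * ε / 2 * (t ^ 3 + 2 * t + (starRingEnd ℂ) t) := by
    intro t ht
    rw [limacon_eq ht]
    push_cast
    rw [ofReal_re_eq]
    linear_combination (h + h * ε / 2 * t) * mul_conj_of_norm ht
  rw [term _ h₁, term _ h₂, term _ h₃]
  push_cast
  have p2 : t₁ ^ 2 + t₂ ^ 2 + t₃ ^ 2 = h ^ 2 - 2 * (h * (t₁ * t₂ * t₃)) := by
    linear_combination (t₁ + t₂ + t₃ + h) * hsum - 2 * e2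
  have p3 : t₁ ^ 3 + t₂ ^ 3 + t₃ ^ 3 = h ^ 3 - 3 * h ^ 2 * (t₁ * t₂ * t₃) + 3 * (t₁ * t₂ * t₃) := by
    linear_combination (t₁ ^ 2 + t₂ ^ 2 + t₃ ^ 2 - (t₁ * t₂ + t₂ * t₃ + t₃ * t₁)) * hsum +
      h * p2 - h * e2
  linear_combination ((3 - h ^ 2) + h * ε) * hsum + ((3 - h ^ 2) * ε / 2 + h) * p2 +
    h * ε / 2 * p3 + h * ε / 2 * c

/-- The `tᵢ` are the roots of `t³ - h t² + h λ t - λ`, so `t² = λ t̄ + h t - h λ`. This reduces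
`|z(t) - (u + v λ)|²` to an expression of degree one in `t` and `t̄`. The constants `u`, `v` are
chosen to annihilate its nonconstant part, so the value is the same at all three vertices. -/
theorem normSq_sub_circumcenter (p : FocalParams ε h) (h₁ : ‖t₁‖ = 1) (h₂ : ‖t₂‖ = 1)
    (h₃ : ‖t₃‖ = 1) (hsum : t₁ + t₂ + t₃ = h) :
    ‖limacon ε t₁ - (circumcenterConst ε h + circumcenterCoeff ε h * (t₁ * t₂ * t₃))‖ =
      ‖limacon ε t₂ - (circumcenterConst ε h + circumcenterCoeff ε h * (t₁ * t₂ * t₃))‖ := by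
  have hl : ‖t₁ * t₂ * t₃‖ = 1 := by simp [h₁, h₂, h₃]
  have hml := mul_conj_of_norm hl
  have hcub : ∀ t : ℂ, (t - t₁) * (t - t₂) * (t - t₃) = 0 → t ^ 3 = h * t ^ 2 -
      h * (t₁ * t₂ * t₃) * t + t₁ * t₂ * t₃ := by
    intro t ht
    linear_combination ht + t ^ 2 * hsum - t * sum_mul_pairs h₁ h₂ h₃ hsum
  have hr1 := hcub t₁ (by ring)
  have hr2 := hcub t₂ (by ring)
  generalize t₁ * t₂ * t₃ = l at *
  have hD : (2 + ε * h) ^ 2 - ε ^ 2 ≠ 0 := by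
    have := p.neg_one_lt_mul
    nlinarith [p.ecc_sq]
  obtain ⟨u, hu⟩ : ∃ u, u = circumcenterConst ε h := ⟨_, rfl⟩
  obtain ⟨v, hv⟩ : ∃ v, v = circumcenterCoeff ε h := ⟨_, rfl⟩
  -- The two linear equations for `u` and `v`: the coefficients of `t + t̄` and of `t λ̄ + t̄ λ`
  -- vanish.
  have r1 : u * (2 + ε * h) + ε * v = 2 * ε + ε ^ 2 * h / 2 := by
    rw [hu, hv, circumcenterConst, circumcenterCoeff]; field_simp; ring
  have r2 : v * (2 + ε * h) + ε * u = ε ^ 2 / 2 := by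
    rw [hu, hv, circumcenterConst, circumcenterCoeff]; field_simp; ring
  have r1' := congrArg (Complex.ofReal) r1
  have r2' := congrArg (Complex.ofReal) r2
  push_cast at r1' r2'
  rw [← hu, ← hv]
  have key : ∀ t : ℂ, ‖t‖ = 1 → t ^ 3 = h * t ^ 2 - h * l * t + l →
      (limacon ε t - (u + v * l)) * (starRingEnd ℂ) (limacon ε t - (u + v * l)) =
      1 + ε ^ 2 / 2 - ε ^ 2 / 4 * h * (l + (starRingEnd ℂ) l) -
        (u + v * (starRingEnd ℂ) l) * (ε / 2) * (1 - l * h) -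
        (u + v * l) * (ε / 2) * (1 - (starRingEnd ℂ) l * h) +
        (u + v * l) * (u + v * (starRingEnd ℂ) l) := by
    intro t ht hr
    have hm := mul_conj_of_norm ht
    have s1 : t ^ 2 = l * (starRingEnd ℂ) t + h * t - l * h := by
      have ht0 : t ≠ 0 := by rintro rfl; simp at ht
      apply mul_left_cancel₀ ht0
      linear_combination hr - l * hm
    have s2 : (starRingEnd ℂ) t ^ 2 = (starRingEnd ℂ) l * t + h * (starRingEnd ℂ) t -
        (starRingEnd ℂ) l * h := by
      have := congrArg (starRingEnd ℂ) s1
      simpa using this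
    rw [limacon_eq ht]
    simp only [map_sub, map_add, map_mul, map_pow, map_div₀, map_one, map_ofNat,
      Complex.conj_ofReal]
    generalize (starRingEnd ℂ) t = s at *
    generalize (starRingEnd ℂ) l = m at *
    linear_combination (1 + ε / 2 * (s + t) + ε ^ 2 / 4 * (t * s + 1)) * hm +
      (ε ^ 2 / 4 - ε / 2 * (u + v * m)) * s1 + (ε ^ 2 / 4 - ε / 2 * (u + v * l)) * s2 -
      (t + s) / 2 * r1' - (t * m + s * l) / 2 * r2' - v * ε / 2 * (t + s) * hml
  have n1 := key t₁ h₁ hr1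
  have n2 := key t₂ h₂ hr2
  rw [← n2, Complex.mul_conj, Complex.mul_conj, Complex.normSq_eq_norm_sq,
    Complex.normSq_eq_norm_sq] at n1
  exact (sq_eq_sq₀ (norm_nonneg _) (norm_nonneg _)).1 (by exact_mod_cast n1)

end Sum


/-! ### The circles swept by the 28 centers -/

section Locus

variable {ε h : ℝ}

theorem mem_inversiveLocus_iff {a b ρ : ℝ} (ha : 0 < a) (hb : 0 < b)
    (hab : b ^ 2 = a ^ 2 * (1 - ε ^ 2)) (p : FocalParams ε h) {k : ℕ} {X : Plane} :
    X ∈ inversiveLocus k a b ρ (toPlane ((ε * a : ℝ) : ℂ)) ↔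
      ∃ t₁ t₂ t₃ : ℂ, ‖t₁‖ = 1 ∧ ‖t₂‖ = 1 ∧ ‖t₃‖ = 1 ∧ t₁ + t₂ + t₃ = h ∧
        IsKimberlingCenter k (inversePoint (ε * a) (ρ ^ 2 / (a * (1 - ε ^ 2))) ε t₁)
          (inversePoint (ε * a) (ρ ^ 2 / (a * (1 - ε ^ 2))) ε t₂)
          (inversePoint (ε * a) (ρ ^ 2 / (a * (1 - ε ^ 2))) ε t₃) X := by
  have inv : ∀ t : ℂ, ‖t‖ = 1 → inversion (toPlane ((ε * a : ℝ) : ℂ)) ρ (ellipsePoint a ε t) =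
      inversePoint (ε * a) (ρ ^ 2 / (a * (1 - ε ^ 2))) ε t :=
    fun t ht => inversion_ellipsePoint ha p.ecc_sq ρ ht
  constructor
  · rintro ⟨P, Q, R, H, hX⟩
    obtain ⟨t₁, h₁, rfl⟩ := exists_ellipsePoint ha hb p.ecc_sq hab H.mem_P
    obtain ⟨t₂, h₂, rfl⟩ := exists_ellipsePoint ha hb p.ecc_sq hab H.mem_Q
    obtain ⟨t₃, h₃, rfl⟩ := exists_ellipsePoint ha hb p.ecc_sq hab H.mem_R
    rw [inv _ h₁, inv _ h₂, inv _ h₃] at hX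
    exact ⟨t₁, t₂, t₃, h₁, h₂, h₃, (isThreePeriodic_iff ha hb hab p h₁ h₂ h₃).1 H, hX⟩
  · rintro ⟨t₁, t₂, t₃, h₁, h₂, h₃, hs, hX⟩
    refine ⟨_, _, _, (isThreePeriodic_iff ha hb hab p h₁ h₂ h₃).2 hs, ?_⟩
    rwa [inv _ h₁, inv _ h₂, inv _ h₃]

/-- The sum of the coefficients in `centerCoeff`. -/
noncomputable def coeffTotal (k : ℕ) (κ : ℝ) : ℝ :=
  (centerCoeff k κ).1 + (centerCoeff k κ).2.1 + (centerCoeff k κ).2.2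

/-- The center of the normalized locus, up to `coeffTotal`. -/
noncomputable def locusConst (k : ℕ) (ε h : ℝ) : ℝ :=
  (centerCoeff k ((1 - h ^ 2) / 2)).1 * incenterConst ε h +
    (centerCoeff k ((1 - h ^ 2) / 2)).2.1 * centroidConst ε h +
    (centerCoeff k ((1 - h ^ 2) / 2)).2.2 * circumcenterConst ε h

/-- The signed radius of the normalized locus, up to `coeffTotal`. -/
noncomputable def locusCoeff (k : ℕ) (ε h : ℝ) : ℝ :=
  (centerCoeff k ((1 - h ^ 2) / 2)).1 * incenterCoeff ε h +
    (centerCoeff k ((1 - h ^ 2) / 2)).2.1 * centroidCoeff ε h +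
    (centerCoeff k ((1 - h ^ 2) / 2)).2.2 * circumcenterCoeff ε h

theorem isKimberlingCenter_inversePoint_iff {k : ℕ} (hk : k ∈ circularIndices)
    (p : FocalParams ε h) {f s : ℝ} (hs : 0 < s) {t₁ t₂ t₃ : ℂ} (h₁ : ‖t₁‖ = 1)
    (h₂ : ‖t₂‖ = 1) (h₃ : ‖t₃‖ = 1) (hsum : t₁ + t₂ + t₃ = h) {X : Plane} :
    IsKimberlingCenter k (inversePoint f s ε t₁) (inversePoint f s ε t₂) (inversePoint f s ε t₃) X ↔
      coeffTotal k ((1 - h ^ 2) / 2) ≠ 0 ∧ coeffTotal k ((1 - h ^ 2) / 2) • X =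
        toPlane ((coeffTotal k ((1 - h ^ 2) / 2) * f + s * locusConst k ε h : ℝ) +
          (s * locusCoeff k ε h : ℝ) * (t₁ * t₂ * t₃)) := by
  have T := isTriangle_inversePoint (f := f) p hs h₁ h₂ h₃ hsum
  have hκ := sum_cos_sub_one (f := f) p hs h₁ h₂ h₃ hsum
  have d3 := dist_inversePoint (f := f) p hs h₁ h₂ h₃ hsum
  have d1 := dist_inversePoint (f := f) p hs h₂ h₃ h₁ (by rw [← hsum]; ring)
  have d2 := dist_inversePoint (f := f) p hs h₃ h₁ h₂ (by rw [← hsum]; ring)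
  have s1 := sum_side_mul_limacon p h₁ h₂ h₃ hsum
  have s2 := sum_limacon (ε := ε) h₁ h₂ h₃ hsum
  have r := congrArg Complex.re hsum
  simp at r
  have hI : (dist (inversePoint f s ε t₂) (inversePoint f s ε t₃) +
      dist (inversePoint f s ε t₃) (inversePoint f s ε t₁) +
      dist (inversePoint f s ε t₁) (inversePoint f s ε t₂)) •
        toPlane (f + s * (incenterConst ε h + incenterCoeff ε h * (t₁ * t₂ * t₃))) =
      dist (inversePoint f s ε t₂) (inversePoint f s ε t₃) • inversePoint f s ε t₁ +
      dist (inversePoint f s ε t₃) (inversePoint f s ε t₁) • inversePoint f s ε t₂ +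
      dist (inversePoint f s ε t₁) (inversePoint f s ε t₂) • inversePoint f s ε t₃ := by
    rw [d1, d2, d3]
    have e : 3 - h ^ 2 + 2 * h * t₁.re + (3 - h ^ 2 + 2 * h * t₂.re) +
        (3 - h ^ 2 + 2 * h * t₃.re) = 9 - h ^ 2 := by
      rw [← r]; ring
    rw [← mul_add, ← mul_add, e]
    simp only [inversePoint, ← map_smul, ← map_add, Complex.real_smul]
    congr 1
    have e' := congrArg Complex.ofReal e
    push_cast at s1 e' ⊢
    linear_combination (-(s * (((√(2 * FocalParams.ratio ε h) : ℝ) : ℂ) / 2)) * f) * e' -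
      s * (((√(2 * FocalParams.ratio ε h) : ℝ) : ℂ) / 2) * s * s1
  have hG : (3 : ℝ) • toPlane (f + s * (centroidConst ε h + centroidCoeff ε h * (t₁ * t₂ * t₃))) =
      inversePoint f s ε t₁ + inversePoint f s ε t₂ + inversePoint f s ε t₃ := by
    simp only [inversePoint, ← map_smul, ← map_add, Complex.real_smul]
    congr 1
    push_cast
    linear_combination -s * s2
  have dO : ∀ t : ℂ, dist (inversePoint f s ε t)
      (toPlane (f + s * (circumcenterConst ε h + circumcenterCoeff ε h * (t₁ * t₂ * t₃)))) =
      s * ‖limacon ε t - (circumcenterConst ε h + circumcenterCoeff ε h * (t₁ * t₂ * t₃))‖ := by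
    intro t
    rw [inversePoint, toPlane.dist_map, dist_add_left, Complex.dist_eq, ← mul_sub, norm_mul,
      Complex.norm_real, Real.norm_of_nonneg hs.le]
  have n1 := normSq_sub_circumcenter p h₁ h₂ h₃ hsum
  have n2 := normSq_sub_circumcenter p h₂ h₃ h₁ (by rw [← hsum]; ring)
  rw [show t₂ * t₃ * t₁ = t₁ * t₂ * t₃ by ring] at n2
  have hO := circumcenter_barycentric T (by rw [dO, dO, n1]) (by rw [dO, dO, n2])
  rw [T.sum_mul_cos, ← hκ] at hO
  rw [isKimberlingCenter_iff hk T hκ hI hG hO]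
  have e : (centerCoeff k ((1 - h ^ 2) / 2)).1 •
        toPlane (f + s * (incenterConst ε h + incenterCoeff ε h * (t₁ * t₂ * t₃))) +
      (centerCoeff k ((1 - h ^ 2) / 2)).2.1 •
        toPlane (f + s * (centroidConst ε h + centroidCoeff ε h * (t₁ * t₂ * t₃))) +
      (centerCoeff k ((1 - h ^ 2) / 2)).2.2 •
        toPlane (f + s * (circumcenterConst ε h + circumcenterCoeff ε h * (t₁ * t₂ * t₃))) =
      toPlane ((coeffTotal k ((1 - h ^ 2) / 2) * f + s * locusConst k ε h : ℝ) +
          (s * locusCoeff k ε h : ℝ) * (t₁ * t₂ * t₃)) := by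
    simp only [← map_smul, ← map_add, Complex.real_smul]
    congr 1
    simp only [coeffTotal, locusConst, locusCoeff]
    push_cast
    ring
  rw [e]
  rfl

/-- Every center is a real constant plus a nonzero real multiple of `t₁ t₂ t₃`, which gives one
inclusion; `exists_unit_triple` supplies an orbit for each point of the circle and gives the other.
-/
theorem inversiveLocus_eq_sphere {k : ℕ} (hk : k ∈ circularIndices) {a b ρ : ℝ} (ha : 0 < a)
    (hb : 0 < b) (hρ : 0 < ρ) (hab : b ^ 2 = a ^ 2 * (1 - ε ^ 2)) (p : FocalParams ε h)
    (hT : coeffTotal k ((1 - h ^ 2) / 2) ≠ 0) (hV : locusCoeff k ε h ≠ 0) :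
    ∃ x r : ℝ, 0 < r ∧ inversiveLocus k a b ρ (toPlane ((ε * a : ℝ) : ℂ)) =
      Metric.sphere !₂[x, 0] r := by
  obtain ⟨s, hs⟩ : ∃ s, s = ρ ^ 2 / (a * (1 - ε ^ 2)) := ⟨_, rfl⟩
  have s0 : 0 < s := by
    have := sub_pos.2 p.ecc_sq
    rw [hs]; positivity
  generalize hTT : coeffTotal k ((1 - h ^ 2) / 2) = T at *
  refine ⟨ε * a + s * locusConst k ε h / T, |s * locusCoeff k ε h / T|, ?_, ?_⟩
  · rw [abs_pos]
    have := s0.ne'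
    positivity
  have hc : (!₂[ε * a + s * locusConst k ε h / T, 0] : Plane) =
      toPlane ((ε * a + s * locusConst k ε h / T : ℝ) : ℂ) := by
    ext i; fin_cases i
    · simp [-Complex.ofReal_add]
    · simp [-Complex.ofReal_add]
  have hform : ∀ (X : Plane) (l : ℂ), T • X = toPlane ((T * (ε * a) + s * locusConst k ε h : ℝ) +
          (s * locusCoeff k ε h : ℝ) * l) ↔
        X = toPlane ((ε * a + s * locusConst k ε h / T : ℝ) + (s * locusCoeff k ε h / T : ℝ) * l) := by
    intro X l
    have : toPlane ((T * (ε * a) + s * locusConst k ε h : ℝ) + (s * locusCoeff k ε h : ℝ) * l) =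
      T • toPlane ((ε * a + s * locusConst k ε h / T : ℝ) + (s * locusCoeff k ε h / T : ℝ) * l) := by
      rw [← map_smul, Complex.real_smul]
      congr 1
      have hT' : (T : ℂ) ≠ 0 := by exact_mod_cast hT
      push_cast
      field_simp
    rw [this]
    exact (smul_right_injective _ hT).eq_iff
  ext X
  rw [mem_inversiveLocus_iff ha hb hab p, ← hs, hc, Metric.mem_sphere]
  constructor
  · rintro ⟨t₁, t₂, t₃, h₁, h₂, h₃, hsum, hX⟩
    rw [isKimberlingCenter_inversePoint_iff hk p s0 h₁ h₂ h₃ hsum, hTT, hform] at hX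
    rw [hX.2, toPlane.dist_map, Complex.dist_eq, add_sub_cancel_left, norm_mul, norm_mul, norm_mul,
      h₁, h₂, h₃, Complex.norm_real, Real.norm_eq_abs]
    ring
  · intro hX
    obtain ⟨w, rfl⟩ := toPlane.surjective X
    rw [toPlane.dist_map, Complex.dist_eq] at hX
    obtain ⟨t₁, t₂, t₃, h₁, h₂, h₃, hsum, hl⟩ := exists_unit_triple p.sq_lt
      (l := (w - (ε * a + s * locusConst k ε h / T : ℝ)) / (s * locusCoeff k ε h / T : ℝ)) (by
        rw [norm_div, hX, Complex.norm_real, Real.norm_eq_abs, div_self]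
        have := s0.ne'
        positivity)
    refine ⟨t₁, t₂, t₃, h₁, h₂, h₃, hsum, ?_⟩
    rw [isKimberlingCenter_inversePoint_iff hk p s0 h₁ h₂ h₃ hsum, hTT, hform, hl]
    refine ⟨hT, congrArg _ ?_⟩
    rw [mul_div_cancel₀]
    · ring
    · have := s0.ne'
      have : s * locusCoeff k ε h / T ≠ 0 := by positivity
      exact_mod_cast this

/-- The sum has a constant sign on `0 < κ < 1/2` except for `k = 90`, where it is `κ² + 2 κ - 1`
with the zero `√2 - 1` in this interval. -/
theorem coeffTotal_ne_zero {k : ℕ} (hk : k ∈ circularIndices) {κ : ℝ} (h0 : 0 < κ)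
    (h1 : κ < 1 / 2) (h90 : k = 90 → κ ^ 2 + 2 * κ - 1 ≠ 0) : coeffTotal k κ ≠ 0 := by
  simp only [circularIndices, Set.mem_insert_iff, Set.mem_singleton_iff] at hk
  rcases hk with rfl | rfl | rfl | rfl | rfl | rfl | rfl | rfl | rfl | rfl | rfl | rfl | rfl | rfl |
    rfl | rfl | rfl | rfl | rfl | rfl | rfl | rfl | rfl | rfl | rfl | rfl | rfl | rfl
  all_goals
    simp only [coeffTotal, centerCoeff]
    first
      | (apply ne_of_gt; linarith)
      | (apply ne_of_lt; linarith)
      | (have := h90 rfl; contrapose! this; linarith)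

/-- Here `x` stands for `1 + ε h`. The bounds `0 < κ < x² < 1` determine the sign except for `k =
46`, where the expression is a nonzero multiple of `x² + x - 1`. -/
theorem radius_combination_ne_zero {k : ℕ} (hk : k ∈ circularIndices) {x κ : ℝ} (h0 : 0 < x)
    (h1 : x < 1) (hκ : κ * (1 + x) = x ^ 2) (h46 : k = 46 → x ^ 2 + x ≠ 1) :
    -3 * (centerCoeff k κ).1 * x ^ 2 + 2 * (centerCoeff k κ).2.1 * x * (2 + x) -
      3 * (centerCoeff k κ).2.2 ≠ 0 := by
  have κ0 : 0 < κ := by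
    by_contra! hc
    nlinarith
  have κ1 : κ < x ^ 2 := by nlinarith
  have κ2 : x ^ 2 < 1 := by nlinarith
  have a1 : 0 < κ * x := by positivity
  have a2 : 0 < κ * x ^ 2 := by positivity
  have a3 : 0 < κ ^ 2 * x ^ 2 := by positivity
  have a4 : κ ^ 2 < κ := by nlinarith
  simp only [circularIndices, Set.mem_insert_iff, Set.mem_singleton_iff] at hk
  rcases hk with rfl | rfl | rfl | rfl | rfl | rfl | rfl | rfl | rfl | rfl | rfl | rfl | rfl | rfl |
    rfl | rfl | rfl | rfl | rfl | rfl | rfl | rfl | rfl | rfl | rfl | rfl | rfl | rfl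
  all_goals
    simp only [centerCoeff]
    first
      | (apply ne_of_gt; nlinarith)
      | (apply ne_of_lt; nlinarith)
      | (have := h46 rfl; contrapose! this; nlinarith)

end Locus


section Radius

variable {ε h : ℝ}

/-- The product `y = ε h` in `(-1, 0)` is a rational parameter: `ε²`, `h²` and hence `κ` are
rational functions of it. -/
theorem FocalParams.ecc_sq_eq (p : FocalParams ε h) :
    ε ^ 2 = -(ε * h) * (2 + ε * h) / (3 + 2 * (ε * h)) := by
  have := p.neg_one_lt_mul
  rw [eq_div_iff (by linarith)]
  linear_combination p.sq_relation

theorem FocalParams.sq_eq (p : FocalParams ε h) :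
    h ^ 2 = -(ε * h) * (3 + 2 * (ε * h)) / (2 + ε * h) := by
  have := p.neg_one_lt_mul
  rw [eq_div_iff (by linarith)]
  apply mul_left_cancel₀ p.ecc_ne
  apply mul_left_cancel₀ p.ecc_ne
  linear_combination ε * h * p.sq_relation

theorem FocalParams.kappa_eq (p : FocalParams ε h) :
    (1 - h ^ 2) / 2 * (1 + (1 + ε * h)) = (1 + ε * h) ^ 2 := by
  have := p.neg_one_lt_mul
  rw [p.sq_eq]
  generalize ε * h = y at *
  have : 2 + y ≠ 0 := by linarith
  field_simp
  ring

/-- In terms of `y = ε h` the radius coefficients of `X₁`, `X₂`, `X₃` are `y (1 + y) / (2 (3 + y))`,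
`-y / 3` and `y / (2 (1 + y) (3 + y))`; a common nonzero factor is taken out. -/
theorem locusCoeff_eq (p : FocalParams ε h) (k : ℕ) :
    locusCoeff k ε h = -(ε * h) / (6 * (1 + ε * h) * (3 + ε * h)) *
      (-3 * (centerCoeff k ((1 - h ^ 2) / 2)).1 * (1 + ε * h) ^ 2 +
        2 * (centerCoeff k ((1 - h ^ 2) / 2)).2.1 * (1 + ε * h) * (2 + (1 + ε * h)) -
        3 * (centerCoeff k ((1 - h ^ 2) / 2)).2.2) := by
  have h1 := p.neg_one_lt_mul
  have h2 := p.mul_neg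
  have hE := p.ecc_sq_eq
  have hH := p.sq_eq
  have e1 : incenterCoeff ε h = (ε * h) * (1 + ε * h) / (2 * (3 + ε * h)) := by
    have : incenterCoeff ε h = -((3 * (ε * h) + h ^ 2 * (ε * h + 4)) / 2) / (9 - h ^ 2) := by
      unfold incenterCoeff; congr 1; ring
    rw [this]
    have h9 : 9 - h ^ 2 ≠ 0 := by nlinarith [p.sq_lt]
    rw [div_eq_div_iff h9 (by linarith)]
    generalize ε * h = y at *
    rw [hH]
    have : 2 + y ≠ 0 := by linarith
    field_simp
    ring
  have e3 : circumcenterCoeff ε h = (ε * h) / (2 * (1 + ε * h) * (3 + ε * h)) := by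
    unfold circumcenterCoeff
    have h9 : (2 + ε * h) ^ 2 - ε ^ 2 ≠ 0 := by nlinarith [p.ecc_sq]
    have : 0 < 1 + ε * h := by linarith
    have : 0 < 3 + ε * h := by linarith
    rw [div_eq_div_iff h9 (by positivity)]
    generalize ε * h = y at *
    rw [hE]
    have : 3 + y * 2 ≠ 0 := by linarith
    field_simp
    ring
  unfold locusCoeff
  rw [e1, e3, centroidCoeff]
  generalize (1 - h ^ 2) / 2 = κ at *
  generalize ε * h = y at *
  have : 1 + y ≠ 0 := by linarith
  have : 3 + y ≠ 0 := by linarith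
  field_simp
  ring

end Radius

theorem inversiveLocus_of_params {k : ℕ} (hk : k ∈ circularIndices) {a b ρ ε h : ℝ} (ha : 0 < a)
    (hb : 0 < b) (hρ : 0 < ρ) (hab : b ^ 2 = a ^ 2 * (1 - ε ^ 2)) (p : FocalParams ε h)
    (h46 : k = 46 → (ε * h) ^ 2 + 3 * (ε * h) + 1 ≠ 0)
    (h90 : k = 90 → (1 + ε * h) ^ 2 ≠ (√2 - 1) * (2 + ε * h)) :
    ∃ x r : ℝ, 0 < r ∧ inversiveLocus k a b ρ (toPlane ((ε * a : ℝ) : ℂ)) =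
      Metric.sphere !₂[x, 0] r := by
  have y1 := p.neg_one_lt_mul
  have y0 := p.mul_neg
  have hκ := p.kappa_eq
  have κ0 : 0 < (1 - h ^ 2) / 2 := by linarith [p.sq_lt]
  have κ1 : (1 - h ^ 2) / 2 < 1 / 2 := by
    have := p.ne
    have : 0 < h ^ 2 := by positivity
    linarith
  refine inversiveLocus_eq_sphere hk ha hb hρ hab p ?_ ?_
  · refine coeffTotal_ne_zero hk κ0 κ1 fun hk90 h0 => h90 hk90 ?_
    generalize (1 - h ^ 2) / 2 = κ at *
    -- The positive zero of `κ² + 2 κ - 1`; by `κ (2 + y) = (1 + y)²` it turns into the condition on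
    -- `y = ε h`.
    have hκ2 : κ + 1 = √2 := by
      rw [eq_comm, Real.sqrt_eq_iff_mul_self_eq (by norm_num) (by linarith)]
      linarith
    rw [← hκ2, ← hκ]
    ring
  · rw [locusCoeff_eq p]
    have c1 : 0 < 1 + ε * h := by linarith
    have c3 : 0 < 3 + ε * h := by linarith
    refine mul_ne_zero (div_ne_zero (by linarith) (by positivity))
      (radius_combination_ne_zero hk c1 (by linarith) hκ fun hk46 h0 => h46 hk46 ?_)
    linarith

theorem inversiveLocus_circularIndices {k : ℕ} (hk : k ∈ circularIndices) {a b ρ : ℝ} {F : Plane}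
    (hb : 0 < b) (hab : b < a) (hρ : 0 < ρ) (hF : F ∈ foci a b)
    (h46 : k = 46 → 2 * a ^ 2 ≠ (5 - √5) * b ^ 2)
    (h90 : k = 90 → √(a ^ 4 - a ^ 2 * b ^ 2 + b ^ 4) *
          (2 * a ^ 2 - b ^ 2 - √(a ^ 4 - a ^ 2 * b ^ 2 + b ^ 4)) ≠
        √2 * a ^ 2 * (a ^ 2 - b ^ 2)) :
    ∃ x r : ℝ, 0 < r ∧ inversiveLocus k a b ρ F = Metric.sphere !₂[x, 0] r := by
  have ha : 0 < a := hb.trans hab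
  obtain ⟨ε, h, p, hab', rfl, hq⟩ := exists_focalParams hb hab hF
  have y1 := p.neg_one_lt_mul
  have y0 := p.mul_neg
  have hE := p.ecc_sq_eq
  refine inversiveLocus_of_params hk ha hb hρ hab' p (fun hk46 h0 => h46 hk46 ?_)
    fun hk90 h0 => h90 hk90 ?_
  · rw [hab', hE]
    generalize ε * h = y at *
    -- The root of `y² + 3 y + 1` in `(-1, 0)` is `(√5 - 3) / 2`.
    have h5 : 3 + 2 * y = √5 := by
      rw [eq_comm, Real.sqrt_eq_iff_mul_self_eq (by norm_num) (by linarith)]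
      linear_combination (-4) * h0
    have h2y : 3 + 2 * y ≠ 0 := by linarith
    rw [← h5]
    field_simp
    linear_combination (2 * y) * h0
  · generalize √(a ^ 4 - a ^ 2 * b ^ 2 + b ^ 4) = δ at *
    have hδ : δ = a ^ 2 * (1 + ε ^ 2 + ε * h) := by rw [hab'] at hq; linear_combination hq
    have e1 : 2 * a ^ 2 - b ^ 2 - δ = a ^ 2 * (-(ε * h)) := hq.symm
    have e2 : a ^ 2 - b ^ 2 = a ^ 2 * ε ^ 2 := by rw [hab']; ring
    rw [e1, e2, hδ, hE]
    generalize ε * h = y at *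
    have h2y : 3 + y * 2 ≠ 0 := by linarith
    have e3 : 1 + -y * (2 + y) / (3 + 2 * y) + y = √2 * (2 + y) / (3 + 2 * y) := by
      field_simp
      linear_combination h0
    rw [e3]
    ring

theorem finite_setOf_quadratic (b c : ℝ) : {x : ℝ | x ^ 2 + b * x + c = 0}.Finite := by
  rcases Set.eq_empty_or_nonempty {x : ℝ | x ^ 2 + b * x + c = 0} with h | ⟨y, hy⟩
  · rw [h]; exact Set.finite_empty
  · refine Set.Finite.subset (Set.toFinite {y, -b - y}) fun x hx => ?_
    have h1 : y ^ 2 + b * y + c = 0 := hy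
    have h2 : x ^ 2 + b * x + c = 0 := hx
    have : (x - y) * (x - (-b - y)) = 0 := by linear_combination h2 - h1
    rcases mul_eq_zero.1 this with h | h
    · left; linarith
    · right; exact Set.mem_singleton_iff.2 (by linarith)

/-- Since `(a / b)² = 1 / (1 - ε²) = (3 + 2 y) / ((1 + y) (3 + y))` for `y = ε h`, the exceptional
aspect ratios are images of the zeros of the two quadratics in `y` that belong to `k = 46` and `k =
90`. -/
theorem sweepsCircle_of_mem {k : ℕ} (hk : k ∈ circularIndices) : SweepsCircle k := by
  refine ⟨(fun y => √((3 + 2 * y) / ((1 + y) * (3 + y)))) ''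
    ({y : ℝ | y ^ 2 + 3 * y + 1 = 0} ∪ {y : ℝ | y ^ 2 + (3 - √2) * y + (3 - 2 * √2) = 0}),
    ((finite_setOf_quadratic _ _).union (finite_setOf_quadratic _ _)).image _,
    fun a b ρ F hb hab hE hρ hF => ?_⟩
  have ha : 0 < a := hb.trans hab
  obtain ⟨ε, h, p, hab', rfl, -⟩ := exists_focalParams hb hab hF
  have y1 := p.neg_one_lt_mul
  have hEq : √((3 + 2 * (ε * h)) / ((1 + ε * h) * (3 + ε * h))) = a / b := by
    rw [Real.sqrt_eq_iff_mul_self_eq_of_pos (by positivity), ← sq, div_pow, hab', p.ecc_sq_eq]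
    generalize ε * h = y at *
    have h2y : 3 + y * 2 ≠ 0 := by linarith
    have : 1 + y ≠ 0 := by linarith
    have : 3 + y ≠ 0 := by linarith
    have : 1 - -y * (2 + y) / (3 + 2 * y) = (1 + y) * (3 + y) / (3 + 2 * y) := by field_simp; ring
    rw [this]
    field_simp
  rw [← hEq] at hE
  obtain ⟨x, r, hr, hs⟩ := inversiveLocus_of_params hk ha hb hρ hab' p
    (fun _ h0 => hE ⟨_, Or.inl h0, rfl⟩)
    (fun _ h0 => hE ⟨ε * h, Or.inr (show _ = _ by linear_combination h0), rfl⟩)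
  exact ⟨_, r, hr, hs⟩


/-! ### Reduction of the converse to a normalized position -/

/-- The weight of the vertex opposite to the side `a`, in terms of the sides alone. -/
noncomputable def sideWeight (k : ℕ) (a b c : ℝ) : ℝ :=
  a * trilinear k a b c (Real.arccos ((b ^ 2 + c ^ 2 - a ^ 2) / (2 * b * c)))
    (Real.arccos ((c ^ 2 + a ^ 2 - b ^ 2) / (2 * c * a)))
    (Real.arccos ((a ^ 2 + b ^ 2 - c ^ 2) / (2 * a * b)))

theorem weight_eq_sideWeight {k : ℕ} {P Q R : Plane}
    (h : IsTriangle (dist Q R) (dist R P) (dist P Q) (∠ R P Q) (∠ P Q R) (∠ Q R P)) :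
    weight k P Q R = sideWeight k (dist Q R) (dist R P) (dist P Q) := by
  rw [sideWeight, ← h.cos_A, ← h.cos_B, ← h.cos_C, Real.arccos_cos (angle_nonneg _ _ _)
    (angle_le_pi _ _ _), Real.arccos_cos (angle_nonneg _ _ _) (angle_le_pi _ _ _),
    Real.arccos_cos (angle_nonneg _ _ _) (angle_le_pi _ _ _), weight]

/-- The eccentricity belonging to the parameter `h`. -/
noncomputable def eccentricity (h : ℝ) : ℝ :=
  ((h ^ 2 + 3) / (-2 * h) - √(((h ^ 2 + 3) / (-2 * h)) ^ 2 - 4)) / 2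

/-- The relation reads `ε² - B ε + 1 = 0` with `B = (h² + 3) / (-2 h) > 2`. Its roots are positive
and reciprocal to each other, and the smaller one is taken. -/
theorem eccentricity_spec {h : ℝ} (h0 : h < 0) (h1 : -1 < h) :
    FocalParams (eccentricity h) h ∧ 0 < eccentricity h := by
  obtain ⟨B, hB⟩ : ∃ B, B = (h ^ 2 + 3) / (-2 * h) := ⟨_, rfl⟩
  have hn : 0 < -2 * h := by linarith
  have hB2 : 2 < B := by
    rw [hB, lt_div_iff₀ hn]; nlinarith
  have hB4 : 0 < B ^ 2 - 4 := by nlinarith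
  obtain ⟨D, hD⟩ : ∃ D, D = √(B ^ 2 - 4) := ⟨_, rfl⟩
  have D0 : 0 < D := hD ▸ Real.sqrt_pos.2 hB4
  have D2 : D ^ 2 = B ^ 2 - 4 := by rw [hD, Real.sq_sqrt hB4.le]
  have DB : D < B := lt_of_pow_lt_pow_left₀ 2 (by linarith) (by linarith)
  have he : eccentricity h = (B - D) / 2 := by rw [eccentricity, ← hB, ← hD]
  have hrel : B * (-2 * h) = h ^ 2 + 3 := by rw [hB]; exact div_mul_cancel₀ _ hn.ne'
  have hlt : (B - D) / 2 < 1 := by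
    have : (B - 2) ^ 2 < D ^ 2 := by rw [D2]; nlinarith
    linarith [lt_of_pow_lt_pow_left₀ 2 D0.le this]
  have hpos : 0 < (B - D) / 2 := by linarith
  rw [he]
  refine ⟨⟨hpos.ne', by nlinarith, h0.ne, by nlinarith, ?_⟩, hpos⟩
  linear_combination (-(B - D) / 2) * hrel + h / 2 * D2

theorem eccentricity_inj {h h' : ℝ} (h0 : h < 0) (h1 : -1 < h) (h0' : h' < 0) (h1' : -1 < h')
    (he : eccentricity h = eccentricity h') : h = h' := by
  obtain ⟨p, e0⟩ := eccentricity_spec h0 h1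
  obtain ⟨p', -⟩ := eccentricity_spec h0' h1'
  have r := p.rel
  have r' := p'.rel
  have e1 := p.ecc_sq
  rw [← he] at r'
  generalize eccentricity h = ε at *
  have : (h - h') * (ε * (h + h') + 2 * (1 + ε ^ 2)) = 0 := by linear_combination r - r'
  rcases mul_eq_zero.1 this with h | h
  · linarith
  · nlinarith

/-- Normalized sides of the focus-inversive triangle. -/
noncomputable def normalizedSide (h : ℝ) (t : ℂ) : ℝ := 49 * (3 - h ^ 2 + 2 * h * t.re)

/-- The weight at the vertex `t₁` of the normalized focus-inversive triangle. -/
noncomputable def normalizedWeight (k : ℕ) (h : ℝ) (t₁ t₂ t₃ : ℂ) : ℝ :=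
  sideWeight k (normalizedSide h t₁) (normalizedSide h t₂) (normalizedSide h t₃)

/-- The sum of the three weights of the normalized focus-inversive triangle. -/
noncomputable def totalWeight (k : ℕ) (h : ℝ) (t₁ t₂ t₃ : ℂ) : ℝ :=
  normalizedWeight k h t₁ t₂ t₃ + normalizedWeight k h t₂ t₃ t₁ + normalizedWeight k h t₃ t₁ t₂

/-- The barycentric combination defining the center of the normalized triangle. -/
noncomputable def weightedSum (k : ℕ) (h : ℝ) (t₁ t₂ t₃ : ℂ) : ℂ :=
  normalizedWeight k h t₁ t₂ t₃ * limacon (eccentricity h) t₁ +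
    normalizedWeight k h t₂ t₃ t₁ * limacon (eccentricity h) t₂ +
    normalizedWeight k h t₃ t₁ t₂ * limacon (eccentricity h) t₃

/-- Triples of directions of the vertices of 3-periodics. -/
structure IsTriple (h : ℝ) (t₁ t₂ t₃ : ℂ) : Prop where
  norm₁ : ‖t₁‖ = 1
  norm₂ : ‖t₂‖ = 1
  norm₃ : ‖t₃‖ = 1
  sum_eq : t₁ + t₂ + t₃ = h

/-- The locus of `X_k` in normalized position. -/
def normalizedLocus (k : ℕ) (h : ℝ) : Set ℂ :=
  {Z | ∃ t₁ t₂ t₃ : ℂ, IsTriple h t₁ t₂ t₃ ∧ totalWeight k h t₁ t₂ t₃ ≠ 0 ∧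
    totalWeight k h t₁ t₂ t₃ * Z = weightedSum k h t₁ t₂ t₃}

theorem isTriangle_normalizedSide {h : ℝ} (h0 : h < 0) (h1 : -1 < h) {t₁ t₂ t₃ : ℂ}
    (T : IsTriple h t₁ t₂ t₃) : ∃ A B C : ℝ,
      IsTriangle (normalizedSide h t₁) (normalizedSide h t₂) (normalizedSide h t₃) A B C ∧
      A = Real.arccos ((normalizedSide h t₂ ^ 2 + normalizedSide h t₃ ^ 2 - normalizedSide h t₁ ^ 2) /
        (2 * normalizedSide h t₂ * normalizedSide h t₃)) ∧
      B = Real.arccos ((normalizedSide h t₃ ^ 2 + normalizedSide h t₁ ^ 2 - normalizedSide h t₂ ^ 2) /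
        (2 * normalizedSide h t₃ * normalizedSide h t₁)) ∧
      C = Real.arccos ((normalizedSide h t₁ ^ 2 + normalizedSide h t₂ ^ 2 - normalizedSide h t₃ ^ 2) /
        (2 * normalizedSide h t₁ * normalizedSide h t₂)) := by
  obtain ⟨p, -⟩ := eccentricity_spec h0 h1
  have hr := p.ratio_pos
  have hs : 0 < 98 / √(2 * FocalParams.ratio (eccentricity h) h) := by positivity
  have hsc : ∀ x : ℝ, 98 / √(2 * FocalParams.ratio (eccentricity h) h) *
      (√(2 * FocalParams.ratio (eccentricity h) h) / 2) * x = 49 * x := by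
    intro x; field_simp; ring
  have H := isTriangle_inversePoint (f := 0) p hs T.norm₁ T.norm₂ T.norm₃ T.sum_eq
  rw [dist_inversePoint p hs T.norm₁ T.norm₂ T.norm₃ T.sum_eq,
    dist_inversePoint p hs T.norm₂ T.norm₃ T.norm₁ (by rw [← T.sum_eq]; ring),
    dist_inversePoint p hs T.norm₃ T.norm₁ T.norm₂ (by rw [← T.sum_eq]; ring), hsc, hsc, hsc] at H
  refine ⟨_, _, _, H, ?_, ?_, ?_⟩
  · rw [normalizedSide, normalizedSide, normalizedSide, ← H.cos_A,
      Real.arccos_cos (angle_nonneg _ _ _) (angle_le_pi _ _ _)]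
  · rw [normalizedSide, normalizedSide, normalizedSide, ← H.cos_B,
      Real.arccos_cos (angle_nonneg _ _ _) (angle_le_pi _ _ _)]
  · rw [normalizedSide, normalizedSide, normalizedSide, ← H.cos_C,
      Real.arccos_cos (angle_nonneg _ _ _) (angle_le_pi _ _ _)]

/-- For this value of `s` the sides are exactly the normalized ones, so the homogeneity of the
trilinears need not be used. -/
theorem isKimberlingCenter_inversePoint_iff_normalized {k : ℕ} {h : ℝ} (h0 : h < 0) (h1 : -1 < h)
    {f s : ℝ} (hs : s = 98 / √(2 * FocalParams.ratio (eccentricity h) h)) {t₁ t₂ t₃ : ℂ}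
    (T : IsTriple h t₁ t₂ t₃) (Z : ℂ) :
    IsKimberlingCenter k (inversePoint f s (eccentricity h) t₁) (inversePoint f s (eccentricity h) t₂)
      (inversePoint f s (eccentricity h) t₃) (toPlane (f + s * Z)) ↔
      totalWeight k h t₁ t₂ t₃ ≠ 0 ∧ totalWeight k h t₁ t₂ t₃ * Z = weightedSum k h t₁ t₂ t₃ := by
  obtain ⟨p, -⟩ := eccentricity_spec h0 h1
  have hr := p.ratio_pos
  have hs0 : 0 < s := by rw [hs]; positivity
  have hsc : ∀ x : ℝ, s * (√(2 * FocalParams.ratio (eccentricity h) h) / 2) * x = 49 * x := by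
    intro x; rw [hs]; field_simp; ring
  have key : ∀ {u v w : ℂ}, IsTriple h u v w →
      weight k (inversePoint f s (eccentricity h) u) (inversePoint f s (eccentricity h) v)
        (inversePoint f s (eccentricity h) w) = normalizedWeight k h u v w := by
    intro u v w T
    rw [weight_eq_sideWeight (isTriangle_inversePoint p hs0 T.norm₁ T.norm₂ T.norm₃ T.sum_eq),
      dist_inversePoint p hs0 T.norm₁ T.norm₂ T.norm₃ T.sum_eq,
      dist_inversePoint p hs0 T.norm₂ T.norm₃ T.norm₁ (by rw [← T.sum_eq]; ring),
      dist_inversePoint p hs0 T.norm₃ T.norm₁ T.norm₂ (by rw [← T.sum_eq]; ring), hsc, hsc, hsc]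
    rfl
  have T2 : IsTriple h t₂ t₃ t₁ := ⟨T.norm₂, T.norm₃, T.norm₁, by rw [← T.sum_eq]; ring⟩
  have T3 : IsTriple h t₃ t₁ t₂ := ⟨T.norm₃, T.norm₁, T.norm₂, by rw [← T.sum_eq]; ring⟩
  unfold IsKimberlingCenter
  rw [key T, key T2, key T3, totalWeight, weightedSum]
  refine and_congr_right fun _ => ?_
  simp only [inversePoint, ← map_smul, ← map_add, Complex.real_smul]
  rw [toPlane.injective.eq_iff]
  have hs' : (s : ℂ) ≠ 0 := by exact_mod_cast hs0.ne'
  push_cast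
  constructor
  · intro H
    apply mul_left_cancel₀ hs'
    linear_combination H
  · intro H
    linear_combination s * H

theorem exists_normalizedLocus_eq_sphere {k : ℕ} (hk : SweepsCircle k) :
    ∃ S : Set ℝ, S.Finite ∧ ∀ h : ℝ, h < 0 → -1 < h → h ∉ S →
      ∃ (O : ℂ) (r : ℝ), 0 < r ∧ normalizedLocus k h = Metric.sphere O r := by
  obtain ⟨E, hE, H⟩ := hk
  -- The bad `h` are those whose aspect ratio lies in `E`; they are finitely many because the aspect
  -- ratio determines `h`.
  refine ⟨Set.Ioo (-1) 0 ∩ (fun h => 1 / √(1 - eccentricity h ^ 2)) ⁻¹' E, ?_, ?_⟩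
  · refine Set.Finite.of_finite_image (f := fun h => 1 / √(1 - eccentricity h ^ 2))
      (hE.subset ?_) ?_
    · rintro _ ⟨h, ⟨-, hh⟩, rfl⟩; exact hh
    · rintro h ⟨⟨h1, h0⟩, -⟩ h' ⟨⟨h1', h0'⟩, -⟩ heq
      obtain ⟨p, e0⟩ := eccentricity_spec h0 h1
      obtain ⟨p', e0'⟩ := eccentricity_spec h0' h1'
      have a1 := sub_pos.2 p.ecc_sq
      have a2 := sub_pos.2 p'.ecc_sq
      simp only [one_div, inv_inj] at heq
      rw [Real.sqrt_inj a1.le a2.le] at heq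
      exact eccentricity_inj h0 h1 h0' h1' ((sq_eq_sq₀ e0.le e0'.le).1 (by linarith))
  · intro h h0 h1 hS
    obtain ⟨p, e0⟩ := eccentricity_spec h0 h1
    have a1 := sub_pos.2 p.ecc_sq
    have hr := p.ratio_pos
    obtain ⟨s, hs⟩ : ∃ s, s = 98 / √(2 * FocalParams.ratio (eccentricity h) h) := ⟨_, rfl⟩
    have hs0 : 0 < s := by rw [hs]; positivity
    have hb : 0 < √(1 - eccentricity h ^ 2) := Real.sqrt_pos.2 a1
    have hb2 : √(1 - eccentricity h ^ 2) ^ 2 = 1 ^ 2 * (1 - eccentricity h ^ 2) := by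
      rw [Real.sq_sqrt a1.le]; ring
    have hb1 : √(1 - eccentricity h ^ 2) < 1 := by
      rw [Real.sqrt_lt' one_pos]; nlinarith [sq_nonneg (eccentricity h), pow_pos e0 2]
    have hρ : 0 < √(s * (1 - eccentricity h ^ 2)) := Real.sqrt_pos.2 (by positivity)
    -- The billiard has `a = 1` and `b² = 1 - ε²`, and `ρ² = s (1 - ε²)` makes the scale of the
    -- inversive triangle equal to `s`.
    obtain ⟨O, r, hr0, hO⟩ := H 1 _ _ (toPlane ((eccentricity h * 1 : ℝ) : ℂ)) hb hb1
      (fun hmem => hS ⟨⟨h1, h0⟩, hmem⟩) hρ (by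
        refine ⟨?_, ?_⟩
        · rw [hb2]; simp
        · simp [-mul_one])
    have hsc : √(s * (1 - eccentricity h ^ 2)) ^ 2 / (1 * (1 - eccentricity h ^ 2)) = s := by
      rw [Real.sq_sqrt (by positivity)]; field_simp
    obtain ⟨w, rfl⟩ := toPlane.surjective O
    refine ⟨(w - (eccentricity h * 1 : ℝ)) / s, r / s, by positivity, ?_⟩
    have hsC : (s : ℂ) ≠ 0 := by exact_mod_cast hs0.ne'
    ext Z
    have m1 : toPlane ((eccentricity h * 1 : ℝ) + s * Z) ∈ Metric.sphere (toPlane w) r ↔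
        Z ∈ Metric.sphere ((w - (eccentricity h * 1 : ℝ)) / s) (r / s) := by
      rw [Metric.mem_sphere, Metric.mem_sphere, toPlane.dist_map, Complex.dist_eq, Complex.dist_eq,
        eq_div_iff hs0.ne']
      have : ((eccentricity h * 1 : ℝ) + s * Z - w : ℂ) =
        (Z - (w - (eccentricity h * 1 : ℝ)) / s) * s := by field_simp; ring
      rw [this, norm_mul, Complex.norm_real, Real.norm_of_nonneg hs0.le]
    rw [← m1, ← hO, mem_inversiveLocus_iff one_pos hb hb2 p, hsc]
    constructor
    · rintro ⟨t₁, t₂, t₃, T, hZ⟩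
      exact ⟨t₁, t₂, t₃, T.norm₁, T.norm₂, T.norm₃, T.sum_eq,
        (isKimberlingCenter_inversePoint_iff_normalized h0 h1 hs T Z).2 hZ⟩
    · rintro ⟨t₁, t₂, t₃, n1, n2, n3, hsum, hZ⟩
      have T : IsTriple h t₁ t₂ t₃ := ⟨n1, n2, n3, hsum⟩
      exact ⟨t₁, t₂, t₃, T, (isKimberlingCenter_inversePoint_iff_normalized h0 h1 hs T Z).1 hZ⟩

theorem conj_mem_normalizedLocus {k : ℕ} {h : ℝ} {Z : ℂ} (hZ : Z ∈ normalizedLocus k h) :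
    (starRingEnd ℂ) Z ∈ normalizedLocus k h := by
  obtain ⟨t₁, t₂, t₃, T, hW, hZ⟩ := hZ
  have hs : ∀ t : ℂ, normalizedSide h ((starRingEnd ℂ) t) = normalizedSide h t := by
    intro t; simp [normalizedSide]
  have hw : ∀ u v w : ℂ, normalizedWeight k h ((starRingEnd ℂ) u) ((starRingEnd ℂ) v)
      ((starRingEnd ℂ) w) = normalizedWeight k h u v w := by
    intro u v w; simp only [normalizedWeight, hs]
  have hl : ∀ t : ℂ, limacon (eccentricity h) ((starRingEnd ℂ) t) =
      (starRingEnd ℂ) (limacon (eccentricity h) t) := by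
    intro t; simp [limacon]
  refine ⟨(starRingEnd ℂ) t₁, (starRingEnd ℂ) t₂, (starRingEnd ℂ) t₃,
    ⟨by simpa using T.norm₁, by simpa using T.norm₂, by simpa using T.norm₃,
      conj_sum T.sum_eq⟩, ?_, ?_⟩
  · simpa only [totalWeight, hw] using hW
  · have := congrArg (starRingEnd ℂ) hZ
    simp only [map_mul, Complex.conj_ofReal] at this
    simp only [totalWeight, hw] at this ⊢
    rw [this]
    simp only [weightedSum, hw, hl, map_add, map_mul, Complex.conj_ofReal]

/-- Three points that lie, together with their mirror images in the real axis, on a circle. -/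
theorem det_eq_zero_of_sphere {L : Set ℂ} {O : ℂ} {r : ℝ} (hL : L = Metric.sphere O r)
    (hc : ∀ Z ∈ L, (starRingEnd ℂ) Z ∈ L) {Z₁ Z₂ Z₃ : ℂ} (h₁ : Z₁ ∈ L) (h₂ : Z₂ ∈ L) (h₃ : Z₃ ∈ L) :
    (Complex.normSq Z₁ - Complex.normSq Z₂) * (Z₁.re - Z₃.re) -
      (Complex.normSq Z₁ - Complex.normSq Z₃) * (Z₁.re - Z₂.re) = 0 := by
  -- Averaging the circle equations of `Z` and its conjugate removes the term in `Im O`. Hence the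
  -- points `(Re Z, |Z|²)` are collinear, which the determinant expresses.
  have key : ∀ Z ∈ L, Complex.normSq Z - 2 * O.re * Z.re = r ^ 2 - O.re ^ 2 - O.im ^ 2 := by
    intro Z hZ
    have e1 := hc Z hZ
    rw [hL, Metric.mem_sphere, Complex.dist_eq] at hZ e1
    have f1 := congrArg (· ^ 2) hZ
    have f2 := congrArg (· ^ 2) e1
    simp only [Complex.sq_norm, Complex.normSq_apply, Complex.sub_re, Complex.sub_im,
      Complex.conj_re, Complex.conj_im] at f1 f2
    rw [Complex.normSq_apply]
    linarith
  have k1 := key _ h₁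
  have k2 := key _ h₂
  have k3 := key _ h₃
  linear_combination (Z₁.re - Z₃.re) * (k1 - k2) - (Z₁.re - Z₂.re) * (k1 - k3)


/-! ### The integer certificate at `h = -2/7` -/

/-- A polynomial expression for the trilinears of `X_k`, up to a factor common to the three
coordinates, in terms of the sides, of the cosines `x`, `y`, `z` of the angles and of
`ω = sin A / (√3 a)`, made homogeneous in `x`, `y`, `z`, `ω` by means of `e`. -/
def algTrilinear {R : Type*} [CommRing R] (k : ℕ) (a b c x y z ω e : R) : R :=
  match k with
  | 6 => a
  | 13 => (y + b * ω) * (z + c * ω)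
  | 14 => (b * ω - y) * (c * ω - z)
  | 15 => x + a * ω
  | 16 => a * ω - x
  | 17 => (y + 3 * b * ω) * (z + 3 * c * ω)
  | 18 => (3 * b * ω - y) * (3 * c * ω - z)
  | 19 => a * y * z
  | 22 => a * (b ^ 4 + c ^ 4 - a ^ 4)
  | 23 => a * (b ^ 4 + c ^ 4 - a ^ 4 - b ^ 2 * c ^ 2)
  | 24 => y * z * (2 * x ^ 2 - e ^ 2)
  | 25 => a ^ 2 * y * z
  | 26 => a * (b ^ 2 * (2 * y ^ 2 - e ^ 2) + c ^ 2 * (2 * z ^ 2 - e ^ 2) - a ^ 2 * (2 * x ^ 2 - e ^ 2))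
  | 27 => y * z * ((c + a) * (a + b))
  | 28 => a * y * z * ((c + a) * (a + b))
  | 29 => y * z * ((z + x) * (x + y))
  | 31 => a ^ 2
  | 32 => a ^ 3
  | 33 => (e + x) * y * z
  | 34 => (e - x) * y * z
  | 37 => b + c
  | 38 => b ^ 2 + c ^ 2
  | 39 => a * (b ^ 2 + c ^ 2)
  | 41 => a ^ 2 * (b + c - a)
  | 42 => a * (b + c)
  | 43 => a * b + a * c - b * c
  | 44 => b + c - 2 * a
  | 45 => 2 * b + 2 * c - a
  | 47 => 2 * x ^ 2 - e ^ 2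
  | 48 => a * x
  | 49 => 4 * x ^ 3 - 3 * e ^ 2 * x
  | 50 => a * (4 * x ^ 2 - e ^ 2)
  | 51 => a ^ 2 * (e * x + 2 * y * z)
  | 52 => (2 * x ^ 2 - e ^ 2) * (e * x + 2 * y * z)
  | 53 => a * y * z * (e * x + 2 * y * z)
  | 54 => (e * y + 2 * z * x) * (e * z + 2 * x * y)
  | 58 => a * ((c + a) * (a + b))
  | 59 => (e ^ 2 - e * y - 2 * z * x) * (e ^ 2 - e * z - 2 * x * y)
  | 60 => (e ^ 2 + e * y + 2 * z * x) * (e ^ 2 + e * z + 2 * x * y)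
  | 61 => x + 3 * a * ω
  | 62 => 3 * a * ω - x
  | 64 => (e * y - z * x) * (e * z - x * y)
  | 66 => b * (c ^ 4 + a ^ 4 - b ^ 4) * (c * (a ^ 4 + b ^ 4 - c ^ 4))
  | 67 => b * (c ^ 4 + a ^ 4 - b ^ 4 - c ^ 2 * a ^ 2) *
      (c * (a ^ 4 + b ^ 4 - c ^ 4 - a ^ 2 * b ^ 2))
  | 68 => x * (2 * y ^ 2 - e ^ 2) * (2 * z ^ 2 - e ^ 2)
  | 69 => x * (b ^ 2 * c ^ 2)
  | 70 => b * (c ^ 2 * (2 * z ^ 2 - e ^ 2) + a ^ 2 * (2 * x ^ 2 - e ^ 2) - b ^ 2 * (2 * y ^ 2 - e ^ 2)) *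
      (c * (a ^ 2 * (2 * x ^ 2 - e ^ 2) + b ^ 2 * (2 * y ^ 2 - e ^ 2) - c ^ 2 * (2 * z ^ 2 - e ^ 2)))
  | 71 => (b + c) * x
  | 73 => x * (y + z)
  | 74 => (e * y - 2 * z * x) * (e * z - 2 * x * y)
  | 75 => b ^ 2 * c ^ 2
  | 76 => b ^ 3 * c ^ 3
  | 77 => x * ((e + y) * (e + z))
  | 81 => (c + a) * (a + b)
  | 82 => (c ^ 2 + a ^ 2) * (a ^ 2 + b ^ 2)
  | 83 => b * c * ((c ^ 2 + a ^ 2) * (a ^ 2 + b ^ 2))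
  | 85 => b ^ 2 * c ^ 2 * ((c + a - b) * (a + b - c))
  | 86 => b * c * ((c + a) * (a + b))
  | 87 => (b * c + b * a - c * a) * (c * a + c * b - a * b)
  | 88 => (c + a - 2 * b) * (a + b - 2 * c)
  | 89 => (2 * c + 2 * a - b) * (2 * a + 2 * b - c)
  | 91 => (2 * y ^ 2 - e ^ 2) * (2 * z ^ 2 - e ^ 2)
  | 92 => (e * x + y * z) * (y * z)
  | 93 => (4 * y ^ 3 - 3 * e ^ 2 * y) * (4 * z ^ 3 - 3 * e ^ 2 * z)
  | 94 => (e * x + y * z) * ((4 * y ^ 2 - e ^ 2) * (4 * z ^ 2 - e ^ 2))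
  | 95 => (e * y + 2 * z * x) * (e * z + 2 * x * y) * (b ^ 2 * c ^ 2)
  | 96 => (2 * y ^ 2 - e ^ 2) * (2 * z ^ 2 - e ^ 2) * ((e * y + 2 * z * x) * (e * z + 2 * x * y))
  | 97 => x * (b * c) * ((e * y + 2 * z * x) * (e * z + 2 * x * y))
  | 98 => b * (c ^ 4 + a ^ 4 - b ^ 2 * c ^ 2 - b ^ 2 * a ^ 2) *
      (c * (a ^ 4 + b ^ 4 - c ^ 2 * a ^ 2 - c ^ 2 * b ^ 2))
  | 99 => b * (c ^ 2 - a ^ 2) * (c * (a ^ 2 - b ^ 2))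
  | _ => 0

/-- The ring `ℤ[√57, √345]`. -/
abbrev Biquadratic := QuadraticAlgebra (QuadraticAlgebra ℤ 57 0) 345 0

/-- The element `r + s √57 + t √345 + u √57 √345`. -/
def biquad (r s t u : ℤ) : Biquadratic := ⟨⟨r, s⟩, ⟨t, u⟩⟩

/-- The weight of a vertex of a triangle with integer sides and cosines `x / e`, `y / e`, `z / e`,
up to a common factor. -/
def biquadWeight (k : ℕ) (a b c x y z e : ℤ) (ω : Biquadratic) : Biquadratic :=
  biquad a 0 0 0 * algTrilinear k (biquad a 0 0 0) (biquad b 0 0 0) (biquad c 0 0 0)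
    (biquad x 0 0 0) (biquad y 0 0 0) (biquad z 0 0 0) ω (biquad e 0 0 0)

/-- The circular indices, and the indices `7` and `30` of a fixed center and of a center at
infinity. -/
def specialIndices : List ℕ :=
  [1, 2, 3, 4, 5, 7, 8, 9, 10, 11, 12, 20, 21, 30, 35, 36, 40, 46, 55, 56, 57, 63, 65, 72, 78, 79,
    80, 84, 90, 100]

/-- The number `14 * 784 * y * (1 + ε * x)` for `x = x' / 14` and `y = y' / 14`. -/
def scaledLimacon (x' y' : ℤ) : Biquadratic :=
  biquad (y' * (784 + 151 * x')) 0 0 (-(y' * x'))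

/-- With respect to the 3-periodics with apex direction `1`, `-1` and `(-1 + 4 √3 i) / 7` for
`h = -2 / 7`, an expression that can only vanish if the three centers `X_k` lie on a circle with
center on the axis, or if one of them is undefined. -/
def circleDefect (k : ℕ) : Biquadratic :=
  -- At `h = -2/7` the sides are `143 - 28 Re t`, and the real parts are multiples of `1/14`. The
  -- last integer argument is a common denominator of the cosines. The first two triangles are
  -- isosceles, so the weights at the base agree and are counted twice.
  let u₁ := biquadWeight k 115 161 161 1679 805 805 2254 (biquad 0 1 0 0)
  let u₂ := biquadWeight k 161 161 115 805 805 1679 2254 (biquad 0 1 0 0)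
  let v₁ := biquadWeight k 171 133 133 969 3591 3591 5586 (biquad 0 0 1 0)
  let v₂ := biquadWeight k 133 133 171 3591 3591 969 5586 (biquad 0 0 1 0)
  let w₁ := biquadWeight k 147 169 121 22197 9087 30063 42042 (biquad 0 0 0 1)
  let w₂ := biquadWeight k 169 121 147 9087 30063 22197 42042 (biquad 0 0 0 1)
  let w₃ := biquadWeight k 121 147 169 30063 22197 9087 42042 (biquad 0 0 0 1)
  let D₁ := u₁ + 2 * u₂
  let D₂ := v₁ + 2 * v₂
  let D₃ := w₁ + w₂ + w₃
  let N₁ := u₁ * scaledLimacon 14 14 + 2 * u₂ * scaledLimacon (-9) (-9)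
  let N₂ := v₁ * scaledLimacon (-14) (-14) + 2 * v₂ * scaledLimacon 5 5
  let X := w₁ * scaledLimacon (-2) (-2) + w₂ * scaledLimacon (-13) (-13) + w₃ * scaledLimacon 11 11
  let Y := w₁ * scaledLimacon (-2) 8 + w₂ * scaledLimacon (-13) (-3) + w₃ * scaledLimacon 11 (-5)
  -- The first two centers are real points `x₁`, `x₂`. Besides the denominators, the factors express
  -- `x₁ ≠ x₂` and `(x₃ - x₁) (x₃ - x₂) + y₃² ≠ 0`, that is, the third center is off the circle with
  -- diameter `x₁ x₂`; `Y` omits the factor `√3` of the imaginary part.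
  D₁ * D₂ * D₃ * (N₁ * D₂ - N₂ * D₁) *
    ((X * D₁ - N₁ * D₃) * (X * D₂ - N₂ * D₃) + 3 * (Y * Y) * (D₁ * D₂))

-- The iterated norm is an integer, so the nonvanishing of a real number in a biquadratic field is
-- decided by integer arithmetic.
set_option maxRecDepth 100000 in
theorem norm_circleDefect_ne_zero : ∀ k ∈ Finset.Icc 1 100, k ∈ specialIndices ∨
    QuadraticAlgebra.norm (QuadraticAlgebra.norm (circleDefect k)) ≠ 0 := by
  decide +kernel


/-! ### Trilinears as polynomials in sides, cosines and `sin A / (√3 a)` -/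

/-- The positive factor, invariant under rotation, by which `trilinear` exceeds `algTrilinear`;
here `x`, `y`, `z` are the cosines of the angles and `σ = sin A / a`. -/
noncomputable def trilinearScale (k : ℕ) (a b c x y z σ : ℝ) : ℝ :=
  match k with
  | 13 | 14 => 3 / 4
  | 15 | 16 => √3 / 2
  | 17 | 18 => 1 / 4
  | 19 | 50 | 53 => σ
  | 25 => σ ^ 2
  | 27 | 58 | 81 | 86 => 1 / ((a + b) * (b + c) * (c + a))
  | 28 => σ / ((a + b) * (b + c) * (c + a))
  | 29 => 1 / ((x + y) * (y + z) * (z + x))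
  | 48 => 2 * σ
  | 60 => 1 / ((1 + x + 2 * y * z) * (1 + y + 2 * z * x) * (1 + z + 2 * x * y))
  | 61 | 62 => 1 / 2
  | 69 => 1 / (σ ^ 2 * (a ^ 2 * b ^ 2 * c ^ 2))
  | 75 | 95 => 1 / (a ^ 2 * b ^ 2 * c ^ 2)
  | 76 => 1 / (a ^ 3 * b ^ 3 * c ^ 3)
  | 77 => 1 / ((1 + x) * (1 + y) * (1 + z))
  | 82 | 83 => 1 / ((a ^ 2 + b ^ 2) * (b ^ 2 + c ^ 2) * (c ^ 2 + a ^ 2))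
  | 85 => 1 / ((b + c - a) * (c + a - b) * (a + b - c))
  | 89 => 1 / ((2 * b + 2 * c - a) * (2 * c + 2 * a - b) * (2 * a + 2 * b - c))
  | 92 => 4
  | 97 => 1 / (σ * (a * b * c))
  | _ => 1

theorem trilinearScale_rotate (k : ℕ) (a b c x y z σ : ℝ) :
    trilinearScale k b c a y z x σ = trilinearScale k a b c x y z σ := by
  unfold trilinearScale
  split <;> first | rfl | (congr 1; ring)

/-- For `ω = sin A / (√3 a)`, the expressions in a triangle that are relevant for `trilinear`. -/
structure TriangleFacts (a b c A B C x y z ω : ℝ) : Prop where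
  a_pos : 0 < a
  b_pos : 0 < b
  c_pos : 0 < c
  ω_pos : 0 < ω
  cos_A : Real.cos A = x
  cos_B : Real.cos B = y
  cos_C : Real.cos C = z
  sin_A : Real.sin A = a * (√3 * ω)
  sin_B : Real.sin B = b * (√3 * ω)
  sin_C : Real.sin C = c * (√3 * ω)
  cos_BC : Real.cos (B - C) = x + 2 * y * z
  cos_CA : Real.cos (C - A) = y + 2 * z * x
  cos_AB : Real.cos (A - B) = z + 2 * x * y
  sq_A : 3 * (a * ω) ^ 2 = 1 - x ^ 2
  mul_BC : 3 * (b * ω) * (c * ω) = x + y * z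
  add_x : 0 < 1 + x
  add_y : 0 < 1 + y
  add_z : 0 < 1 + z
  add_xy : 0 < x + y
  add_yz : 0 < y + z
  add_zx : 0 < z + x
  add_BC : 0 < 1 + x + 2 * y * z
  add_CA : 0 < 1 + y + 2 * z * x
  add_AB : 0 < 1 + z + 2 * x * y
  sub_a : 0 < b + c - a
  sub_b : 0 < c + a - b
  sub_c : 0 < a + b - c

namespace TriangleFacts

theorem rotate {a b c A B C x y z ω : ℝ} (h : TriangleFacts a b c A B C x y z ω) :
    TriangleFacts b c a B C A y z x ω where
  a_pos := h.b_pos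
  b_pos := h.c_pos
  c_pos := h.a_pos
  ω_pos := h.ω_pos
  cos_A := h.cos_B
  cos_B := h.cos_C
  cos_C := h.cos_A
  sin_A := h.sin_B
  sin_B := h.sin_C
  sin_C := h.sin_A
  cos_BC := h.cos_CA
  cos_CA := h.cos_AB
  cos_AB := h.cos_BC
  sq_A := by
    have h1 := Real.sin_sq_add_cos_sq B
    have h3 : √3 ^ 2 = 3 := Real.sq_sqrt (by norm_num)
    rw [h.sin_B, h.cos_B] at h1
    linear_combination h1 - (b * ω) ^ 2 * h3
  mul_BC := by
    have h1 := Real.cos_sub C A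
    have h3 : √3 ^ 2 = 3 := Real.sq_sqrt (by norm_num)
    rw [h.sin_C, h.sin_A, h.cos_C, h.cos_A, h.cos_CA] at h1
    linear_combination -h1 - c * a * ω ^ 2 * h3
  add_x := h.add_y
  add_y := h.add_z
  add_z := h.add_x
  add_xy := h.add_yz
  add_yz := h.add_zx
  add_zx := h.add_xy
  add_BC := h.add_CA
  add_CA := h.add_AB
  add_AB := h.add_BC
  sub_a := h.sub_b
  sub_b := h.sub_c
  sub_c := h.sub_a

theorem trilinearScale_pos {a b c A B C x y z ω : ℝ} (h : TriangleFacts a b c A B C x y z ω)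
    (k : ℕ) : 0 < trilinearScale k a b c x y z (√3 * ω) := by
  obtain ⟨a0, b0, c0, w0, -, -, -, -, -, -, -, -, -, -, -, x0, y0, z0, h1, h2, h3, h4, h5, h6, h7,
    h8, h9⟩ := h
  have g1 : 0 < 2 * b + 2 * c - a := by linarith
  have g2 : 0 < 2 * c + 2 * a - b := by linarith
  have g3 : 0 < 2 * a + 2 * b - c := by linarith
  unfold trilinearScale
  split <;> positivity

theorem sin_three_mul {a b c A B C x y z ω : ℝ} (h : TriangleFacts a b c A B C x y z ω) :
    Real.sin (3 * A) = a * (√3 * ω) * (4 * x ^ 2 - 1) := by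
  have r3 : √3 ^ 2 = 3 := Real.sq_sqrt (by norm_num)
  rw [Real.sin_three_mul, h.sin_A]
  linear_combination (-4 * a * √3 * ω) * h.sq_A - 4 * (a * √3 * ω) * (a * ω) ^ 2 * r3

theorem sin_add_third {a b c A B C x y z ω : ℝ} (h : TriangleFacts a b c A B C x y z ω) :
    Real.sin (A + Real.pi / 3) = √3 / 2 * (x + a * ω) := by
  rw [Real.sin_add, h.sin_A, h.cos_A, Real.cos_pi_div_three, Real.sin_pi_div_three]; ring

theorem sin_sub_third {a b c A B C x y z ω : ℝ} (h : TriangleFacts a b c A B C x y z ω) :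
    Real.sin (A - Real.pi / 3) = √3 / 2 * (a * ω - x) := by
  rw [Real.sin_sub, h.sin_A, h.cos_A, Real.cos_pi_div_three, Real.sin_pi_div_three]; ring

theorem sin_add_sixth {a b c A B C x y z ω : ℝ} (h : TriangleFacts a b c A B C x y z ω) :
    Real.sin (A + Real.pi / 6) = 1 / 2 * (x + 3 * a * ω) := by
  have r3 : √3 ^ 2 = 3 := Real.sq_sqrt (by norm_num)
  rw [Real.sin_add, h.sin_A, h.cos_A, Real.cos_pi_div_six, Real.sin_pi_div_six]
  linear_combination a * ω / 2 * r3

theorem sin_sub_sixth {a b c A B C x y z ω : ℝ} (h : TriangleFacts a b c A B C x y z ω) :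
    Real.sin (A - Real.pi / 6) = 1 / 2 * (3 * a * ω - x) := by
  have r3 : √3 ^ 2 = 3 := Real.sq_sqrt (by norm_num)
  rw [Real.sin_sub, h.sin_A, h.cos_A, Real.cos_pi_div_six, Real.sin_pi_div_six]
  linear_combination a * ω / 2 * r3

set_option maxHeartbeats 4000000 in
theorem trilinear_eq {a b c A B C x y z ω : ℝ} (h : TriangleFacts a b c A B C x y z ω)
    {k : ℕ} (h1 : 1 ≤ k) (h2 : k ≤ 100) (h3 : k ∉ specialIndices) :
    trilinear k a b c A B C =
      trilinearScale k a b c x y z (√3 * ω) * algTrilinear k a b c x y z ω 1 := by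
  interval_cases k
  all_goals first
    | (refine absurd ?_ h3; decide)
    | skip
  all_goals clear h1 h2 h3
  all_goals dsimp only [trilinear]
  all_goals try simp only [Real.cos_two_mul, Real.sin_two_mul,
    Real.cos_three_mul, h.sin_three_mul, h.rotate.sin_three_mul, h.rotate.rotate.sin_three_mul,
    h.sin_add_third, h.rotate.sin_add_third, h.rotate.rotate.sin_add_third,
    h.sin_sub_third, h.rotate.sin_sub_third, h.rotate.rotate.sin_sub_third,
    h.sin_add_sixth, h.rotate.sin_add_sixth, h.rotate.rotate.sin_add_sixth,
    h.sin_sub_sixth, h.rotate.sin_sub_sixth, h.rotate.rotate.sin_sub_sixth,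
    h.cos_A, h.cos_B, h.cos_C, h.sin_A, h.sin_B, h.sin_C, h.cos_BC, h.cos_CA, h.cos_AB]
  all_goals simp only [algTrilinear, trilinearScale]
  all_goals first
    | ring1
    | skip
  all_goals
    have r0 : 0 < √3 := by positivity
    have r3 : √3 ^ 2 = 3 := Real.sq_sqrt (by norm_num)
    have mBC := h.mul_BC
  -- Products of two sines need more than ring arithmetic: `√3 ^ 2 = 3` for the indices `13` and
  -- `14`, and also `sin B sin C = cos A + cos B cos C` for `92` and `94`.
  all_goals first
    | linear_combination (y + b * ω) * (z + c * ω) / 4 * r3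
    | linear_combination (b * ω - y) * (c * ω - z) / 4 * r3
    | linear_combination 4 * y * z * (mBC + b * ω * (c * ω) * r3)
    | linear_combination (4 * y ^ 2 - 1) * (4 * z ^ 2 - 1) * (mBC + b * ω * (c * ω) * r3)
    | skip
  all_goals
    obtain ⟨a0, b0, c0, w0, -, -, -, -, -, -, -, -, -, -, -, x0, y0, z0, xy0, yz0, zx0, BC0, CA0,
      AB0, sa, sb, sc⟩ := h
    have g1 : 2 * b + 2 * c - a ≠ 0 := (by linarith : 0 < 2 * b + 2 * c - a).ne'
    have g2 : 2 * c + 2 * a - b ≠ 0 := (by linarith : 0 < 2 * c + 2 * a - b).ne'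
    have g3 : 2 * a + 2 * b - c ≠ 0 := (by linarith : 0 < 2 * a + 2 * b - c).ne'
    have := x0.ne'; have := y0.ne'; have := z0.ne'; have := xy0.ne'; have := yz0.ne'
    have := zx0.ne'; have := BC0.ne'; have := CA0.ne'; have := AB0.ne'; have := sa.ne'
    have := sb.ne'; have := sc.ne'
  all_goals first
    | (field_simp; done)
    | rw [one_pow, one_mul, one_mul, ← add_assoc, one_div_mul_eq_div, mul_assoc (1 + x + 2 * y * z),
        div_mul_cancel_right₀ (mul_ne_zero CA0.ne' AB0.ne'), one_div]
    | rw [one_div_mul_eq_div, mul_assoc (2 * b + 2 * c - a),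
        div_mul_cancel_right₀ (mul_ne_zero g2 g3), one_div]

end TriangleFacts


theorem algTrilinear_swap {R : Type*} [CommRing R] (k : ℕ) (a b c x y z ω e : R) :
    algTrilinear k a c b x z y ω e = algTrilinear k a b c x y z ω e := by
  unfold algTrilinear
  split <;> first | rfl | ring

theorem map_algTrilinear {R S : Type*} [CommRing R] [CommRing S] (φ : R →+* S) (k : ℕ)
    (a b c x y z ω e : R) :
    φ (algTrilinear k a b c x y z ω e) =
      algTrilinear k (φ a) (φ b) (φ c) (φ x) (φ y) (φ z) (φ ω) (φ e) := by
  unfold algTrilinear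
  split <;> first
    | rfl
    | simp only [map_add, map_sub, map_mul, map_pow, map_zero, map_ofNat]

/-- Homogeneity clears the common denominator of the cosines; the degree depends on `k` alone, so
the three weights acquire the same power. -/
theorem exists_algTrilinear_mul (k : ℕ) : ∃ d : ℕ, ∀ a b c x y z ω e l : ℝ,
    algTrilinear k a b c (l * x) (l * y) (l * z) (l * ω) (l * e) =
      l ^ d * algTrilinear k a b c x y z ω e := by
  unfold algTrilinear
  split <;> first
    | exact ⟨0, by intros; ring1⟩
    | exact ⟨1, by intros; ring1⟩
    | exact ⟨2, by intros; ring1⟩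
    | exact ⟨3, by intros; ring1⟩
    | exact ⟨4, by intros; ring1⟩
    | exact ⟨5, by intros; ring1⟩
    | exact ⟨6, by intros; ring1⟩
    | exact ⟨8, by intros; ring1⟩

/-- The embedding of `ℤ[√57, √345]` in the real numbers. -/
noncomputable def biquadHom : Biquadratic →+* ℝ where
  toFun v := v.re.re + v.re.im * √57 + (v.im.re + v.im.im * √57) * √345
  map_one' := by simp [QuadraticAlgebra.re_one, QuadraticAlgebra.im_one]
  map_zero' := by simp
  map_add' v w := by simp; ring
  map_mul' v w := by
    have h1 : √57 ^ 2 = 57 := Real.sq_sqrt (by norm_num)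
    have h2 : √345 ^ 2 = 345 := Real.sq_sqrt (by norm_num)
    simp only [QuadraticAlgebra.re_mul, QuadraticAlgebra.im_mul, QuadraticAlgebra.re_add,
      QuadraticAlgebra.im_add, QuadraticAlgebra.re_ofNat, QuadraticAlgebra.im_ofNat, zero_mul,
      mul_zero, add_zero]
    push_cast
    linear_combination -(v.re.im * w.re.im + 345 * v.im.im * w.im.im +
      (v.re.im * w.im.im + v.im.im * w.re.im) * √345) * h1 -
      (v.im.re + v.im.im * √57) * (w.im.re + w.im.im * √57) * h2

theorem biquadHom_biquad (r s t u : ℤ) :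
    biquadHom (biquad r s t u) = r + s * √57 + (t + u * √57) * √345 := rfl

theorem biquadHom_int (r : ℤ) : biquadHom (biquad r 0 0 0) = r := by
  rw [biquadHom_biquad]; simp

/-- If the real value of `v` were zero, so would be that of the iterated norm, which is a multiple
of `v`; but the iterated norm is an integer and is sent to itself. -/
theorem biquadHom_ne_zero {v : Biquadratic}
    (hv : QuadraticAlgebra.norm (QuadraticAlgebra.norm v) ≠ 0) : biquadHom v ≠ 0 := by
  intro h
  apply hv
  have h1 : biquadHom (algebraMap _ _ (QuadraticAlgebra.norm v)) = 0 := by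
    rw [QuadraticAlgebra.algebraMap_norm_eq_mul_star, map_mul, h, zero_mul]
  have h2 : biquadHom (algebraMap _ _ (algebraMap ℤ (QuadraticAlgebra ℤ 57 0)
      (QuadraticAlgebra.norm (QuadraticAlgebra.norm v)))) = 0 := by
    rw [QuadraticAlgebra.algebraMap_norm_eq_mul_star, map_mul, map_mul, h1, zero_mul]
  have h3 : biquadHom (algebraMap _ _ (algebraMap ℤ (QuadraticAlgebra ℤ 57 0)
      (QuadraticAlgebra.norm (QuadraticAlgebra.norm v)))) =
      (QuadraticAlgebra.norm (QuadraticAlgebra.norm v) : ℤ) := by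
    simp [biquadHom]
  rw [h3] at h2
  exact_mod_cast h2

theorem triangleFacts_of_isTriangle {a b c A B C x y z ω : ℝ} (h : IsTriangle a b c A B C)
    (hx : x = (b ^ 2 + c ^ 2 - a ^ 2) / (2 * b * c)) (hy : y = (c ^ 2 + a ^ 2 - b ^ 2) / (2 * c * a))
    (hz : z = (a ^ 2 + b ^ 2 - c ^ 2) / (2 * a * b)) (hω : 0 < ω)
    (hq : 3 * (a * ω) ^ 2 = 1 - x ^ 2) : TriangleFacts a b c A B C x y z ω := by
  have r3 : √3 ^ 2 = 3 := Real.sq_sqrt (by norm_num)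
  have r0 : 0 < √3 := by positivity
  have cA := h.cos_A.trans hx.symm
  have cB := h.cos_B.trans hy.symm
  have cC := h.cos_C.trans hz.symm
  have a0 := h.a_pos
  have b0 := h.b_pos
  have c0 := h.c_pos
  have sA : Real.sin A = a * (√3 * ω) := by
    refine (sq_eq_sq₀ h.sin_A_pos.le (by positivity)).1 ?_
    have := Real.sin_sq_add_cos_sq A
    rw [cA] at this
    linear_combination this - hq - (a * ω) ^ 2 * r3
  have sB : Real.sin B = b * (√3 * ω) := by
    have := h.sines_AB
    rw [sA] at this
    apply mul_left_cancel₀ a0.ne'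
    linear_combination this
  have sC : Real.sin C = c * (√3 * ω) := by
    have := h.sines_CA
    rw [sA] at this
    apply mul_left_cancel₀ a0.ne'
    linear_combination -this
  have cBC := h.cos_B_sub_C
  have cCA := h.rotate.cos_B_sub_C
  have cAB := h.rotate.rotate.cos_B_sub_C
  rw [cA, cB, cC] at cBC cCA cAB
  have hA : A = Real.pi - (B + C) := by linarith [h.sum_eq]
  have mBC : 3 * (b * ω) * (c * ω) = x + y * z := by
    have h1 := congrArg Real.cos hA
    rw [Real.cos_pi_sub, Real.cos_add, cA, cB, cC, sB, sC] at h1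
    linear_combination -h1 - b * ω * (c * ω) * r3
  have lt1 : ∀ {θ w : ℝ}, Real.cos θ = w → 0 < Real.sin θ → 0 < 1 + w := by
    intro θ w h1 h2
    have := Real.sin_sq_add_cos_sq θ
    rw [h1] at this
    nlinarith [pow_pos h2 2]
  have key : ∀ {a b c : ℝ}, 0 < a → 0 < b → 0 < c → a < b + c → b < c + a → c < a + b →
      0 < (b ^ 2 + c ^ 2 - a ^ 2) / (2 * b * c) + (c ^ 2 + a ^ 2 - b ^ 2) / (2 * c * a) := by
    intro a b c ha hb hc h1 h2 h3
    have : (b ^ 2 + c ^ 2 - a ^ 2) / (2 * b * c) + (c ^ 2 + a ^ 2 - b ^ 2) / (2 * c * a) =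
      (a + b) * ((c - a + b) * (c + a - b)) / (2 * a * b * c) := by field_simp; ring
    rw [this]
    have := sub_pos.2 h1; have := sub_pos.2 h2
    have e1 : 0 < c - a + b := by linarith
    positivity
  -- If `cos (θ - θ') = -1`, then `(cos θ + cos θ')² + (sin θ + sin θ')² = 2 + 2 cos (θ - θ') = 0`,
  -- against the positivity of the two sums.
  have ltd : ∀ {w θ θ' : ℝ}, Real.cos (θ - θ') = w → 0 < Real.sin θ → 0 < Real.sin θ' →
      0 < Real.cos θ + Real.cos θ' → 0 < 1 + w := by
    intro w θ θ' h1 h2 h3 h4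
    rcases (by linarith [Real.neg_one_le_cos (θ - θ')] : 0 ≤ 1 + w).lt_or_eq with h5 | h5
    · exact h5
    rw [Real.cos_sub] at h1
    nlinarith [Real.sin_sq_add_cos_sq θ, Real.sin_sq_add_cos_sq θ', mul_pos h2 h3,
      sq_nonneg (Real.sin θ + Real.sin θ'), sq_nonneg (Real.cos θ + Real.cos θ'), mul_pos h4 h4]
  have xy : 0 < x + y := by rw [hx, hy]; exact key a0 b0 c0 h.a_lt h.b_lt h.c_lt
  have yz : 0 < y + z := by rw [hy, hz]; exact key b0 c0 a0 h.b_lt h.c_lt h.a_lt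
  have zx : 0 < z + x := by rw [hz, hx]; exact key c0 a0 b0 h.c_lt h.a_lt h.b_lt
  exact ⟨a0, b0, c0, hω, cA, cB, cC, sA, sB, sC, by rw [cBC]; ring, by rw [cCA]; ring,
    by rw [cAB]; ring, hq, mBC, lt1 cA h.sin_A_pos, lt1 cB h.sin_B_pos, lt1 cC h.sin_C_pos, xy, yz,
    zx, by linarith [ltd rfl h.sin_B_pos h.sin_C_pos (by rwa [cB, cC]), cBC],
    by linarith [ltd rfl h.sin_C_pos h.sin_A_pos (by rwa [cC, cA]), cCA],
    by linarith [ltd rfl h.sin_A_pos h.sin_B_pos (by rwa [cA, cB]), cAB], by linarith [h.a_lt], by linarith [h.b_lt], by linarith [h.c_lt]⟩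


/-! ### Continuous dependence of the centers on `h` -/

set_option maxHeartbeats 4000000 in
theorem continuousAt_trilinear (k : ℕ) {a b c A B C x y z ω : ℝ}
    (h : TriangleFacts a b c A B C x y z ω) :
    ContinuousAt (fun v : ℝ × ℝ × ℝ × ℝ × ℝ × ℝ =>
      trilinear k v.1 v.2.1 v.2.2.1 v.2.2.2.1 v.2.2.2.2.1 v.2.2.2.2.2) (a, b, c, A, B, C) := by
  obtain ⟨a0, b0, c0, w0, cA, cB, cC, sA, sB, sC, cBC, -, -, -, -, x0, y0, z0, xy0, yz0, zx0,
    BC0, -, -, sa, sb, sc⟩ := h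
  have sA0 : Real.sin A ≠ 0 := by rw [sA]; positivity
  have e1 : Real.cos B + Real.cos C ≠ 0 := by rw [cB, cC]; exact yz0.ne'
  have e2 : 1 + Real.cos A ≠ 0 := by rw [cA]; exact x0.ne'
  have e3 : 1 - Real.cos A ≠ 0 := by
    intro h
    have := Real.sin_sq_add_cos_sq A
    rw [← eq_of_sub_eq_zero h] at this
    exact sA0 (by nlinarith)
  have e4 : 1 + Real.cos (B - C) ≠ 0 := by rw [cBC, ← add_assoc]; exact BC0.ne'
  have e5 : 2 * b + 2 * c - a ≠ 0 := by linarith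
  have e6 : b + c ≠ 0 := by positivity
  have e7 : b ^ 2 + c ^ 2 ≠ 0 := by positivity
  unfold trilinear
  split <;> fun_prop (disch := first | assumption | positivity)

theorem continuousAt_sideWeight (k : ℕ) {a b c x y z ω : ℝ} (h : TriangleFacts a b c
    (Real.arccos ((b ^ 2 + c ^ 2 - a ^ 2) / (2 * b * c)))
    (Real.arccos ((c ^ 2 + a ^ 2 - b ^ 2) / (2 * c * a)))
    (Real.arccos ((a ^ 2 + b ^ 2 - c ^ 2) / (2 * a * b))) x y z ω) {f g l : ℝ → ℝ} {h₀ : ℝ}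
    (hf : ContinuousAt f h₀) (hg : ContinuousAt g h₀) (hl : ContinuousAt l h₀)
    (ea : f h₀ = a) (eb : g h₀ = b) (ec : l h₀ = c) :
    ContinuousAt (fun h => sideWeight k (f h) (g h) (l h)) h₀ := by
  have a0 := h.a_pos.ne'
  have b0 := h.b_pos.ne'
  have c0 := h.c_pos.ne'
  have H := continuousAt_trilinear k h
  subst ea eb ec
  unfold sideWeight
  refine hf.mul (ContinuousAt.comp (f := fun h => (f h, g h, l h,
    Real.arccos ((g h ^ 2 + l h ^ 2 - f h ^ 2) / (2 * g h * l h)),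
    Real.arccos ((l h ^ 2 + f h ^ 2 - g h ^ 2) / (2 * l h * f h)),
    Real.arccos ((f h ^ 2 + g h ^ 2 - l h ^ 2) / (2 * f h * g h)))) H ?_)
  have A := Real.continuous_arccos
  refine hf.prodMk (hg.prodMk (hl.prodMk ((A.continuousAt.comp ?_).prodMk
    ((A.continuousAt.comp ?_).prodMk (A.continuousAt.comp ?_)))))
  · exact ((hg.pow 2).add (hl.pow 2) |>.sub (hf.pow 2)).div ((hg.const_mul 2).mul hl)
      (by positivity)
  · exact ((hl.pow 2).add (hf.pow 2) |>.sub (hg.pow 2)).div ((hl.const_mul 2).mul hf)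
      (by positivity)
  · exact ((hf.pow 2).add (hg.pow 2) |>.sub (hl.pow 2)).div ((hf.const_mul 2).mul hg)
      (by positivity)

/-- With `t₁` kept fixed, two unit numbers of sum `h - t₁` are `(h - t₁) / 2 * (1 ± i u)` with `|h -
t₁|² (1 + u²) = 4`. Taking `u` as `w` times a square root that equals 1 at `h₀` selects the branch
with `u = w` there. -/
theorem exists_continuous_triple {h₀ w : ℝ} {t₁ : ℂ} (ht : ‖t₁‖ = 1) (hw : w ≠ 0)
    (hs : Complex.normSq (h₀ - t₁) * (1 + w ^ 2) = 4) :
    ∃ τ₂ τ₃ : ℝ → ℂ, ContinuousAt τ₂ h₀ ∧ ContinuousAt τ₃ h₀ ∧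
      τ₂ h₀ = (h₀ - t₁) / 2 * (1 + w * Complex.I) ∧ τ₃ h₀ = (h₀ - t₁) / 2 * (1 - w * Complex.I) ∧
      ∀ᶠ h in nhds h₀, IsTriple h t₁ (τ₂ h) (τ₃ h) := by
  have n0 : Complex.normSq (h₀ - t₁) ≠ 0 := by
    intro h; rw [h] at hs; norm_num at hs
  have hc : ContinuousAt (fun h : ℝ => Complex.normSq (h - t₁)) h₀ :=
    (Complex.continuous_normSq.comp (Complex.continuous_ofReal.sub continuous_const)).continuousAt
  have hc2 : ContinuousAt (fun h : ℝ => (4 / Complex.normSq (h - t₁) - 1) / w ^ 2) h₀ :=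
    ((continuousAt_const.div hc n0).sub continuousAt_const).div_const _
  have hv : (4 / Complex.normSq (h₀ - t₁) - 1) / w ^ 2 = 1 := by
    rw [← hs]; field_simp; ring
  have hwc : ContinuousAt (fun h : ℝ =>
      ((w * √((4 / Complex.normSq (h - t₁) - 1) / w ^ 2) : ℝ) : ℂ)) h₀ :=
    Complex.continuous_ofReal.continuousAt.comp
      (continuousAt_const.mul (Real.continuous_sqrt.continuousAt.comp hc2))
  have hsc : ContinuousAt (fun h : ℝ => ((h : ℂ) - t₁) / 2) h₀ := by fun_prop
  refine ⟨fun h => (h - t₁) / 2 *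
      (1 + (w * √((4 / Complex.normSq (h - t₁) - 1) / w ^ 2) : ℝ) * Complex.I),
    fun h => (h - t₁) / 2 *
      (1 - (w * √((4 / Complex.normSq (h - t₁) - 1) / w ^ 2) : ℝ) * Complex.I),
    hsc.mul (continuousAt_const.add (hwc.mul continuousAt_const)),
    hsc.mul (continuousAt_const.sub (hwc.mul continuousAt_const)), ?_, ?_, ?_⟩
  · simp only [hv, Real.sqrt_one, mul_one]
  · simp only [hv, Real.sqrt_one, mul_one]
  · filter_upwards [hc.eventually_ne n0,
      hc2.eventually_const_lt (show (0 : ℝ) < _ by simp only [hv]; exact one_pos)] with h e1 e2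
    have hq : (w * √((4 / Complex.normSq (h - t₁) - 1) / w ^ 2)) ^ 2 =
        4 / Complex.normSq (h - t₁) - 1 := by
      rw [mul_pow, Real.sq_sqrt e2.le]; field_simp
    generalize w * √((4 / Complex.normSq (h - t₁) - 1) / w ^ 2) = u at hq ⊢
    have hn : ∀ u : ℝ, u ^ 2 = 4 / Complex.normSq (h - t₁) - 1 →
        ‖((h : ℂ) - t₁) / 2 * (1 + u * Complex.I)‖ = 1 := by
      intro u hu
      have : ‖((h : ℂ) - t₁) / 2 * (1 + u * Complex.I)‖ ^ 2 = 1 := by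
        rw [Complex.sq_norm, map_mul, Complex.normSq_div]
        have h1 : Complex.normSq (1 + u * Complex.I) = 1 + u ^ 2 := by
          rw [Complex.normSq_apply]; simp; ring
        have h2 : Complex.normSq 2 = 4 := by rw [Complex.normSq_apply]; norm_num
        rw [h1, h2, hu]; field_simp; ring
      exact (pow_eq_one_iff_of_nonneg (norm_nonneg _) two_ne_zero).1 this
    refine ⟨ht, hn u hq, ?_, by ring⟩
    have := hn (-u) (by rw [neg_sq, hq])
    rw [← this]; push_cast; ring_nf


theorem sideWeight_eq {k d : ℕ} (h1 : 1 ≤ k) (h2 : k ≤ 100) (h3 : k ∉ specialIndices)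
    (hd : ∀ a b c x y z ω e l : ℝ, algTrilinear k a b c (l * x) (l * y) (l * z) (l * ω) (l * e) =
      l ^ d * algTrilinear k a b c x y z ω e)
    {a b c x y z e : ℤ} {ω : Biquadratic} (he : (e : ℝ) ≠ 0) (h : TriangleFacts (a : ℝ) b c
    (Real.arccos ((b ^ 2 + c ^ 2 - a ^ 2) / (2 * b * c)))
    (Real.arccos ((c ^ 2 + a ^ 2 - b ^ 2) / (2 * c * a)))
    (Real.arccos ((a ^ 2 + b ^ 2 - c ^ 2) / (2 * a * b)))
    (x / e) (y / e) (z / e) (biquadHom ω / e)) :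
    sideWeight k a b c = trilinearScale k a b c (x / e) (y / e) (z / e) (√3 * (biquadHom ω / e)) /
      e ^ d * biquadHom (biquadWeight k a b c x y z e ω) := by
  have H := hd a b c (x / e) (y / e) (z / e) (biquadHom ω / e) 1 e
  simp only [mul_div_cancel₀ _ he, mul_one] at H
  rw [sideWeight, h.trilinear_eq h1 h2 h3, biquadWeight, map_mul, map_algTrilinear]
  simp only [biquadHom_int]
  rw [H]
  field_simp

/-- Deforming one explicit orbit gives a continuous family of centers, since the total weight stays
nonzero near `h₀`. At `h₀` the positive factor between true and algebraic weights is common to the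
vertices and cancels, so the center is computed exactly. -/
theorem exists_continuous_center {k : ℕ} (h1 : 1 ≤ k) (h2 : k ≤ 100) (h3 : k ∉ specialIndices)
    {h₀ w : ℝ} (hn : h₀ < 0) (hn' : -1 < h₀) {t₁ t₂ t₃ : ℂ} (ht : ‖t₁‖ = 1) (hw : w ≠ 0)
    (hs : Complex.normSq (h₀ - t₁) * (1 + w ^ 2) = 4)
    (ht₂ : (h₀ - t₁) / 2 * (1 + w * Complex.I) = t₂)
    (ht₃ : (h₀ - t₁) / 2 * (1 - w * Complex.I) = t₃) {a b c x y z e : ℤ} {ω : Biquadratic}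
    (ha : normalizedSide h₀ t₁ = a) (hb : normalizedSide h₀ t₂ = b) (hc : normalizedSide h₀ t₃ = c)
    (he : (0 : ℝ) < e) (hx : (x / e : ℝ) = (b ^ 2 + c ^ 2 - a ^ 2) / (2 * b * c))
    (hy : (y / e : ℝ) = (c ^ 2 + a ^ 2 - b ^ 2) / (2 * c * a))
    (hz : (z / e : ℝ) = (a ^ 2 + b ^ 2 - c ^ 2) / (2 * a * b)) (hω : 0 < biquadHom ω)
    (hq : 3 * (a * (biquadHom ω / e)) ^ 2 = 1 - (x / e : ℝ) ^ 2)
    (hD : biquadHom (biquadWeight k a b c x y z e ω + biquadWeight k b c a y z x e ω +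
      biquadWeight k c a b z x y e ω) ≠ 0) :
    ∃ ζ : ℝ → ℂ, ContinuousAt ζ h₀ ∧ (∀ᶠ h in nhds h₀, ζ h ∈ normalizedLocus k h) ∧
      biquadHom (biquadWeight k a b c x y z e ω + biquadWeight k b c a y z x e ω +
        biquadWeight k c a b z x y e ω) * ζ h₀ =
      biquadHom (biquadWeight k a b c x y z e ω) * limacon (eccentricity h₀) t₁ +
      biquadHom (biquadWeight k b c a y z x e ω) * limacon (eccentricity h₀) t₂ +
      biquadHom (biquadWeight k c a b z x y e ω) * limacon (eccentricity h₀) t₃ := by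
  obtain ⟨τ₂, τ₃, c₂, c₃, e₂, e₃, hT⟩ := exists_continuous_triple ht hw hs
  rw [ht₂] at e₂
  rw [ht₃] at e₃
  have T : IsTriple h₀ t₁ t₂ t₃ := by
    have := hT.self_of_nhds; rwa [e₂, e₃] at this
  obtain ⟨A, B, C, H, rfl, rfl, rfl⟩ := isTriangle_normalizedSide hn hn' T
  rw [ha, hb, hc] at H
  have F := triangleFacts_of_isTriangle H hx hy hz (div_pos hω he) hq
  obtain ⟨d, hd⟩ := exists_algTrilinear_mul k
  have s1 : ContinuousAt (fun h : ℝ => normalizedSide h t₁) h₀ := by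
    unfold normalizedSide; fun_prop
  have sτ : ∀ τ : ℝ → ℂ, ContinuousAt τ h₀ → ContinuousAt (fun h => normalizedSide h (τ h)) h₀ := by
    intro τ hτ
    have := Complex.continuous_re.continuousAt.comp hτ
    have h' : ContinuousAt (fun h => (τ h).re) h₀ := this
    unfold normalizedSide; fun_prop
  have s2 := sτ _ c₂
  have s3 := sτ _ c₃
  have hb' : normalizedSide h₀ (τ₂ h₀) = b := by rw [e₂, hb]
  have hc' : normalizedSide h₀ (τ₃ h₀) = c := by rw [e₃, hc]
  have w1 : ContinuousAt (fun h => normalizedWeight k h t₁ (τ₂ h) (τ₃ h)) h₀ :=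
    continuousAt_sideWeight k F s1 s2 s3 ha hb' hc'
  have w2 : ContinuousAt (fun h => normalizedWeight k h (τ₂ h) (τ₃ h) t₁) h₀ :=
    continuousAt_sideWeight k F.rotate s2 s3 s1 hb' hc' ha
  have w3 : ContinuousAt (fun h => normalizedWeight k h (τ₃ h) t₁ (τ₂ h)) h₀ :=
    continuousAt_sideWeight k F.rotate.rotate s3 s1 s2 hc' ha hb'
  have v1 := sideWeight_eq h1 h2 h3 hd he.ne' F
  have v2 := sideWeight_eq h1 h2 h3 hd he.ne' F.rotate
  have v3 := sideWeight_eq h1 h2 h3 hd he.ne' F.rotate.rotate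
  rw [trilinearScale_rotate] at v2
  rw [← trilinearScale_rotate] at v3
  have S := (div_pos (F.trilinearScale_pos k) (pow_pos he d)).ne'
  generalize trilinearScale k a b c (x / e) (y / e) (z / e) (√3 * (biquadHom ω / e)) / e ^ d = σ
    at v1 v2 v3 S
  have hε : ContinuousAt eccentricity h₀ := by
    unfold eccentricity
    have : -2 * h₀ ≠ 0 := by linarith
    fun_prop (disch := assumption)
  have hl : ∀ τ : ℝ → ℂ, ContinuousAt τ h₀ →
      ContinuousAt (fun h => limacon (eccentricity h) (τ h)) h₀ := by
    intro τ hτ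
    have h' : ContinuousAt (fun h => (τ h).re) h₀ := Complex.continuous_re.continuousAt.comp hτ
    unfold limacon; fun_prop
  have cW : ContinuousAt (fun h => totalWeight k h t₁ (τ₂ h) (τ₃ h)) h₀ := (w1.add w2).add w3
  have O : ∀ {f : ℝ → ℝ}, ContinuousAt f h₀ → ContinuousAt (fun h => (f h : ℂ)) h₀ :=
    fun hf => Complex.continuous_ofReal.continuousAt.comp hf
  have cS : ContinuousAt (fun h => weightedSum k h t₁ (τ₂ h) (τ₃ h)) h₀ :=
    (((O w1).mul (hl _ continuousAt_const)).add ((O w2).mul (hl _ c₂))).add ((O w3).mul (hl _ c₃))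
  have n1 : normalizedWeight k h₀ t₁ t₂ t₃ = sideWeight k a b c := by
    rw [normalizedWeight, ha, hb, hc]
  have n2 : normalizedWeight k h₀ t₂ t₃ t₁ = sideWeight k b c a := by
    rw [normalizedWeight, ha, hb, hc]
  have n3 : normalizedWeight k h₀ t₃ t₁ t₂ = sideWeight k c a b := by
    rw [normalizedWeight, ha, hb, hc]
  have W0 : totalWeight k h₀ t₁ t₂ t₃ = σ *
      biquadHom (biquadWeight k a b c x y z e ω + biquadWeight k b c a y z x e ω +
        biquadWeight k c a b z x y e ω) := by
    rw [totalWeight, n1, n2, n3, v1, v2, v3, map_add, map_add]; ring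
  have W1 : totalWeight k h₀ t₁ (τ₂ h₀) (τ₃ h₀) ≠ 0 := by
    rw [e₂, e₃, W0]; exact mul_ne_zero S hD
  refine ⟨fun h => weightedSum k h t₁ (τ₂ h) (τ₃ h) / totalWeight k h t₁ (τ₂ h) (τ₃ h),
    cS.div (O cW) (by exact_mod_cast W1), ?_, ?_⟩
  · filter_upwards [hT, cW.eventually_ne W1] with h hT' hW
    have hW' : (totalWeight k h t₁ (τ₂ h) (τ₃ h) : ℂ) ≠ 0 := by exact_mod_cast hW
    exact ⟨_, _, _, hT', hW, mul_div_cancel₀ _ hW'⟩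
  · simp only [e₂, e₃] at W1 ⊢
    rw [W0] at W1 ⊢
    rw [weightedSum, n1, n2, n3, v1, v2, v3]
    have hS : (σ : ℂ) ≠ 0 := by exact_mod_cast S
    have hD' : (biquadHom (biquadWeight k a b c x y z e ω + biquadWeight k b c a y z x e ω +
        biquadWeight k c a b z x y e ω) : ℂ) ≠ 0 := by exact_mod_cast hD
    push_cast
    field_simp


/-! ### The indices 30 and 7 -/

theorem exists_mem_notMem_finite {S : Set ℝ} (hS : S.Finite) :
    ∃ h : ℝ, h < 0 ∧ -1 < h ∧ h ∉ S := by
  obtain ⟨h, ⟨h1, h2⟩, h3⟩ := (Set.Ioo_infinite (show (-1 : ℝ) < 0 by norm_num)).exists_notMem_finite hS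
  exact ⟨h, h2, h1, h3⟩

/-- The barycentric weights of `X₃₀`, the infinite point of the Euler line, always sum to zero. -/
theorem normalizedLocus_thirty {h : ℝ} (h0 : h < 0) (h1 : -1 < h) : normalizedLocus 30 h = ∅ := by
  refine Set.eq_empty_of_forall_notMem ?_
  rintro Z ⟨t₁, t₂, t₃, T, hW, -⟩
  apply hW
  obtain ⟨A, B, C, H, hA, hB, hC⟩ := isTriangle_normalizedSide h0 h1 T
  rw [totalWeight, normalizedWeight, normalizedWeight, normalizedWeight, sideWeight, sideWeight,
    sideWeight, ← hA, ← hB, ← hC]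
  simp only [trilinear]
  rw [H.cos_A, H.cos_B, H.cos_C]
  have := H.a_pos; have := H.b_pos; have := H.c_pos
  field_simp
  ring

theorem not_sweepsCircle_thirty : ¬ SweepsCircle 30 := by
  intro hk
  obtain ⟨S, hS, H⟩ := exists_normalizedLocus_eq_sphere hk
  obtain ⟨h, h0, h1, h2⟩ := exists_mem_notMem_finite hS
  obtain ⟨O, r, hr, hO⟩ := H h h0 h1 h2
  rw [normalizedLocus_thirty h0 h1] at hO
  exact (NormedSpace.sphere_nonempty.2 hr.le).ne_empty hO.symm

/-- These are the parts of degree 0 and 1 in `ε / 2` of the equation for the Gergonne point,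
multiplied by `t₁ t₂ t₃`; here `V t = t (3 + h² - 4 h Re t)` on the unit circle. -/
theorem sum_symmetric_eq_zero {t₁ t₂ t₃ l h : ℂ} (h1 : t₁ + t₂ + t₃ = h)
    (h2 : t₁ * t₂ + t₂ * t₃ + t₃ * t₁ = h * l) (h3 : t₁ * t₂ * t₃ = l) {V : ℂ → ℂ}
    (hV : ∀ t, V t = (3 + h ^ 2) * t - 2 * h * t ^ 2 - 2 * h) :
    V t₂ * V t₃ * (t₁ * (t₁ - h)) + V t₃ * V t₁ * (t₂ * (t₂ - h)) +
        V t₁ * V t₂ * (t₃ * (t₃ - h)) = 0 ∧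
      V t₂ * V t₃ * (t₁ * (t₁ ^ 2 - h ^ 2)) + V t₃ * V t₁ * (t₂ * (t₂ ^ 2 - h ^ 2)) +
        V t₁ * V t₂ * (t₃ * (t₃ ^ 2 - h ^ 2)) = 0 := by
  simp only [hV]
  constructor <;> grind

/-- The weights of `X₇` are inversely proportional to `3 + h² - 4 h Re tᵢ`. The stationary point is
the value at `t = h` of the polynomial `t + ε (t² + 1) / 2` that gives the limaçon on the unit
circle. -/
theorem normalizedLocus_seven {h : ℝ} (h0 : h < 0) (h1 : -1 < h) :
    normalizedLocus 7 h ⊆ {(h + eccentricity h * (1 + h ^ 2) / 2 : ℂ)} := by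
  rintro Z ⟨t₁, t₂, t₃, T, hW, hZ⟩
  obtain ⟨A, B, C, H, -, -, -⟩ := isTriangle_normalizedSide h0 h1 T
  have hW' : (totalWeight 7 h t₁ t₂ t₃ : ℂ) ≠ 0 := by exact_mod_cast hW
  have hre : t₁.re + t₂.re + t₃.re = h := by
    have := congrArg Complex.re T.sum_eq; simpa using this
  have hw : ∀ {u v w : ℂ}, u.re + v.re + w.re = h → normalizedWeight 7 h u v w =
      normalizedSide h u * normalizedSide h v * normalizedSide h w /
        (49 * (3 + h ^ 2 - 4 * h * u.re)) := by
    intro u v w huvw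
    have : normalizedSide h v + normalizedSide h w - normalizedSide h u =
        49 * (3 + h ^ 2 - 4 * h * u.re) := by
      simp only [normalizedSide]; linear_combination 98 * h * huvw
    simp only [normalizedWeight, sideWeight, trilinear]
    rw [this]; ring
  have hU : ∀ {u v w : ℂ}, u.re + v.re + w.re = h →
      normalizedSide h u < normalizedSide h v + normalizedSide h w →
      ((3 + h ^ 2 - 4 * h * u.re : ℝ) : ℂ) ≠ 0 := by
    intro u v w huvw hlt
    have : normalizedSide h v + normalizedSide h w - normalizedSide h u =
        49 * (3 + h ^ 2 - 4 * h * u.re) := by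
      simp only [normalizedSide]; linear_combination 98 * h * huvw
    have : 3 + h ^ 2 - 4 * h * u.re ≠ 0 := by linarith
    exact_mod_cast this
  have u1 := hU hre H.a_lt
  have u2 := hU (by linarith : t₂.re + t₃.re + t₁.re = h) H.b_lt
  have u3 := hU (by linarith : t₃.re + t₁.re + t₂.re = h) H.c_lt
  have hV : ∀ {t : ℂ}, ‖t‖ = 1 → t * ((3 + h ^ 2 - 4 * h * t.re : ℝ) : ℂ) =
      (3 + h ^ 2) * t - 2 * h * t ^ 2 - 2 * h := by
    intro t ht
    have e1 := mul_conj_of_norm ht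
    have e2 := Complex.add_conj t
    push_cast at e2 ⊢
    linear_combination -2 * h * e1 + 2 * h * t * e2
  have v1 := hV T.norm₁
  have v2 := hV T.norm₂
  have v3 := hV T.norm₃
  have hp := sum_mul_pairs T.norm₁ T.norm₂ T.norm₃ T.sum_eq
  obtain ⟨E1, E2⟩ := sum_symmetric_eq_zero T.sum_eq hp rfl (fun t => rfl)
  simp only [← v1, ← v2, ← v3] at E1 E2
  have n1 : t₁ ≠ 0 := norm_ne_zero_iff.1 (by rw [T.norm₁]; exact one_ne_zero)
  have n2 : t₂ ≠ 0 := norm_ne_zero_iff.1 (by rw [T.norm₂]; exact one_ne_zero)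
  have n3 : t₃ ≠ 0 := norm_ne_zero_iff.1 (by rw [T.norm₃]; exact one_ne_zero)
  rw [Set.mem_singleton_iff, ← sub_eq_zero]
  apply (mul_eq_zero.1 (?_ : (totalWeight 7 h t₁ t₂ t₃ : ℂ) * _ = 0)).resolve_left hW'
  rw [mul_sub, hZ, totalWeight, weightedSum, hw hre, hw (by linarith : t₂.re + t₃.re + t₁.re = h),
    hw (by linarith : t₃.re + t₁.re + t₂.re = h), limacon_eq T.norm₁, limacon_eq T.norm₂,
    limacon_eq T.norm₃]
  generalize 3 + h ^ 2 - 4 * h * t₁.re = U₁ at *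
  generalize 3 + h ^ 2 - 4 * h * t₂.re = U₂ at *
  generalize 3 + h ^ 2 - 4 * h * t₃.re = U₃ at *
  generalize normalizedSide h t₁ = s₁
  generalize normalizedSide h t₂ = s₂
  generalize normalizedSide h t₃ = s₃
  have key : (U₂ * U₃ : ℂ) * (t₁ - h + eccentricity h / 2 * (t₁ ^ 2 - h ^ 2)) +
      U₃ * U₁ * (t₂ - h + eccentricity h / 2 * (t₂ ^ 2 - h ^ 2)) +
      U₁ * U₂ * (t₃ - h + eccentricity h / 2 * (t₃ ^ 2 - h ^ 2)) = 0 := by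
    apply mul_left_cancel₀ (mul_ne_zero (mul_ne_zero n1 n2) n3)
    linear_combination E1 + eccentricity h / 2 * E2
  push_cast
  field_simp
  linear_combination 2 * (s₁ * s₂ * s₃) * key

theorem not_sweepsCircle_seven : ¬ SweepsCircle 7 := by
  intro hk
  obtain ⟨S, hS, H⟩ := exists_normalizedLocus_eq_sphere hk
  obtain ⟨h, h0, h1, h2⟩ := exists_mem_notMem_finite hS
  obtain ⟨O, r, hr, hO⟩ := H h h0 h1 h2
  have hsub := normalizedLocus_seven h0 h1
  rw [hO] at hsub
  have e1 := hsub (show O + r ∈ Metric.sphere O r by simp [hr.le])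
  have e2 := hsub (show O - r ∈ Metric.sphere O r by simp [hr.le])
  rw [Set.mem_singleton_iff] at e1 e2
  have : (r : ℂ) = 0 := by linear_combination (e1 - e2) / 2
  exact hr.ne' (by exact_mod_cast this)


/-! ### Noncircular loci for the remaining indices -/

theorem biquadWeight_swap (k : ℕ) (a b c x y z e : ℤ) (ω : Biquadratic) :
    biquadWeight k a c b x z y e ω = biquadWeight k a b c x y z e ω := by
  rw [biquadWeight, algTrilinear_swap, biquadWeight]

theorem eccentricity_neg_two_sevenths :
    eccentricity (-2 / 7) = (151 - √57 * √345) / 56 := by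
  have h : (((-2 / 7 : ℝ) ^ 2 + 3) / (-2 * (-2 / 7))) ^ 2 - 4 = (√57 * √345 / 28) ^ 2 := by
    have : (√57 * √345) ^ 2 = 19665 := by
      rw [mul_pow, Real.sq_sqrt (by norm_num), Real.sq_sqrt (by norm_num)]; norm_num
    linear_combination (-1 / 784) * this
  rw [eccentricity, h, Real.sqrt_sq (by positivity)]
  ring

theorem limacon_re (ε : ℝ) (t : ℂ) : (limacon ε t).re = t.re * (1 + ε * t.re) := by
  simp [limacon]; ring

theorem limacon_im (ε : ℝ) (t : ℂ) : (limacon ε t).im = t.im * (1 + ε * t.re) := by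
  simp [limacon]; ring

theorem biquadHom_scaledLimacon (x y : ℤ) :
    biquadHom (scaledLimacon x y) = 10976 * (y / 14 * (1 + eccentricity (-2 / 7) * (x / 14))) := by
  rw [scaledLimacon, biquadHom_biquad, eccentricity_neg_two_sevenths]
  push_cast
  ring

/-- For two real points the determinant factors as `(x₁ - x₂) ((x₃ - x₁) (x₃ - x₂) + y₃²)`, which up
to nonzero multiples are the last two factors of `circleDefect`. -/
theorem det_ne_zero_of_defect_ne_zero {s D₁ D₂ D₃ N₁ N₂ X Y x₁ x₂ x₃ y₃ : ℝ}
    (h₁ : N₁ = s * (D₁ * x₁)) (h₂ : N₂ = s * (D₂ * x₂)) (h₃ : X = s * (D₃ * x₃))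
    (h₄ : √3 * Y = s * (D₃ * y₃)) (G : N₁ * D₂ - N₂ * D₁ ≠ 0)
    (K : (X * D₁ - N₁ * D₃) * (X * D₂ - N₂ * D₃) + 3 * (Y * Y) * (D₁ * D₂) ≠ 0) :
    (x₁ * x₁ - x₂ * x₂) * (x₁ - x₃) - (x₁ * x₁ - (x₃ * x₃ + y₃ * y₃)) * (x₁ - x₂) ≠ 0 := by
  intro h
  have r3 : √3 ^ 2 = 3 := Real.sq_sqrt (by norm_num)
  have hY : 3 * (Y * Y) = (s * D₃) ^ 2 * (y₃ * y₃) := by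
    linear_combination -(Y * Y) * r3 + (√3 * Y + s * (D₃ * y₃)) * h₄
  refine mul_ne_zero G K ?_
  rw [hY, h₁, h₂, h₃]
  linear_combination s ^ 3 * (D₁ * D₂ * D₃) ^ 2 * h

/-- The finite exceptional set may contain `h₀` itself. Continuity keeps the determinant nonzero at
nearby `h` outside that set, where `det_eq_zero_of_sphere` would make it vanish. -/
theorem not_sweepsCircle_of_det_ne_zero {k : ℕ} {ζ₁ ζ₂ ζ₃ : ℝ → ℂ} {h₀ : ℝ} (hn : h₀ < 0) (hn' : -1 < h₀)
    (c₁ : ContinuousAt ζ₁ h₀) (c₂ : ContinuousAt ζ₂ h₀) (c₃ : ContinuousAt ζ₃ h₀)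
    (m₁ : ∀ᶠ h in nhds h₀, ζ₁ h ∈ normalizedLocus k h)
    (m₂ : ∀ᶠ h in nhds h₀, ζ₂ h ∈ normalizedLocus k h)
    (m₃ : ∀ᶠ h in nhds h₀, ζ₃ h ∈ normalizedLocus k h)
    (hΔ : (Complex.normSq (ζ₁ h₀) - Complex.normSq (ζ₂ h₀)) * ((ζ₁ h₀).re - (ζ₃ h₀).re) -
      (Complex.normSq (ζ₁ h₀) - Complex.normSq (ζ₃ h₀)) * ((ζ₁ h₀).re - (ζ₂ h₀).re) ≠ 0) :
    ¬ SweepsCircle k := by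
  intro hk
  obtain ⟨S, hS, H⟩ := exists_normalizedLocus_eq_sphere hk
  have R : ∀ {ζ : ℝ → ℂ}, ContinuousAt ζ h₀ → ContinuousAt (fun h => (ζ h).re) h₀ :=
    fun hζ => Complex.continuous_re.continuousAt.comp hζ
  have N : ∀ {ζ : ℝ → ℂ}, ContinuousAt ζ h₀ → ContinuousAt (fun h => Complex.normSq (ζ h)) h₀ :=
    fun hζ => Complex.continuous_normSq.continuousAt.comp hζ
  have hc := ((((N c₁).sub (N c₂)).mul ((R c₁).sub (R c₃))).sub
    (((N c₁).sub (N c₃)).mul ((R c₁).sub (R c₂)))).eventually_ne hΔ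
  have hS' : ∀ᶠ h in nhdsWithin h₀ {h₀}ᶜ, h ∉ S := by
    have : (S \ {h₀})ᶜ ∈ nhds h₀ := (hS.sdiff).isClosed.isOpen_compl.mem_nhds (by simp)
    filter_upwards [nhdsWithin_le_nhds this, self_mem_nhdsWithin] with h e1 e2 e3
    exact e1 ⟨e3, e2⟩
  obtain ⟨h, ⟨e0, e1, e2, e3, e4, e5⟩, e6⟩ := (((eventually_lt_nhds hn).and ((eventually_gt_nhds hn').and
    (m₁.and (m₂.and (m₃.and hc))))).filter_mono nhdsWithin_le_nhds |>.and hS').exists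
  obtain ⟨O, r, -, hO⟩ := H h e0 e1 e6
  exact e5 (det_eq_zero_of_sphere hO (fun Z => conj_mem_normalizedLocus) e2 e3 e4)

theorem not_sweepsCircle_of_notMem {k : ℕ} (h1 : 1 ≤ k) (h2 : k ≤ 100) (h3 : k ∉ specialIndices) :
    ¬ SweepsCircle k := by
  have hne := biquadHom_ne_zero
    ((norm_circleDefect_ne_zero k (Finset.mem_Icc.2 ⟨h1, h2⟩)).resolve_left h3)
  have p2 : √57 ^ 2 = 57 := Real.sq_sqrt (by norm_num)
  have q2 : √345 ^ 2 = 345 := Real.sq_sqrt (by norm_num)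
  have p0 : 0 < √57 := by positivity
  have q0 : 0 < √345 := by positivity
  have r3 : √3 ^ 2 = 3 := Real.sq_sqrt (by norm_num)
  have r0 : 0 < √3 := by positivity
  have s115 : √115 ^ 2 = 115 := Real.sq_sqrt (by norm_num)
  have s171 : √171 ^ 2 = 171 := Real.sq_sqrt (by norm_num)
  have hω₁ : biquadHom (biquad 0 1 0 0) = √57 := by
    rw [biquadHom_biquad]; push_cast; ring
  have hω₂ : biquadHom (biquad 0 0 1 0) = √345 := by
    rw [biquadHom_biquad]; push_cast; ring
  have hω₃ : biquadHom (biquad 0 0 0 1) = √57 * √345 := by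
    rw [biquadHom_biquad]; push_cast; ring
  obtain ⟨u₁, hu₁⟩ : ∃ u, u = biquadWeight k 115 161 161 1679 805 805 2254
    (biquad 0 1 0 0) := ⟨_, rfl⟩
  obtain ⟨u₂, hu₂⟩ : ∃ u, u = biquadWeight k 161 161 115 805 805 1679 2254
    (biquad 0 1 0 0) := ⟨_, rfl⟩
  obtain ⟨v₁, hv₁⟩ : ∃ u, u = biquadWeight k 171 133 133 969 3591 3591 5586
    (biquad 0 0 1 0) := ⟨_, rfl⟩
  obtain ⟨v₂, hv₂⟩ : ∃ u, u = biquadWeight k 133 133 171 3591 3591 969 5586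
    (biquad 0 0 1 0) := ⟨_, rfl⟩
  obtain ⟨w₁, hw₁⟩ : ∃ u, u = biquadWeight k 147 169 121 22197 9087 30063 42042
    (biquad 0 0 0 1) := ⟨_, rfl⟩
  obtain ⟨w₂, hw₂⟩ : ∃ u, u = biquadWeight k 169 121 147 9087 30063 22197 42042
    (biquad 0 0 0 1) := ⟨_, rfl⟩
  obtain ⟨w₃, hw₃⟩ : ∃ u, u = biquadWeight k 121 147 169 30063 22197 9087 42042
    (biquad 0 0 0 1) := ⟨_, rfl⟩
  simp only [circleDefect, ← hu₁, ← hu₂, ← hv₁, ← hv₂, ← hw₁, ← hw₂, ← hw₃] at hne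
  simp only [map_mul, map_add, map_sub, map_ofNat, biquadHom_scaledLimacon,
    mul_ne_zero_iff, Int.cast_neg, Int.cast_ofNat] at hne
  obtain ⟨⟨⟨⟨D1, D2⟩, D3⟩, G⟩, K⟩ := hne
  -- In each of the three cases `w` is read off from `t₂ = (h₀ - t₁) / 2 * (1 + i w)`.
  have S₁ := exists_continuous_center (h₀ := -2 / 7) (w := √115 / 9) (t₁ := 1)
    (t₂ := ⟨-9 / 14, -√115 / 14⟩) (t₃ := ⟨-9 / 14, √115 / 14⟩) (a := 115) (b := 161) (c := 161)
    (x := 1679) (y := 805) (z := 805) (e := 2254) (ω := biquad 0 1 0 0) h1 h2 h3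
    (by norm_num) (by norm_num) (by simp) (by positivity)
    (by rw [Complex.normSq_apply]; norm_num [div_pow, s115])
    (by apply Complex.ext <;> simp <;> ring) (by apply Complex.ext <;> simp <;> ring)
    (by norm_num [normalizedSide]) (by norm_num [normalizedSide]) (by norm_num [normalizedSide])
    (by norm_num) (by norm_num) (by norm_num) (by norm_num) (by rw [hω₁]; positivity)
    (by rw [hω₁]; push_cast; linear_combination 3 * (115 / 2254) ^ 2 * p2)
  have S₂ := exists_continuous_center (h₀ := -2 / 7) (w := √171 / 5) (t₁ := -1)
    (t₂ := ⟨5 / 14, √171 / 14⟩) (t₃ := ⟨5 / 14, -√171 / 14⟩) (a := 171) (b := 133) (c := 133)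
    (x := 969) (y := 3591) (z := 3591) (e := 5586) (ω := biquad 0 0 1 0) h1 h2 h3
    (by norm_num) (by norm_num) (by simp) (by positivity)
    (by rw [Complex.normSq_apply]; norm_num [div_pow, s171])
    (by apply Complex.ext <;> simp <;> ring) (by apply Complex.ext <;> simp <;> ring)
    (by norm_num [normalizedSide]) (by norm_num [normalizedSide]) (by norm_num [normalizedSide])
    (by norm_num) (by norm_num) (by norm_num) (by norm_num) (by rw [hω₂]; positivity)
    (by rw [hω₂]; push_cast; linear_combination 3 * (171 / 5586) ^ 2 * q2)
  have S₃ := exists_continuous_center (h₀ := -2 / 7) (w := -√3) (t₁ := ⟨-1 / 7, √3 * (4 / 7)⟩)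
    (t₂ := ⟨-13 / 14, √3 * (-3 / 14)⟩) (t₃ := ⟨11 / 14, √3 * (-5 / 14)⟩) (a := 147) (b := 169)
    (c := 121) (x := 22197) (y := 9087) (z := 30063) (e := 42042)
    (ω := biquad 0 0 0 1) h1 h2 h3
    (by norm_num) (by norm_num)
    (by
      rw [← sq_eq_sq₀ (norm_nonneg _) zero_le_one, Complex.sq_norm, Complex.normSq_apply]
      linear_combination 16 / 49 * r3)
    (by simp)
    (by rw [Complex.normSq_apply]; simp; linear_combination 64 / 49 * r3)
    (by apply Complex.ext <;> simp <;> first | ring1 | linear_combination (-2 / 7) * r3)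
    (by apply Complex.ext <;> simp <;> first | ring1 | linear_combination (2 / 7) * r3)
    (by norm_num [normalizedSide]) (by norm_num [normalizedSide]) (by norm_num [normalizedSide])
    (by norm_num) (by norm_num) (by norm_num) (by norm_num) (by rw [hω₃]; positivity)
    (by
      rw [hω₃]; push_cast
      linear_combination 3 * (147 / 42042) ^ 2 * (√345 ^ 2 * p2 + 57 * q2))
  -- The two base vertices of an isosceles triangle have equal weights, so the totals take the form
  -- `u₁ + 2 u₂` and `v₁ + 2 v₂` used in `circleDefect`.
  rw [← biquadWeight_swap k 161 115 161, ← hu₁, ← hu₂] at S₁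
  rw [← biquadWeight_swap k 133 171 133, ← hv₁, ← hv₂] at S₂
  rw [← hw₁, ← hw₂, ← hw₃] at S₃
  simp only [map_add] at S₁ S₂ S₃
  obtain ⟨ζ₁, c₁, m₁, e₁⟩ := S₁ (by convert D1 using 1; ring)
  obtain ⟨ζ₂, c₂, m₂, e₂⟩ := S₂ (by convert D2 using 1; ring)
  obtain ⟨ζ₃, c₃, m₃, e₃⟩ := S₃ D3
  refine not_sweepsCircle_of_det_ne_zero (by norm_num) (by norm_num) c₁ c₂ c₃ m₁ m₂ m₃ ?_
  have a₁ := congrArg Complex.re e₁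
  have b₁ := congrArg Complex.im e₁
  have a₂ := congrArg Complex.re e₂
  have b₂ := congrArg Complex.im e₂
  have a₃ := congrArg Complex.re e₃
  have b₃ := congrArg Complex.im e₃
  simp only [Complex.add_re, Complex.add_im, Complex.re_ofReal_mul,
    Complex.im_ofReal_mul, limacon_re, limacon_im, Complex.one_re, Complex.one_im, Complex.neg_re,
    Complex.neg_im] at a₁ b₁ a₂ b₂ a₃ b₃
  -- The conjugate base directions carry equal weights, so their imaginary parts cancel and this
  -- center lies on the axis.
  have z₁ : (ζ₁ (-2 / 7)).im = 0 := by
    apply mul_left_cancel₀ D1; linear_combination b₁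
  have z₂ : (ζ₂ (-2 / 7)).im = 0 := by
    apply mul_left_cancel₀ D2; linear_combination b₂
  rw [Complex.normSq_apply, Complex.normSq_apply, Complex.normSq_apply, z₁, z₂, mul_zero, add_zero,
    add_zero]
  refine det_ne_zero_of_defect_ne_zero (s := 10976) ?_ ?_ ?_ ?_ G K
  · linear_combination -10976 * a₁
  · linear_combination -10976 * a₂
  · linear_combination -10976 * a₃
  · linear_combination -10976 * b₃

theorem mem_circularIndices_of_sweepsCircle {k : ℕ} (h1 : 1 ≤ k) (h2 : k ≤ 100)
    (hk : SweepsCircle k) : k ∈ circularIndices := by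
  by_cases h3 : k ∈ specialIndices
  · simp only [specialIndices, List.mem_cons, List.not_mem_nil, or_false] at h3
    have h7 : k ≠ 7 := fun h => not_sweepsCircle_seven (h ▸ hk)
    have h30 : k ≠ 30 := fun h => not_sweepsCircle_thirty (h ▸ hk)
    simp only [circularIndices, Set.mem_insert_iff, Set.mem_singleton_iff]
    omega
  · exact absurd hk (not_sweepsCircle_of_notMem h1 h2 h3)

theorem mainTheorem9 :
    {k : ℕ | 1 ≤ k ∧ k ≤ 100 ∧ SweepsCircle k} = circularIndices ∧
    ∀ k ∈ circularIndices, ∀ (a b ρ : ℝ) (F : Plane),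
      0 < b → b < a → 0 < ρ → F ∈ foci a b →
      (k = 46 → 2 * a ^ 2 ≠ (5 - √5) * b ^ 2) →
      (k = 90 → √(a ^ 4 - a ^ 2 * b ^ 2 + b ^ 4) *
          (2 * a ^ 2 - b ^ 2 - √(a ^ 4 - a ^ 2 * b ^ 2 + b ^ 4)) ≠
        √2 * a ^ 2 * (a ^ 2 - b ^ 2)) →
      ∃ x r : ℝ, 0 < r ∧ inversiveLocus k a b ρ F = Metric.sphere !₂[x, 0] r := by
  refine ⟨?_, ?_⟩
  · ext k
    refine ⟨fun ⟨h1, h2, hk⟩ => mem_circularIndices_of_sweepsCircle h1 h2 hk, fun hk => ?_⟩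
    have hb : 1 ≤ k ∧ k ≤ 100 := by
      simp only [circularIndices, Set.mem_insert_iff, Set.mem_singleton_iff] at hk
      omega
    exact ⟨hb.1, hb.2, sweepsCircle_of_mem hk⟩
  · exact fun k hk a b ρ F hb hba hρ hF h46 h90 =>
      inversiveLocus_circularIndices hk hb hba hρ hF h46 h90
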